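/- Let $n\ge 2$, $G=SL(n,\mathbb R)$, and let $H\cong GL(n-1,\mathbb R)$ be the subgroup of $G$ of block diagonal matrices $\mathrm{diag}((\det h)^{-1},h)$. Put $X=G/H$ and $\theta(g)={}^tg^{-1}$. Let $S$ be the unit sphere of $\mathbb R^n$ with its normalized surface measure $ds$, and let $\widetilde S=S/\{\pm1\}$, with the induced measure and the action $g.s=g(s)/\|g(s)\|$ of $G$. Via $gH\mapsto(g.\widetilde e_1,\theta(g).\widetilde e_1)$, identify $X$ with $\{(u,v)\in\widetilde S\times\widetilde S:\langle u,v\rangle\ne0\}$, with the measure $|\langle u,v\rangle|^{-n}\,du\,dv$; $L^2(X)$ is taken with respect to this measure. Let $\sigma\in\mathbb R$, $\sigma\neq0$, and put $\mu=-\frac n2+i\sigma$. For $\phi\in C^\infty(\widetilde S)$ and $s\in\widetilde S$ let $A_w\phi(s)$ be the meromorphic continuation in $w\in\mathbb C$ of $\int_{S}|\langle s,t\rangle|^{-w-n}\phi(t)\,dt$ (absolutely convergent for $\mathrm{Re}\,w<1-n$). Let $$d(\sigma)=\frac{\sqrt\pi}{\Gamma(\frac n2)}\cdot\frac{\Gamma\left(\frac{n/2+i\sigma}{2}\right)}{\Gamma\left(\frac{-n/2+i\sigma+1}{2}\right)},$$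 and let $U_\sigma$ be the bounded operator on $L^2(\widetilde S)$ that extends $d(\sigma)A_\mu$. For $f\in L^2(X)$ let $T_\sigma f\in L^2(\widetilde S\times\widetilde S)$ be the function such that, for almost every $u$, $(T_\sigma f)(u,\cdot)=U_\sigma\big(w\mapsto f(u,w)|\langle u,w\rangle|^{\mu}\big)$; that is, in the sense of analytic continuation, $(T_\sigma f)(u,v)=d(\sigma)\int_S f(u,w)|\langle u,w\rangle|^{-\frac n2+i\sigma}|\langle v,w\rangle|^{-\frac n2-i\sigma}\,dw$. Let $\mathrm{Op}_\sigma(f)$ be the Hilbert–Schmidt operator on $L^2(\widetilde S)$ with kernel $T_\sigma f$. Then $\mathrm{Op}_\sigma:L^2(X)\to\mathcal L(L^2(\widetilde S))$ is well defined (it exists and is unique) and linear. For all $f,g\in L^2(X)$ there are unique elements $f\sharp_\sigma g$ and $f^*$ of $L^2(X)$ with $$\mathrm{Op}_\sigma(f\sharp_\sigma g)=\mathrm{Op}_\sigma(f)\circ\mathrm{Op}_\sigma(g),\qquad \mathrm{Op}_\sigma(f^*)=\mathrm{Op}_\sigma(f)^*.$$ With this product and this involution the Hilbert space $L^2(X)$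 is an $H^*$-algebra (Hilbert algebra): the product is bilinear and associative, $\|f\sharp_\sigma g\|_2\le\|f\|_2\|g\|_2$, the map $f\mapsto f^*$ is conjugate linear with $f^{**}=f$, $(f\sharp_\sigma g)^*=g^*\sharp_\sigma f^*$ and $\|f^*\|_2=\|f\|_2$, one has $(f\sharp_\sigma g,h)=(g,f^*\sharp_\sigma h)$ for all $f,g,h\in L^2(X)$, and $f\sharp_\sigma f^*\ne0$ for $f\neq0$. Moreover the measure of $X$ is $G$-invariant, $\pi(x)\phi(s)=\phi(x^{-1}.s)\,\|x^{-1}(s)\|^{\mu}$ defines a unitary representation $\pi$ of $G$ (as an abstract group) on $L^2(\widetilde S)$, and for all $x\in G$ and $f,g\in L^2(X)$, with $L_xf(p)=f(x^{-1}p)$, $$\mathrm{Op}_\sigma(L_xf)=\pi(x)\,\mathrm{Op}_\sigma(f)\,\pi(x^{-1}),\qquad L_x(f\sharp_\sigma g)=(L_xf)\sharp_\sigma(L_xg).$$ -/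

import Mathlib

open MeasureTheory Filter
open scoped ContDiff ComplexConjugate Matrix.SpecialLinearGroup

namespace ParaHermitian

/-! ### The group `G = SL(n, ℝ)`, the subgroup `H ≃ GL(n-1, ℝ)`, the Cartan involution -/

/-- `G = SL(n, ℝ)`. -/
abbrev G (n : ℕ) : Type := Matrix.SpecialLinearGroup (Fin n) ℝ

/-- `ℝⁿ` with its Euclidean structure. -/
abbrev E (n : ℕ) : Type := EuclideanSpace ℝ (Fin n)

/-- The Cartan involution `θ(g) = ᵗg⁻¹` of `G`. -/
def theta {n : ℕ} (g : G n) : G n := Matrix.SpecialLinearGroup.transpose g⁻¹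

theorem theta_mul {n : ℕ} (g h : G n) : theta (g * h) = theta g * theta h := by
  apply Subtype.ext
  simp only [theta, mul_inv_rev, Matrix.SpecialLinearGroup.coe_transpose,
    Matrix.SpecialLinearGroup.coe_mul, Matrix.transpose_mul]

/-- The subgroup `H` of block diagonal matrices `diag(a, A)` with `a ∈ ℝ` and `A` of size `n - 1`.
As `a * det A = 1`, this is the image of `GL(n-1, ℝ)` under `A ↦ diag((det A)⁻¹, A)`. -/
def H (n : ℕ) [NeZero n] : Subgroup (G n) where
  carrier := {g | ∀ j : Fin n, j ≠ 0 → g.1 0 j = 0 ∧ g.1 j 0 = 0}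
  one_mem' := by
    intro j hj
    simp [hj, hj.symm]
  mul_mem' := by
    intro a b ha hb j hj
    constructor
    · rw [Matrix.SpecialLinearGroup.coe_mul, Matrix.mul_apply]
      refine Finset.sum_eq_zero fun k _ => ?_
      by_cases hk : k = 0
      · rw [hk, (hb j hj).1, mul_zero]
      · rw [(ha k hk).1, zero_mul]
    · rw [Matrix.SpecialLinearGroup.coe_mul, Matrix.mul_apply]
      refine Finset.sum_eq_zero fun k _ => ?_
      by_cases hk : k = 0
      · rw [hk, (ha j hj).2, zero_mul]
      · rw [(hb k hk).2, mul_zero]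
  inv_mem' := by
    intro a ha j hj
    have h1 : ((a⁻¹).1 * a.1) = 1 := by
      rw [← Matrix.SpecialLinearGroup.coe_mul, inv_mul_cancel, Matrix.SpecialLinearGroup.coe_one]
    have h2 : (a.1 * (a⁻¹).1) = 1 := by
      rw [← Matrix.SpecialLinearGroup.coe_mul, mul_inv_cancel, Matrix.SpecialLinearGroup.coe_one]
    have key1 : ∀ i, (a⁻¹).1 i 0 * a.1 0 0 = (1 : Matrix (Fin n) (Fin n) ℝ) i 0 := by
      intro i
      rw [← h1, Matrix.mul_apply, Finset.sum_eq_single 0]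
      · intro k _ hk
        rw [(ha k hk).2, mul_zero]
      · simp
    have key2 : ∀ i, a.1 0 0 * (a⁻¹).1 0 i = (1 : Matrix (Fin n) (Fin n) ℝ) 0 i := by
      intro i
      rw [← h2, Matrix.mul_apply, Finset.sum_eq_single 0]
      · intro k _ hk
        rw [(ha k hk).1, zero_mul]
      · simp
    have h0 : a.1 0 0 ≠ 0 := by
      intro h
      have := key1 0
      simp [h] at this
    constructor
    · have := key2 j
      rw [Matrix.one_apply_ne hj.symm] at this
      exact (mul_eq_zero.1 this).resolve_left h0
    · have := key1 j
      rw [Matrix.one_apply_ne hj] at this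
      exact (mul_eq_zero.1 this).resolve_right h0

theorem theta_mem_H {n : ℕ} [NeZero n] {h : G n} (hh : h ∈ H n) : theta h ∈ H n := by
  intro j hj
  have := (H n).inv_mem hh j hj
  exact ⟨this.2, this.1⟩

/-- The linear action of `G` on `ℝⁿ`. -/
noncomputable def linAct {n : ℕ} (g : G n) (x : E n) : E n :=
  WithLp.toLp 2 (g.1.mulVec x.ofLp)

theorem linAct_mul {n : ℕ} (g h : G n) (x : E n) : linAct (g * h) x = linAct g (linAct h x) := by
  simp [linAct, Matrix.mulVec_mulVec]

theorem linAct_one {n : ℕ} (x : E n) : linAct 1 x = x := by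
  simp [linAct]

theorem linAct_smul {n : ℕ} (g : G n) (c : ℝ) (x : E n) : linAct g (c • x) = c • linAct g x := by
  simp [linAct, Matrix.mulVec_smul]

theorem linAct_neg {n : ℕ} (g : G n) (x : E n) : linAct g (-x) = -linAct g x := by
  simp [linAct, Matrix.mulVec_neg]

theorem linAct_ne_zero {n : ℕ} (g : G n) {x : E n} (hx : x ≠ 0) : linAct g x ≠ 0 := by
  intro h
  apply hx
  have h2 : linAct (g⁻¹ * g) x = 0 := by
    rw [linAct_mul, h]
    simp [linAct]
  rwa [inv_mul_cancel, linAct_one] at h2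

/-! ### The sphere `S`, the projective sphere `S̃ = S/±` and the action of `G` -/

/-- The unit sphere `S` of `ℝⁿ`. -/
abbrev Sph (n : ℕ) : Type := Metric.sphere (0 : E n) 1

theorem Sph.ne_zero {n : ℕ} (s : Sph n) : (s : E n) ≠ 0 := by
  intro h
  have := norm_eq_of_mem_sphere s
  rw [h] at this
  simp at this

/-- `g.s = g(s) / ‖g(s)‖` on `S`. -/
noncomputable def sphAct {n : ℕ} (g : G n) (s : Sph n) : Sph n :=
  ⟨‖linAct g s‖⁻¹ • linAct g s, by
    have h : ‖linAct g (s : E n)‖ ≠ 0 := norm_ne_zero_iff.2 (linAct_ne_zero g s.ne_zero)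
    rw [mem_sphere_zero_iff_norm, norm_smul, norm_inv, norm_norm, inv_mul_cancel₀ h]⟩

/-- The relation `s ∼ s'` iff `s = ± s'`. -/
def antipodal (n : ℕ) : Setoid (Sph n) where
  r s t := s = t ∨ s = -t
  iseqv := by
    refine ⟨fun _ => Or.inl rfl, ?_, ?_⟩
    · rintro s t (h | h)
      · exact Or.inl h.symm
      · exact Or.inr (by rw [h, neg_neg])
    · rintro s t u (rfl | rfl) (rfl | rfl)
      · exact Or.inl rfl
      · exact Or.inr rfl
      · exact Or.inr rfl
      · exact Or.inl (neg_neg _)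

/-- `S̃ = S/∼`. -/
def PSph (n : ℕ) : Type := Quotient (antipodal n)

/-- The class in `S̃` of a point of `S`. -/
def PSph.mk {n : ℕ} (s : Sph n) : PSph n := Quotient.mk (antipodal n) s

/-- The quotient `σ`-algebra, i.e. the even Borel sets of `S`. -/
instance (n : ℕ) : MeasurableSpace (PSph n) :=
  inferInstanceAs (MeasurableSpace (Quotient (antipodal n)))

/-- The normalized surface measure `ds` on `S`. -/
noncomputable def surf (n : ℕ) : Measure (Sph n) :=
  ((volume : Measure (E n)).toSphere Set.univ)⁻¹ • (volume : Measure (E n)).toSphere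

/-- The measure `ds` on `S̃`: functions on `S̃` are even functions on `S`, with the same integrals. -/
noncomputable def nu (n : ℕ) : Measure (PSph n) := (surf n).map PSph.mk

theorem sphAct_neg {n : ℕ} (g : G n) (s : Sph n) : sphAct g (-s) = -sphAct g s := by
  apply Subtype.ext
  simp [sphAct, linAct_neg]

theorem sphAct_mul {n : ℕ} (g h : G n) (s : Sph n) :
    sphAct (g * h) s = sphAct g (sphAct h s) := by
  apply Subtype.ext
  have h0 : ‖linAct h (s : E n)‖ ≠ 0 := norm_ne_zero_iff.2 (linAct_ne_zero h s.ne_zero)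
  simp only [sphAct, linAct_mul, linAct_smul, norm_smul, norm_inv, norm_norm, smul_smul]
  congr 1
  field_simp

/-- The action `g.s` of `G` on `S̃`. -/
noncomputable def act {n : ℕ} (g : G n) : PSph n → PSph n :=
  Quotient.lift (fun s => PSph.mk (sphAct g s)) (by
    rintro s t (rfl | rfl)
    · rfl
    · exact Quotient.sound (Or.inr (sphAct_neg g t)))

theorem act_mul {n : ℕ} (g h : G n) (u : PSph n) : act (g * h) u = act g (act h u) := by
  induction u using Quotient.ind with
  | _ s => exact congrArg PSph.mk (sphAct_mul g h s)

/-- `‖g(s)‖` as a function of the class of `s` in `S̃`. -/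
noncomputable def stretch {n : ℕ} (g : G n) : PSph n → ℝ :=
  Quotient.lift (fun s : Sph n => ‖linAct g s‖) (by
    rintro s t (rfl | rfl)
    · rfl
    · simp [linAct_neg])

/-- `|⟨u, v⟩|` as a function on `S̃ × S̃`. -/
noncomputable def absInner {n : ℕ} : PSph n → PSph n → ℝ :=
  Quotient.lift₂ (fun s t : Sph n => |inner ℝ (s : E n) (t : E n)|) (by
    rintro s t s' t' (rfl | rfl) (rfl | rfl) <;> simp)

/-- The first basis vector, as a point of `S`. -/
noncomputable def e1 (n : ℕ) [NeZero n] : Sph n :=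
  ⟨EuclideanSpace.single 0 1, by simp⟩

theorem act_e1 {n : ℕ} [NeZero n] {h : G n} (hh : h ∈ H n) :
    act h (PSph.mk (e1 n)) = PSph.mk (e1 n) := by
  have h1 : linAct h (e1 n : E n) = h.1 0 0 • (e1 n : E n) := by
    ext i
    by_cases hi : i = 0
    · subst hi
      simp [linAct, e1]
    · simp [linAct, e1, hi, (hh i hi).2]
  have h0 : h.1 0 0 ≠ 0 := by
    intro h'
    rw [h', zero_smul] at h1
    exact linAct_ne_zero h (e1 n).ne_zero h1
  have hn : ‖(e1 n : E n)‖ = 1 := norm_eq_of_mem_sphere _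
  apply Quotient.sound
  rcases lt_or_gt_of_ne h0 with hlt | hgt
  · right
    apply Subtype.ext
    simp only [sphAct, h1, norm_smul, hn, mul_one, smul_smul, Real.norm_eq_abs, abs_of_neg hlt]
    rw [inv_neg, neg_mul, inv_mul_cancel₀ h0, neg_one_smul]
    rfl
  · left
    apply Subtype.ext
    simp only [sphAct, h1, norm_smul, hn, mul_one, smul_smul, Real.norm_eq_abs, abs_of_pos hgt]
    rw [inv_mul_cancel₀ h0, one_smul]

/-! ### The symmetric space `X = G/H` and the Hilbert spaces `L²(S̃)`, `L²(S̃ × S̃)`, `L²(X)` -/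

/-- `X = G/H`. -/
def X (n : ℕ) [NeZero n] : Type := G n ⧸ H n

noncomputable instance (n : ℕ) [NeZero n] : MulAction (G n) (X n) :=
  inferInstanceAs (MulAction (G n) (G n ⧸ H n))

instance (n : ℕ) [NeZero n] : TopologicalSpace (X n) :=
  inferInstanceAs (TopologicalSpace (G n ⧸ H n))

instance (n : ℕ) [NeZero n] : MeasurableSpace (X n) := borel (X n)

/-- The identification `gH ↦ (g.e₁, θ(g).e₁)` of `X` with the open orbit `⟨u, v⟩ ≠ 0` of
`S̃ × S̃`, for the action `g(u, v) = (g.u, θ(g).v)`. -/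
noncomputable def orbitMap (n : ℕ) [NeZero n] : X n → PSph n × PSph n :=
  Quotient.lift (s := QuotientGroup.leftRel (H n))
    (fun g : G n => (act g (PSph.mk (e1 n)), act (theta g) (PSph.mk (e1 n)))) (by
      intro a b hab
      have hh : a⁻¹ * b ∈ H n := QuotientGroup.leftRel_apply.1 hab
      have hb : b = a * (a⁻¹ * b) := by group
      have h1 := act_e1 hh
      have h2 := act_e1 (theta_mem_H hh)
      rw [hb]
      simp only [theta_mul a (a⁻¹ * b), act_mul a (a⁻¹ * b), act_mul (theta a), h1, h2])

/-- The `G`-invariant measure `|⟨x, y⟩|⁻ⁿ dx dy` on `X`. -/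
noncomputable def muX (n : ℕ) [NeZero n] : Measure (X n) :=
  Measure.comap (orbitMap n)
    (((nu n).prod (nu n)).withDensity fun p => ENNReal.ofReal ((absInner p.1 p.2 ^ n)⁻¹))

/-- `L²(S̃)`. -/
noncomputable abbrev L2S (n : ℕ) := Lp ℂ 2 (nu n)

/-- `L²(S̃ × S̃)`. -/
noncomputable abbrev L2SS (n : ℕ) := Lp ℂ 2 ((nu n).prod (nu n))

/-- `L²(X)`. -/
noncomputable abbrev L2X (n : ℕ) [NeZero n] := Lp ℂ 2 (muX n)

/-! ### The intertwining operators -/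

/-- `φ ∈ C^∞(S̃)`: the even function `φ` on `S` is the restriction of a smooth function. -/
def IsSmooth {n : ℕ} (φ : PSph n → ℂ) : Prop :=
  ∃ Φ : E n → ℂ, ContDiff ℝ ∞ Φ ∧ ∀ s : Sph n, φ (PSph.mk s) = Φ s

/-- `z = (A_μ φ)(s)`, where `A_μ φ(s) = ∫ |⟨s, t⟩|^(-μ-n) φ(t) dt` for `Re μ < 1 - n` (the domain of
absolute convergence), and the value at other `μ` is that of the meromorphic continuation in `μ`,
which has to be regular at `μ`. -/
def IsAValue {n : ℕ} (μ : ℂ) (φ : PSph n → ℂ) (s : PSph n) (z : ℂ) : Prop :=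
  ∃ F : ℂ → ℂ, Meromorphic F ∧ AnalyticAt ℂ F μ ∧ F μ = z ∧
    ∀ w : ℂ, w.re < 1 - (n : ℝ) → F w = ∫ t, (absInner s t : ℂ) ^ (-w - (n : ℂ)) * φ t ∂(nu n)

/-- The parameter `-n/2 + iσ`. -/
noncomputable def param (n : ℕ) (σ : ℝ) : ℂ := -(n : ℂ) / 2 + Complex.I * σ

/-- `d(σ) = √π Γ((n/2 + iσ)/2) / (Γ(n/2) Γ((-n/2 + iσ + 1)/2))`. -/
noncomputable def dconst (n : ℕ) (σ : ℝ) : ℂ :=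
  (Real.sqrt Real.pi : ℂ) / Complex.Gamma ((n : ℂ) / 2) *
    (Complex.Gamma (((n : ℂ) / 2 + Complex.I * σ) / 2) /
      Complex.Gamma ((-(n : ℂ) / 2 + Complex.I * σ + 1) / 2))

/-- `U` is the bounded operator on `L²(S̃)` that extends `d(σ) A_{-n/2+iσ}` from `C^∞(S̃)`. -/
def IsIntertwiner (n : ℕ) (σ : ℝ) (U : L2S n →L[ℂ] L2S n) : Prop :=
  ∀ φ : PSph n → ℂ, IsSmooth φ → ∃ (hφ : MemLp φ 2 (nu n)) (Aφ : PSph n → ℂ),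
    (∀ s, IsAValue (param n σ) φ s (Aφ s)) ∧
      U (hφ.toLp φ) =ᵐ[nu n] fun s => dconst n σ * Aφ s

/-! ### The symbolic calculus -/

/-- The function `f(u, v) |⟨u, v⟩|^(-n/2+iσ)` on `S̃ × S̃` (zero off the orbit, which has full
measure), for a function `f` on `X`. -/
noncomputable def lowered {n : ℕ} [NeZero n] (σ : ℝ) (f : X n → ℂ) : PSph n × PSph n → ℂ :=
  Function.extend (orbitMap n)
    (fun x => f x * (absInner (orbitMap n x).1 (orbitMap n x).2 : ℂ) ^ param n σ) 0

/-- `k = T_σ f`, that is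
`k(u, v) = d(σ) ∫ f(u, w) |⟨u, w⟩|^(-n/2+iσ) |⟨v, w⟩|^(-n/2-iσ) dw`
in the sense of analytic continuation: for almost every `u`, the function `k(u, ·)` is the image
under (the `L²` extension of) `d(σ) A_{-n/2+iσ}` of `w ↦ f(u, w) |⟨u, w⟩|^(-n/2+iσ)`. -/
def IsT {n : ℕ} [NeZero n] (σ : ℝ) (f : L2X n) (k : L2SS n) : Prop :=
  ∃ U : L2S n →L[ℂ] L2S n, IsIntertwiner n σ U ∧
    ∀ᵐ u ∂(nu n), ∃ h : MemLp (fun w => lowered σ f (u, w)) 2 (nu n),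
      (fun v => k (u, v)) =ᵐ[nu n] U (h.toLp _)

/-- `Op` is a symbolic calculus on `X`: it is linear, and `Op f` is the Hilbert-Schmidt operator
on `L²(S̃)` with kernel `T_σ f ∈ L²(S̃ × S̃)`. -/
def IsSymbolicCalculus {n : ℕ} [NeZero n] (σ : ℝ)
    (Op : L2X n →ₗ[ℂ] (L2S n →L[ℂ] L2S n)) : Prop :=
  ∀ f : L2X n, ∃ k : L2SS n, IsT σ f k ∧
    ∀ φ : L2S n, Op f φ =ᵐ[nu n] fun u => ∫ v, k (u, v) * φ v ∂(nu n)

/-! ### `H*`-algebras and covariance -/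

/-- The Hilbert space `R`, with the product `mul` and the involution `star`, is an `H*`-algebra
(Hilbert algebra): a Banach algebra with involution for the Hilbert space norm, such that
`(xy, z) = (y, x*z)`, `‖x*‖ = ‖x‖` and `xx* ≠ 0` for `x ≠ 0`. -/
structure IsHStarAlgebra (R : Type*) [NormedAddCommGroup R] [InnerProductSpace ℂ R]
    (mul : R → R → R) (star : R → R) : Prop where
  complete : CompleteSpace R
  add_mul : ∀ x y z, mul (x + y) z = mul x z + mul y z
  mul_add : ∀ x y z, mul x (y + z) = mul x y + mul x z
  smul_mul : ∀ (c : ℂ) x y, mul (c • x) y = c • mul x y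
  mul_smul : ∀ (c : ℂ) x y, mul x (c • y) = c • mul x y
  mul_assoc : ∀ x y z, mul (mul x y) z = mul x (mul y z)
  norm_mul_le : ∀ x y, ‖mul x y‖ ≤ ‖x‖ * ‖y‖
  star_add : ∀ x y, star (x + y) = star x + star y
  star_smul : ∀ (c : ℂ) x, star (c • x) = conj c • star x
  star_star : ∀ x, star (star x) = x
  star_mul : ∀ x y, star (mul x y) = mul (star y) (star x)
  inner_mul : ∀ x y z, inner ℂ (mul x y) z = inner ℂ y (mul (star x) z)
  norm_star : ∀ x, ‖star x‖ = ‖x‖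
  mul_star_ne_zero : ∀ x, x ≠ 0 → mul x (star x) ≠ 0

/-- `π` is the representation `π⁺_μ`, `π⁺_μ(g) φ(s) = φ(g⁻¹.s) ‖g⁻¹(s)‖^μ`, on `L²(S̃)`. -/
def IsPiPlus {n : ℕ} (μ : ℂ) (π : G n →* unitary (L2S n →L[ℂ] L2S n)) : Prop :=
  ∀ (g : G n) (φ : PSph n → ℂ) (hφ : MemLp φ 2 (nu n)),
    (π g : L2S n →L[ℂ] L2S n) (hφ.toLp φ) =ᵐ[nu n]
      fun s => φ (act g⁻¹ s) * (stretch g⁻¹ s : ℂ) ^ μ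

/-- The left translation `L_x f(p) = f(x⁻¹ p)` on `L²(X)`; `hinv` says that the measure of `X` is
invariant. -/
noncomputable def leftTranslate {n : ℕ} [NeZero n]
    (hinv : ∀ x : G n, MeasurePreserving (fun p : X n => x • p) (muX n) (muX n))
    (x : G n) (f : L2X n) : L2X n :=
  Lp.compMeasurePreserving (fun p : X n => x⁻¹ • p) (hinv x⁻¹) f

end ParaHermitian

set_option linter.unusedSectionVars false

/-! The map `Op` is a composition of three maps: multiplication of f by |⟨u, v⟩|^μ, the operator U_σ
applied in the second variable, and the passage from a kernel to its integral operator. As Re μ =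
-n/2, the first map is unitary from L²(X) onto L²(S̃ × S̃): the square of the modulus of the factor
is the density of the measure of X, and the complement of the orbit is a null set. The second map is
unitary once U_σ is. The third identifies L²(S̃ × S̃) with the Hilbert–Schmidt operators, which form
an H*-algebra for composition and adjunction. That structure is carried back to L²(X) by the unitary
map `kernelEquiv` (see `isHStarAlgebra_transport`).

The analytic core is the unitarity of U_σ. For an even Schwartz function g put M_ζ g(s) = ∫₀^∞
r^(ζ-1) g(rs) dr. Writing |⟨s, x⟩|^z as a superposition of Gaussians shows that the Fourier
transform turns integration against it into integration against |τ|^(-z-1) on the line ℝs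
(`functional_equation`). In polar coordinates this says that A_μ sends M_{-μ} g to κ(-μ-n) M_{μ+n}
ĝ, with κ an explicit quotient of Gamma functions. Since M_{μ+n} ĝ exists where the defining
integral diverges, this also produces the meromorphic continuation (`isAValue_lift`).

On the other hand ∫ a(x) b̂(rx) dx is symmetric in a and b. Its Mellin transform in r, computed in
polar coordinates, is a pairing of M_{n-ζ} a with M_ζ b̂. Taking b to be the conjugate of â shows
that M_{n-ζ} a ↦ M_ζ â preserves the L² norm when Re ζ = n/2 (`integral_norm_sq_rayMellin_fourier`).
The ray transforms are dense, so this map extends to a unitary operator `fourierU`, and d(σ) has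
been normalized so that |d(σ) κ(-μ-n)| = 1 (`norm_dconst_mul_kappa`).

Covariance comes from the same picture. M_ζ g is the restriction to S of a function homogeneous of
degree -ζ, so translating g by x amounts to π_{-ζ}(x). The Fourier transform replaces x by θ(x).
Hence U_σ exchanges π_μ(θ(x)) and π_{μ̄}(x), and the transpose of π_{μ̄}(x) is π_μ(x⁻¹), which is
the right factor in the covariance formula. -/

namespace ParaHermitian

/-! ### Weighted composition operators on `L²` -/

section WeightedComposition

variable {α β : Type*} [MeasurableSpace α] [MeasurableSpace β] {μ : Measure α} {ν : Measure β}

/-- The map `e` transports the measure `|w|² μ` to `ν`, for a nowhere vanishing weight `w`. -/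
structure IsWeighted (e : α → β) (w : α → ℂ) (μ : Measure α) (ν : Measure β) : Prop where
  measurable_weight : Measurable w
  ne_zero : ∀ x, w x ≠ 0
  preserving : MeasurePreserving e (μ.withDensity fun x => ‖w x‖ₑ ^ 2) ν

namespace IsWeighted

variable {e : α → β} {w : α → ℂ}

theorem measurable (h : IsWeighted e w μ ν) : Measurable e := h.preserving.measurable

theorem absolutelyContinuous (h : IsWeighted e w μ ν) :
    μ ≪ μ.withDensity fun x => ‖w x‖ₑ ^ 2 :=
  withDensity_absolutelyContinuous' (h.measurable_weight.enorm.pow_const 2).aemeasurable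
    (Eventually.of_forall fun x => by simp [h.ne_zero x])

theorem quasiMeasurePreserving (h : IsWeighted e w μ ν) : Measure.QuasiMeasurePreserving e μ ν :=
  h.preserving.quasiMeasurePreserving.mono_left h.absolutelyContinuous

theorem lintegral_eq (h : IsWeighted e w μ ν) {F : β → ENNReal} (hF : AEMeasurable F ν) :
    ∫⁻ x, ‖w x‖ₑ ^ 2 * F (e x) ∂μ = ∫⁻ y, F y ∂ν := by
  have h1 : AEMeasurable F ((μ.withDensity fun x => ‖w x‖ₑ ^ 2).map e) := by
    rw [h.preserving.map_eq]; exact hF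
  rw [← h.preserving.map_eq, lintegral_map' h1 h.measurable.aemeasurable]
  obtain ⟨G, hG, hFG⟩ := hF
  have h2 : (fun x => F (e x)) =ᵐ[μ] fun x => G (e x) := h.quasiMeasurePreserving.ae_eq hFG
  have h3 : (fun x => F (e x)) =ᵐ[μ.withDensity fun x => ‖w x‖ₑ ^ 2] fun x => G (e x) :=
    (withDensity_absolutelyContinuous _ _).ae_le h2
  rw [lintegral_congr_ae h3, lintegral_withDensity_eq_lintegral_mul _
    (h.measurable_weight.enorm.pow_const 2) (g := fun x => G (e x)) (hG.comp h.measurable)]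
  refine lintegral_congr_ae ?_
  filter_upwards [h2] with x hx
  simp [hx]

theorem eLpNorm_eq (h : IsWeighted e w μ ν) {f : β → ℂ} (hf : AEStronglyMeasurable f ν) :
    eLpNorm (fun x => w x * f (e x)) 2 μ = eLpNorm f 2 ν := by
  rw [eLpNorm_eq_lintegral_rpow_enorm_toReal (by simp) (by simp),
    eLpNorm_eq_lintegral_rpow_enorm_toReal (by simp) (by simp)]
  congr 1
  simp only [ENNReal.toReal_ofNat, ENNReal.rpow_two]
  rw [← h.lintegral_eq (hf.enorm.pow_const 2)]
  simp [enorm_mul, mul_pow]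

theorem memLp (h : IsWeighted e w μ ν) {f : β → ℂ} (hf : MemLp f 2 ν) :
    MemLp (fun x => w x * f (e x)) 2 μ :=
  ⟨h.measurable_weight.aestronglyMeasurable.mul
    (hf.1.comp_quasiMeasurePreserving h.quasiMeasurePreserving), by
    rw [h.eLpNorm_eq hf.1]; exact hf.2⟩

/-- The isometry `f ↦ w · (f ∘ e)`. -/
noncomputable def toLpIsometry (h : IsWeighted e w μ ν) : Lp ℂ 2 ν →ₗᵢ[ℂ] Lp ℂ 2 μ where
  toFun f := (h.memLp (Lp.memLp f)).toLp _
  map_add' f g := by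
    refine Lp.ext ?_
    filter_upwards [MemLp.coeFn_toLp (h.memLp (Lp.memLp (f + g))),
      Lp.coeFn_add ((h.memLp (Lp.memLp f)).toLp _) ((h.memLp (Lp.memLp g)).toLp _),
      MemLp.coeFn_toLp (h.memLp (Lp.memLp f)), MemLp.coeFn_toLp (h.memLp (Lp.memLp g)),
      h.quasiMeasurePreserving.ae (Lp.coeFn_add f g)] with x h1 h2 h3 h4 h5
    rw [h1, h2, Pi.add_apply, h3, h4, h5, Pi.add_apply, mul_add]
  map_smul' c f := by
    refine Lp.ext ?_
    filter_upwards [MemLp.coeFn_toLp (h.memLp (Lp.memLp (c • f))),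
      Lp.coeFn_smul c ((h.memLp (Lp.memLp f)).toLp _),
      MemLp.coeFn_toLp (h.memLp (Lp.memLp f)),
      h.quasiMeasurePreserving.ae (Lp.coeFn_smul c f)] with x h1 h2 h3 h5
    rw [RingHom.id_apply, h1, h2, Pi.smul_apply, h3, h5, Pi.smul_apply]
    simp [mul_left_comm]
  norm_map' f := by
    simp only [LinearMap.coe_mk, AddHom.coe_mk, Lp.norm_toLp]
    rw [h.eLpNorm_eq (Lp.memLp f).1, Lp.norm_def]

theorem toLpIsometry_coeFn (h : IsWeighted e w μ ν) (f : Lp ℂ 2 ν) :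
    h.toLpIsometry f =ᵐ[μ] fun x => w x * f (e x) :=
  MemLp.coeFn_toLp (h.memLp (Lp.memLp f))

theorem toLpIsometry_toLp (h : IsWeighted e w μ ν) {f : β → ℂ} (hf : MemLp f 2 ν) :
    h.toLpIsometry (hf.toLp f) =ᵐ[μ] fun x => w x * f (e x) := by
  filter_upwards [h.toLpIsometry_coeFn (hf.toLp f),
    h.quasiMeasurePreserving.ae hf.coeFn_toLp] with x h1 h2
  rw [h1, h2]

end IsWeighted

end WeightedComposition

/-! ### Hilbert–Schmidt kernels -/

section Kernels

variable {α : Type*} [MeasurableSpace α] (ν : Measure α)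

/-- `L²(ν)`. -/
noncomputable abbrev LL := Lp ℂ 2 ν

/-- The space `L²(ν × ν)` of Hilbert–Schmidt kernels. -/
noncomputable abbrev KK := Lp ℂ 2 (ν.prod ν)

variable {ν}

theorem norm_sq_eq_integral {β : Type*} [MeasurableSpace β] {μ : Measure β} (f : Lp ℂ 2 μ) :
    ‖f‖ ^ 2 = ∫ x, ‖f x‖ ^ 2 ∂μ := by
  have h : (inner ℂ f f).re = ‖f‖ ^ 2 := by
    rw [inner_self_eq_norm_sq_to_K]; norm_cast
  rw [← h, L2.inner_def]
  have h2 : ∀ x, inner ℂ (f x) (f x) = ((‖f x‖ ^ 2 : ℝ) : ℂ) := fun x => by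
    rw [inner_self_eq_norm_sq_to_K]; norm_cast
  simp_rw [h2]
  rw [integral_complex_ofReal, Complex.ofReal_re]

/-- Complex conjugation on `L²`. -/
noncomputable def conjL {β : Type*} [MeasurableSpace β] (μ : Measure β) :
    Lp ℂ 2 μ ≃ₗᵢ⋆[ℂ] Lp ℂ 2 μ where
  toFun f := star f
  invFun f := star f
  left_inv f := star_star f
  right_inv f := star_star f
  map_add' f g := by
    refine Lp.ext ?_
    filter_upwards [Lp.coeFn_star (f + g), Lp.coeFn_add f g, Lp.coeFn_add (star f) (star g),
      Lp.coeFn_star f, Lp.coeFn_star g] with x h1 h2 h3 h4 h5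
    rw [h1, h3, Pi.add_apply, h4, h5, Pi.star_apply, h2]
    simp
  map_smul' c f := by
    refine Lp.ext ?_
    filter_upwards [Lp.coeFn_star (c • f), Lp.coeFn_smul c f, Lp.coeFn_smul (conj c) (star f),
      Lp.coeFn_star f] with x h1 h2 h3 h4
    rw [h1, h3, Pi.smul_apply, h4, Pi.star_apply, h2]
    simp
  norm_map' f := by
    change ‖star f‖ = ‖f‖
    rw [Lp.norm_def, Lp.norm_def]
    congr 1
    refine eLpNorm_congr_norm_ae ?_
    filter_upwards [Lp.coeFn_star f] with x h1
    rw [h1]; simp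

theorem conjL_coeFn {β : Type*} [MeasurableSpace β] {μ : Measure β} (f : Lp ℂ 2 μ) :
    conjL μ f =ᵐ[μ] fun x => conj (f x) := Lp.coeFn_star f

@[simp] theorem conjL_conjL {β : Type*} [MeasurableSpace β] {μ : Measure β} (f : Lp ℂ 2 μ) :
    conjL μ (conjL μ f) = f := star_star f

theorem inner_conjL_conjL {β : Type*} [MeasurableSpace β] {μ : Measure β} (f g : Lp ℂ 2 μ) :
    inner ℂ (conjL μ f) (conjL μ g) = inner ℂ g f := by
  rw [L2.inner_def, L2.inner_def]
  refine integral_congr_ae ?_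
  filter_upwards [conjL_coeFn f, conjL_coeFn g] with x h1 h2
  simp [h1, h2, mul_comm]

theorem inner_conjL_left {β : Type*} [MeasurableSpace β] {μ : Measure β} (f g : Lp ℂ 2 μ) :
    inner ℂ (conjL μ f) g = ∫ x, f x * g x ∂μ := by
  rw [L2.inner_def]
  refine integral_congr_ae ?_
  filter_upwards [conjL_coeFn f] with x h1
  simp [h1, mul_comm]

/-- The operator `C T C`, with `C` the complex conjugation. -/
noncomputable def conjOp (T : LL ν →L[ℂ] LL ν) : LL ν →L[ℂ] LL ν :=
  ((conjL ν).toContinuousLinearEquiv : LL ν →L⋆[ℂ] LL ν).comp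
    (T.comp ((conjL ν).toContinuousLinearEquiv : LL ν →L⋆[ℂ] LL ν))

@[simp] theorem conjOp_apply (T : LL ν →L[ℂ] LL ν) (f : LL ν) :
    conjOp T f = conjL ν (T (conjL ν f)) := rfl

variable [IsProbabilityMeasure ν]

theorem memLp_tensor (a b : LL ν) : MemLp (fun p : α × α => a p.1 * b p.2) 2 (ν.prod ν) := by
  have h1 := (memLp_two_iff_integrable_sq_norm (Lp.memLp a).1).1 (Lp.memLp a)
  have h2 := (memLp_two_iff_integrable_sq_norm (Lp.memLp b).1).1 (Lp.memLp b)
  have h3 := h1.mul_prod h2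
  rw [memLp_two_iff_integrable_sq_norm]
  · simpa [mul_pow] using h3
  · exact (Lp.memLp a).1.comp_fst.mul (Lp.memLp b).1.comp_snd

/-- The kernel `a(u) b(v)`. -/
noncomputable def tensor (a b : LL ν) : KK ν := (memLp_tensor a b).toLp _

theorem tensor_coeFn (a b : LL ν) : tensor a b =ᵐ[ν.prod ν] fun p => a p.1 * b p.2 :=
  MemLp.coeFn_toLp _

theorem ae_fst {p : α → Prop} (h : ∀ᵐ x ∂ν, p x) : ∀ᵐ z ∂(ν.prod ν), p z.1 :=
  Measure.quasiMeasurePreserving_fst.ae h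

theorem ae_snd {p : α → Prop} (h : ∀ᵐ x ∂ν, p x) : ∀ᵐ z ∂(ν.prod ν), p z.2 :=
  Measure.quasiMeasurePreserving_snd.ae h

theorem memLp_section {F : α × α → ℂ} (hF : MemLp F 2 (ν.prod ν)) :
    ∀ᵐ u ∂ν, MemLp (fun v => F (u, v)) 2 ν := by
  have h1 := ((memLp_two_iff_integrable_sq_norm hF.1).1 hF).prod_right_ae
  filter_upwards [h1, hF.1.prodMk_left] with u h2 h3
  exact (memLp_two_iff_integrable_sq_norm h3).2 h2

open Classical in
/-- The function `F(u, ·)`. -/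
noncomputable def fib (F : KK ν) (u : α) : LL ν :=
  -- The default value 0 occurs only for u in a null set, by `memLp_section`. This is why the
  -- statements about `fib` hold for almost every u.
  if h : MemLp (fun v => F (u, v)) 2 ν then h.toLp _ else 0

theorem fib_coeFn (F : KK ν) : ∀ᵐ u ∂ν, fib F u =ᵐ[ν] fun v => F (u, v) := by
  filter_upwards [memLp_section (Lp.memLp F)] with u hu
  rw [fib, dif_pos hu]
  exact hu.coeFn_toLp

theorem fib_add (F F' : KK ν) : ∀ᵐ u ∂ν, fib (F + F') u = fib F u + fib F' u := by
  filter_upwards [fib_coeFn F, fib_coeFn F', fib_coeFn (F + F'),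
    Measure.ae_ae_of_ae_prod (Lp.coeFn_add F F')] with u h1 h2 h3 h4
  refine Lp.ext ?_
  filter_upwards [h1, h2, h3, h4, Lp.coeFn_add (fib F u) (fib F' u)] with v h1 h2 h3 h4 h5
  rw [h3, h4, h5, Pi.add_apply, Pi.add_apply, h1, h2]

theorem fib_smul (c : ℂ) (F : KK ν) : ∀ᵐ u ∂ν, fib (c • F) u = c • fib F u := by
  filter_upwards [fib_coeFn F, fib_coeFn (c • F),
    Measure.ae_ae_of_ae_prod (Lp.coeFn_smul c F)] with u h1 h3 h4
  refine Lp.ext ?_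
  filter_upwards [h1, h3, h4, Lp.coeFn_smul c (fib F u)] with v h1 h3 h4 h5
  rw [h3, h4, h5, Pi.smul_apply, Pi.smul_apply, h1]

theorem fib_tensor (a b : LL ν) : ∀ᵐ u ∂ν, fib (tensor a b) u = a u • b := by
  filter_upwards [fib_coeFn (tensor a b),
    Measure.ae_ae_of_ae_prod (tensor_coeFn a b)] with u h1 h2
  refine Lp.ext ?_
  filter_upwards [h1, h2, Lp.coeFn_smul (a u) b] with v h1 h2 h3
  simp [h1, h2, h3]

theorem fib_norm_sq (F : KK ν) : ∀ᵐ u ∂ν, ‖fib F u‖ ^ 2 = ∫ v, ‖F (u, v)‖ ^ 2 ∂ν := by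
  filter_upwards [fib_coeFn F] with u h1
  rw [norm_sq_eq_integral]
  refine integral_congr_ae ?_
  filter_upwards [h1] with v h2
  rw [h2]

theorem integrable_sq_norm (F : KK ν) : Integrable (fun p => ‖F p‖ ^ 2) (ν.prod ν) :=
  (memLp_two_iff_integrable_sq_norm (Lp.memLp F).1).1 (Lp.memLp F)

theorem integrable_fib_norm_sq (F : KK ν) : Integrable (fun u => ‖fib F u‖ ^ 2) ν :=
  (integrable_sq_norm F).integral_prod_left.congr ((fib_norm_sq F).mono fun _ h => h.symm)

theorem norm_sq_eq_integral_fib (F : KK ν) : ‖F‖ ^ 2 = ∫ u, ‖fib F u‖ ^ 2 ∂ν := by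
  rw [norm_sq_eq_integral, integral_prod _ (integrable_sq_norm F)]
  exact integral_congr_ae ((fib_norm_sq F).mono fun _ h => h.symm)

/-- The squared norm of a kernel is the integral of the squared norms of its fibres, so the
difference has norm zero. -/
theorem eq_of_fib_eq {F F' : KK ν} (h : ∀ᵐ u ∂ν, fib F u = fib F' u) : F = F' := by
  rw [← sub_eq_zero, ← norm_eq_zero, ← sq_eq_zero_iff, norm_sq_eq_integral_fib]
  rw [← integral_zero (G := ℝ) (μ := ν)]
  refine integral_congr_ae ?_
  have h1 := fib_add F ((-1 : ℂ) • F')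
  filter_upwards [h, h1, fib_smul (-1) F'] with u h1 h2 h3
  rw [sub_eq_add_neg, ← neg_one_smul ℂ F', h2, h3, h1]
  simp

/-- Kernels act through the bilinear pairing, so a conjugation is needed to see an inner product.
Once it is there, Cauchy–Schwarz on each fibre gives the Hilbert–Schmidt bound. -/
theorem fib_mem (F : KK ν) (φ : LL ν) :
    ∀ᵐ u ∂ν, ∫ v, F (u, v) * φ v ∂ν = inner ℂ (conjL ν φ) (fib F u) := by
  filter_upwards [fib_coeFn F] with u hu
  rw [inner_conjL_left]
  refine integral_congr_ae ?_
  filter_upwards [hu] with v hv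
  rw [hv, mul_comm]

theorem aestronglyMeasurable_kernel (F : KK ν) (φ : LL ν) :
    AEStronglyMeasurable (fun u => ∫ v, F (u, v) * φ v ∂ν) ν :=
  ((Lp.memLp F).1.mul (Lp.memLp φ).1.comp_snd).integral_prod_right'

theorem kernel_bound (F : KK ν) (φ : LL ν) :
    ∀ᵐ u ∂ν, ‖∫ v, F (u, v) * φ v ∂ν‖ ^ 2 ≤ ‖φ‖ ^ 2 * ‖fib F u‖ ^ 2 := by
  filter_upwards [fib_mem F φ] with u hu
  rw [hu, ← mul_pow]
  have := norm_inner_le_norm (𝕜 := ℂ) (conjL ν φ) (fib F u)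
  rw [LinearIsometryEquiv.norm_map] at this
  gcongr

theorem memLp_kernel (F : KK ν) (φ : LL ν) : MemLp (fun u => ∫ v, F (u, v) * φ v ∂ν) 2 ν := by
  rw [memLp_two_iff_integrable_sq_norm (aestronglyMeasurable_kernel F φ)]
  refine ((integrable_fib_norm_sq F).const_mul (‖φ‖ ^ 2)).mono'
    ((aestronglyMeasurable_kernel F φ).norm.pow 2) ?_
  filter_upwards [kernel_bound F φ] with u hu
  simpa using hu

/-- The integral operator with kernel `F`. -/
noncomputable def kint : KK ν →L[ℂ] LL ν →L[ℂ] LL ν :=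
  LinearMap.mkContinuous₂ (LinearMap.mk₂ ℂ (fun F φ => (memLp_kernel F φ).toLp _)
    (by
      intro F F' φ
      refine Lp.ext ?_
      filter_upwards [(memLp_kernel (F + F') φ).coeFn_toLp, (memLp_kernel F φ).coeFn_toLp,
        (memLp_kernel F' φ).coeFn_toLp,
        Lp.coeFn_add ((memLp_kernel F φ).toLp _) ((memLp_kernel F' φ).toLp _),
        fib_mem (F + F') φ, fib_mem F φ, fib_mem F' φ, fib_add F F'] with u h1 h2 h3 h4 h5 h6 h7 h8
      rw [h1, h4, Pi.add_apply, h2, h3, h5, h6, h7, h8, inner_add_right])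
    (by
      intro c F φ
      refine Lp.ext ?_
      filter_upwards [(memLp_kernel (c • F) φ).coeFn_toLp, (memLp_kernel F φ).coeFn_toLp,
        Lp.coeFn_smul c ((memLp_kernel F φ).toLp _),
        fib_mem (c • F) φ, fib_mem F φ, fib_smul c F] with u h1 h2 h4 h5 h6 h8
      rw [h1, h4, Pi.smul_apply, h2, h5, h6, h8, inner_smul_right, smul_eq_mul])
    (by
      intro F φ φ'
      refine Lp.ext ?_
      filter_upwards [(memLp_kernel F (φ + φ')).coeFn_toLp, (memLp_kernel F φ).coeFn_toLp,
        (memLp_kernel F φ').coeFn_toLp,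
        Lp.coeFn_add ((memLp_kernel F φ).toLp _) ((memLp_kernel F φ').toLp _),
        fib_mem F (φ + φ'), fib_mem F φ, fib_mem F φ'] with u h1 h2 h3 h4 h5 h6 h7
      rw [h1, h4, Pi.add_apply, h2, h3, h5, h6, h7, map_add, inner_add_left])
    (by
      intro c F φ
      refine Lp.ext ?_
      filter_upwards [(memLp_kernel F (c • φ)).coeFn_toLp, (memLp_kernel F φ).coeFn_toLp,
        Lp.coeFn_smul c ((memLp_kernel F φ).toLp _),
        fib_mem F (c • φ), fib_mem F φ] with u h1 h2 h4 h5 h6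
      rw [h1, h4, Pi.smul_apply, h2, h5, h6, LinearIsometryEquiv.map_smulₛₗ, inner_smul_left,
        smul_eq_mul]
      simp)) 1
    (by
      intro F φ
      rw [one_mul, LinearMap.mk₂_apply]
      refine le_of_sq_le_sq ?_ (by positivity)
      rw [norm_sq_eq_integral, mul_pow, norm_sq_eq_integral_fib F, mul_comm,
        ← integral_const_mul]
      refine integral_mono_of_nonneg (Eventually.of_forall fun u => by positivity)
        ((integrable_fib_norm_sq F).const_mul _) ?_
      filter_upwards [(memLp_kernel F φ).coeFn_toLp, kernel_bound F φ] with u h1 h2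
      rw [h1]; exact h2)

theorem kint_coeFn (F : KK ν) (φ : LL ν) : kint F φ =ᵐ[ν] fun u => ∫ v, F (u, v) * φ v ∂ν :=
  (memLp_kernel F φ).coeFn_toLp

theorem kint_fib (F : KK ν) (φ : LL ν) :
    kint F φ =ᵐ[ν] fun u => inner ℂ (conjL ν φ) (fib F u) :=
  (kint_coeFn F φ).trans (fib_mem F φ)

theorem norm_kint_le (F : KK ν) : ‖kint F‖ ≤ ‖F‖ := by
  have h : ‖(kint : KK ν →L[ℂ] LL ν →L[ℂ] LL ν)‖ ≤ 1 :=
    LinearMap.mkContinuous₂_norm_le _ zero_le_one _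
  simpa using (kint.le_opNorm F).trans (mul_le_mul_of_nonneg_right h (norm_nonneg F))

theorem kint_tensor (a b φ : LL ν) : kint (tensor a b) φ = inner ℂ (conjL ν φ) b • a := by
  refine Lp.ext ?_
  filter_upwards [kint_fib (tensor a b) φ, fib_tensor a b,
    Lp.coeFn_smul (inner ℂ (conjL ν φ) b) a] with u h1 h2 h3
  rw [h1, h2, h3, inner_smul_right, Pi.smul_apply, smul_eq_mul, mul_comm]

variable [SecondCountableTopology (LL ν)]

/-- Each test function φ comes with its own exceptional null set. Separability of L² reduces to
countably many φ, hence to a single null set, and continuity recovers all the others. -/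
theorem fib_eq_of_kint {F : KK ν} {G : α → LL ν}
    (h : ∀ φ, kint F φ =ᵐ[ν] fun u => inner ℂ (conjL ν φ) (G u)) : ∀ᵐ u ∂ν, fib F u = G u := by
  have h1 : ∀ᵐ u ∂ν, ∀ j : ℕ, inner ℂ (TopologicalSpace.denseSeq (LL ν) j) (fib F u) =
      inner ℂ (TopologicalSpace.denseSeq (LL ν) j) (G u) := by
    rw [ae_all_iff]
    intro j
    filter_upwards [kint_fib F (conjL ν (TopologicalSpace.denseSeq (LL ν) j)),
      h (conjL ν (TopologicalSpace.denseSeq (LL ν) j))] with u h2 h3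
    rw [h2] at h3
    simpa using h3
  filter_upwards [h1] with u hu
  have h2 : (fun x : LL ν => inner ℂ x (fib F u)) = fun x => inner ℂ x (G u) :=
    Continuous.ext_on (TopologicalSpace.denseRange_denseSeq (LL ν)) (by fun_prop) (by fun_prop)
      (by rintro _ ⟨j, rfl⟩; exact hu j)
  exact ext_inner_left ℂ fun x => congrFun h2 x

/-- From here on, an identity between kernels can be verified on the operators that they define. -/
theorem kint_injective : Function.Injective (kint : KK ν → LL ν →L[ℂ] LL ν) := by
  intro F F' h
  refine eq_of_fib_eq (fib_eq_of_kint fun φ => ?_)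
  rw [h]
  exact kint_fib F' φ

/-- The bilinear map `tensor`. -/
noncomputable def tensorMap : LL ν →ₗ[ℂ] LL ν →ₗ[ℂ] KK ν :=
  LinearMap.mk₂ ℂ tensor
    (fun a a' b => kint_injective <| by ext1 φ; simp [kint_tensor])
    (fun c a b => kint_injective <| by ext1 φ; simp [kint_tensor, smul_comm c])
    (fun a b b' => kint_injective <| by ext1 φ; simp [kint_tensor, inner_add_right, add_smul])
    (fun c a b => kint_injective <| by ext1 φ; simp [kint_tensor, inner_smul_right, mul_smul])

theorem tensorMap_apply (a b : LL ν) : tensorMap a b = tensor a b := rfl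

theorem inner_tensor (a b : LL ν) (F : KK ν) :
    inner ℂ (tensor a b) F = inner ℂ a (kint F (conjL ν b)) := by
  rw [L2.inner_def, L2.inner_def, integral_prod]
  · refine integral_congr_ae ?_
    filter_upwards [kint_coeFn F (conjL ν b),
      Measure.ae_ae_of_ae_prod (tensor_coeFn a b)] with u h1 h2
    rw [h1, RCLike.inner_apply, mul_comm, ← integral_const_mul]
    refine integral_congr_ae ?_
    filter_upwards [conjL_coeFn b, h2] with v h3 h4
    simp only [h3, h4, RCLike.inner_apply, map_mul]
    ring
  · exact L2.integrable_inner _ _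

/-- The inner products of F with product kernels are the matrix coefficients of `kint F`. A kernel
orthogonal to all of them therefore defines the zero operator. -/
theorem dense_span_tensor :
    Dense (Submodule.span ℂ (Set.range fun p : LL ν × LL ν => tensor p.1 p.2) : Set (KK ν)) := by
  rw [Submodule.dense_iff_topologicalClosure_eq_top, Submodule.topologicalClosure_eq_top_iff,
    Submodule.eq_bot_iff]
  intro F hF
  refine kint_injective ?_
  rw [map_zero]
  ext1 φ
  rw [zero_apply]
  refine ext_inner_left ℂ fun a => ?_
  have h := (Submodule.mem_orthogonal _ _).1 hF (tensor a (conjL ν φ))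
    (Submodule.subset_span ⟨(a, conjL ν φ), rfl⟩)
  rw [inner_tensor, conjL_conjL] at h
  rw [h, inner_zero_right]

/-- Stability under scalars need not be assumed, since a scalar can be absorbed in the first factor
of a product kernel. The span induction is accordingly run on all multiples at once. -/
theorem tensor_induction {P : KK ν → Prop} (hc : IsClosed {F | P F})
    (hadd : ∀ F F', P F → P F' → P (F + F')) (ht : ∀ a b, P (tensor a b)) (F : KK ν) : P F := by
  have h : closure (Submodule.span ℂ (Set.range fun p : LL ν × LL ν => tensor p.1 p.2) :
      Set (KK ν)) ⊆ {F | P F} := by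
    refine closure_minimal (fun F hF => ?_) hc
    have h0 : P 0 := by simpa [← tensorMap_apply] using ht 0 0
    have : ∀ c : ℂ, P (c • F) := by
      induction hF using Submodule.span_induction with
      | mem x hx =>
        obtain ⟨p, rfl⟩ := hx
        intro c
        simpa [← tensorMap_apply] using ht (c • p.1) p.2
      | zero => simpa using h0
      | add x y _ _ hx hy => intro c; rw [smul_add]; exact hadd _ _ (hx c) (hy c)
      | smul c x _ hx => intro d; rw [smul_smul]; exact hx _
    simpa using this 1
  exact h (dense_span_tensor F)

end Kernels

/-! ### Operators acting in one variable of a kernel -/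

section Amplification

variable {α : Type*} [MeasurableSpace α] {ν : Measure α} [IsProbabilityMeasure ν]
  [SecondCountableTopology (LL ν)]

/-- The map `a ⊗ b ↦ a(u) b(v)`. -/
noncomputable def tensorLift (ν : Measure α) [IsProbabilityMeasure ν]
    [SecondCountableTopology (LL ν)] : TensorProduct ℂ (LL ν) (LL ν) →ₗ[ℂ] KK ν :=
  TensorProduct.lift tensorMap

theorem denseRange_tensorLift : DenseRange (tensorLift ν) := by
  have h : (Submodule.span ℂ (Set.range fun p : LL ν × LL ν => tensor p.1 p.2) : Set (KK ν)) ⊆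
      LinearMap.range (tensorLift ν) := by
    refine SetLike.coe_subset_coe.2 (Submodule.span_le.2 ?_)
    rintro _ ⟨p, rfl⟩
    exact ⟨p.1 ⊗ₜ p.2, TensorProduct.lift.tmul _ _⟩
  exact dense_span_tensor.mono h

theorem fib_tensorLift (T : LL ν →L[ℂ] LL ν) (x : TensorProduct ℂ (LL ν) (LL ν)) :
    ∀ᵐ u ∂ν, fib (tensorLift ν (T.toLinearMap.lTensor (LL ν) x)) u =
      T (fib (tensorLift ν x) u) := by
  induction x using TensorProduct.induction_on with
  | zero =>
    have h : ∀ᵐ u ∂ν, fib (0 : KK ν) u = 0 := by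
      filter_upwards [fib_smul (0 : ℂ) (0 : KK ν)] with u hu
      simpa using hu
    filter_upwards [h] with u hu
    simp [hu]
  | tmul a b =>
    filter_upwards [fib_tensor a b, fib_tensor a (T b)] with u h1 h2
    simp only [tensorLift, LinearMap.lTensor_tmul, TensorProduct.lift.tmul, tensorMap_apply]
    rw [h1, map_smul]
    exact h2
  | add x y hx hy =>
    filter_upwards [hx, hy, fib_add (tensorLift ν x) (tensorLift ν y),
      fib_add (tensorLift ν (T.toLinearMap.lTensor (LL ν) x))
        (tensorLift ν (T.toLinearMap.lTensor (LL ν) y))] with u h1 h2 h3 h4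
    rw [map_add, map_add, map_add, h3, h4, h1, h2, map_add]

/-- The fibrewise bound by ‖T‖ is integrated over u. Measuring the right side by the L² norm of the
image kernel is what lets 1 ⊗ T descend from the algebraic tensor product and extend to all kernels.
-/
theorem norm_tensorLift_le (T : LL ν →L[ℂ] LL ν) (x : TensorProduct ℂ (LL ν) (LL ν)) :
    ‖(tensorLift ν ∘ₗ T.toLinearMap.lTensor (LL ν)) x‖ ≤ ‖T‖ * ‖tensorLift ν x‖ := by
  refine le_of_sq_le_sq ?_ (by positivity)
  rw [mul_pow, norm_sq_eq_integral_fib, norm_sq_eq_integral_fib, ← integral_const_mul]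
  refine integral_mono_of_nonneg (Eventually.of_forall fun u => by positivity)
    ((integrable_fib_norm_sq _).const_mul _) ?_
  filter_upwards [fib_tensorLift T x] with u hu
  rw [LinearMap.comp_apply, hu]
  have := T.le_opNorm (fib (tensorLift ν x) u)
  rw [← mul_pow]
  gcongr

/-- The operator `1 ⊗ T` on kernels: `T` applied in the second variable. -/
noncomputable def amp (T : LL ν →L[ℂ] LL ν) : KK ν →L[ℂ] KK ν :=
  (tensorLift ν ∘ₗ T.toLinearMap.lTensor (LL ν)).extendOfNorm (tensorLift ν)

theorem amp_tensor (T : LL ν →L[ℂ] LL ν) (a b : LL ν) :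
    amp T (tensor a b) = tensor a (T b) := by
  have h := LinearMap.extendOfNorm_eq (f := tensorLift ν ∘ₗ T.toLinearMap.lTensor (LL ν))
    denseRange_tensorLift ⟨‖T‖, norm_tensorLift_le T⟩ (a ⊗ₜ b)
  exact h

theorem norm_amp_le (T : LL ν →L[ℂ] LL ν) (F : KK ν) : ‖amp T F‖ ≤ ‖T‖ * ‖F‖ :=
  LinearMap.norm_extendOfNorm_apply_le denseRange_tensorLift _ (norm_tensorLift_le T) F

theorem ext_tensor {S T : KK ν →L[ℂ] KK ν} (h : ∀ a b, S (tensor a b) = T (tensor a b)) :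
    S = T := by
  ext1 F
  induction F using tensor_induction with
  | hc => exact isClosed_eq S.continuous T.continuous
  | hadd F F' h1 h2 => rw [map_add, map_add, h1, h2]
  | ht a b => exact h a b

theorem amp_comp (S T : LL ν →L[ℂ] LL ν) : amp (S ∘L T) = amp S ∘L amp T :=
  ext_tensor fun a b => by simp [amp_tensor]

theorem amp_id : amp (ContinuousLinearMap.id ℂ (LL ν)) = ContinuousLinearMap.id ℂ (KK ν) :=
  ext_tensor fun a b => by simp [amp_tensor]

/-- The transpose of an operator for the bilinear pairing `∫ φ ψ`. -/
noncomputable def transposeOp (T : LL ν →L[ℂ] LL ν) : LL ν →L[ℂ] LL ν :=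
  conjOp (ContinuousLinearMap.adjoint T)

/-- An operator applied to v ↦ F(u, v) moves to the other factor of the pairing ∫ F(u, v) φ(v) dv.
This pairing is bilinear, so the transpose appears and not the adjoint. -/
theorem kint_amp (T : LL ν →L[ℂ] LL ν) (F : KK ν) :
    kint (amp T F) = kint F ∘L transposeOp T := by
  induction F using tensor_induction with
  | hc => exact isClosed_eq (by fun_prop) (by fun_prop)
  | hadd F F' h1 h2 => rw [map_add, map_add, map_add, h1, h2, ContinuousLinearMap.add_comp]
  | ht a b =>
    ext1 φ
    rw [amp_tensor, kint_tensor, ContinuousLinearMap.comp_apply, kint_tensor, transposeOp,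
      conjOp_apply, conjL_conjL, ContinuousLinearMap.adjoint_inner_left]

/-- The extension by density of 1 ⊗ T is thereby identified with the fibre by fibre prescription
used in `IsT`. -/
theorem fib_amp (T : LL ν →L[ℂ] LL ν) (F : KK ν) : ∀ᵐ u ∂ν, fib (amp T F) u = T (fib F u) := by
  refine fib_eq_of_kint fun φ => ?_
  rw [kint_amp, ContinuousLinearMap.comp_apply]
  refine (kint_fib F _).trans (Eventually.of_forall fun u => ?_)
  simp only [transposeOp, conjOp_apply, conjL_conjL, ContinuousLinearMap.adjoint_inner_left]

/-- The conjugate transpose of a kernel, `conj (F(v, u))`. -/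
noncomputable def kadj (F : KK ν) : KK ν :=
  conjL _ (Lp.compMeasurePreserving Prod.swap Measure.measurePreserving_swap F)

theorem kadj_coeFn (F : KK ν) : kadj F =ᵐ[ν.prod ν] fun p => conj (F p.swap) := by
  filter_upwards [conjL_coeFn (Lp.compMeasurePreserving Prod.swap
    Measure.measurePreserving_swap F : KK ν),
    Lp.coeFn_compMeasurePreserving F Measure.measurePreserving_swap] with p h1 h2
  rw [kadj, h1, h2, Function.comp_apply]

theorem norm_kadj (F : KK ν) : ‖kadj F‖ = ‖F‖ := by
  rw [kadj, LinearIsometryEquiv.norm_map, Lp.norm_compMeasurePreserving]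

theorem kadj_add (F F' : KK ν) : kadj (F + F') = kadj F + kadj F' := by
  simp [kadj]

theorem kadj_tensor (a b : LL ν) : kadj (tensor a b) = tensor (conjL ν b) (conjL ν a) := by
  refine Lp.ext ?_
  filter_upwards [kadj_coeFn (tensor a b), tensor_coeFn (conjL ν b) (conjL ν a),
    Measure.measurePreserving_swap.quasiMeasurePreserving.ae (tensor_coeFn a b),
    ae_fst (conjL_coeFn b), ae_snd (conjL_coeFn a)] with p h1 h2 h3 h4 h5
  rw [h1, h2, h3, h4, h5]
  simp [mul_comm]

theorem continuous_kadj : Continuous (kadj : KK ν → KK ν) :=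
  (conjL _).continuous.comp (Lp.isometry_compMeasurePreserving _).continuous

theorem kint_kadj (F : KK ν) : kint (kadj F) = ContinuousLinearMap.adjoint (kint F) := by
  induction F using tensor_induction with
  | hc => exact isClosed_eq (kint.continuous.comp continuous_kadj) (by fun_prop)
  | hadd F F' h1 h2 => rw [kadj_add, map_add, map_add, map_add, h1, h2]
  | ht a b =>
    rw [ContinuousLinearMap.eq_adjoint_iff]
    intro φ ψ
    rw [kadj_tensor, kint_tensor, kint_tensor, inner_smul_left, inner_smul_right,
      inner_conjL_conjL, inner_conj_symm, mul_comm]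
    congr 1
    rw [← inner_conjL_conjL, conjL_conjL]

theorem kadj_smul (c : ℂ) (F : KK ν) : kadj (c • F) = conj c • kadj F := by
  refine kint_injective ?_
  rw [kint_kadj, map_smul kint c F, map_smul kint (conj c) (kadj F), kint_kadj,
    LinearIsometryEquiv.map_smulₛₗ]

/-- The operator `T ⊗ 1` on kernels: `T` applied in the first variable. -/
noncomputable def ampL (T : LL ν →L[ℂ] LL ν) : KK ν →L[ℂ] KK ν where
  toFun F := kadj (amp (conjOp T) (kadj F))
  map_add' F F' := by simp only [kadj_add, map_add]
  map_smul' c F := by simp only [kadj_smul, map_smul, Complex.conj_conj, RingHom.id_apply]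
  cont := continuous_kadj.comp ((amp (conjOp T)).continuous.comp continuous_kadj)

theorem ampL_apply (T : LL ν →L[ℂ] LL ν) (F : KK ν) :
    ampL T F = kadj (amp (conjOp T) (kadj F)) := rfl

/-- `kadj` swaps the factors and conjugates both of them. The conjugations inside `conjOp` undo
those that reach T. -/
theorem ampL_tensor (T : LL ν →L[ℂ] LL ν) (a b : LL ν) :
    ampL T (tensor a b) = tensor (T a) b := by
  rw [ampL_apply, kadj_tensor, amp_tensor, kadj_tensor, conjOp_apply, conjL_conjL, conjL_conjL,
    conjL_conjL]

theorem norm_conjOp_le (T : LL ν →L[ℂ] LL ν) : ‖conjOp T‖ ≤ ‖T‖ := by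
  refine ContinuousLinearMap.opNorm_le_bound _ (norm_nonneg _) fun f => ?_
  rw [conjOp_apply, LinearIsometryEquiv.norm_map]
  simpa using T.le_opNorm (conjL ν f)

theorem norm_ampL_le (T : LL ν →L[ℂ] LL ν) (F : KK ν) : ‖ampL T F‖ ≤ ‖T‖ * ‖F‖ := by
  rw [ampL_apply, norm_kadj]
  refine (norm_amp_le _ _).trans ?_
  rw [norm_kadj]
  exact mul_le_mul_of_nonneg_right (norm_conjOp_le T) (norm_nonneg _)

/-- Consequently `ampL (kint F)` is left multiplication by F in the algebra of Hilbert–Schmidt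
kernels, and `norm_ampL_le` with `norm_kint_le` makes the Hilbert–Schmidt norm submultiplicative. -/
theorem kint_ampL (T : LL ν →L[ℂ] LL ν) (F : KK ν) : kint (ampL T F) = T ∘L kint F := by
  induction F using tensor_induction with
  | hc => exact isClosed_eq (by fun_prop) (by fun_prop)
  | hadd F F' h1 h2 => rw [map_add, map_add, map_add, h1, h2, ContinuousLinearMap.comp_add]
  | ht a b =>
    ext1 φ
    rw [ampL_tensor, kint_tensor, ContinuousLinearMap.comp_apply, kint_tensor, map_smul]

theorem amp_ampL_comm (S T : LL ν →L[ℂ] LL ν) : amp S ∘L ampL T = ampL T ∘L amp S :=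
  ext_tensor fun a b => by simp [amp_tensor, ampL_tensor]

theorem inner_ampL (T : LL ν →L[ℂ] LL ν) (F F' : KK ν) :
    inner ℂ (ampL T F) F' = inner ℂ F (ampL (ContinuousLinearMap.adjoint T) F') := by
  induction F using tensor_induction with
  | hc => exact isClosed_eq (by fun_prop) (by fun_prop)
  | hadd F F' h1 h2 => rw [map_add, inner_add_left, inner_add_left, h1, h2]
  | ht a b =>
    rw [ampL_tensor, inner_tensor, inner_tensor, kint_ampL, ContinuousLinearMap.comp_apply,
      ContinuousLinearMap.adjoint_inner_right]

/-- A unitary operator applied in the second variable. -/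
noncomputable def ampEquiv (U : LL ν ≃ₗᵢ[ℂ] LL ν) : KK ν ≃ₗᵢ[ℂ] KK ν where
  toFun := amp (U.toContinuousLinearEquiv : LL ν →L[ℂ] LL ν)
  invFun := amp (U.symm.toContinuousLinearEquiv : LL ν →L[ℂ] LL ν)
  map_add' := map_add _
  map_smul' := map_smul _
  left_inv F := by
    rw [← ContinuousLinearMap.comp_apply, ← amp_comp]
    convert congrArg (· F) (amp_id (ν := ν)) using 3
    · ext1 x; simp
    · rfl
  right_inv F := by
    rw [← ContinuousLinearMap.comp_apply, ← amp_comp]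
    convert congrArg (· F) (amp_id (ν := ν)) using 3
    · ext1 x; simp
    · rfl
  norm_map' F := by
    change ‖amp (U.toContinuousLinearEquiv : LL ν →L[ℂ] LL ν) F‖ = ‖F‖
    refine (sq_eq_sq₀ (norm_nonneg _) (norm_nonneg _)).1 ?_
    rw [norm_sq_eq_integral_fib, norm_sq_eq_integral_fib]
    refine integral_congr_ae ?_
    filter_upwards [fib_amp (U.toContinuousLinearEquiv : LL ν →L[ℂ] LL ν) F] with u hu
    rw [hu]; simp

end Amplification

/-! ### The `H*`-algebra of Hilbert–Schmidt kernels, transported to another Hilbert space -/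

section Transport

variable {α : Type*} [MeasurableSpace α] {ν : Measure α} [IsProbabilityMeasure ν]
  [SecondCountableTopology (LL ν)] {R : Type*} [NormedAddCommGroup R] [InnerProductSpace ℂ R]
  (J : R ≃ₗᵢ[ℂ] KK ν)

/-- The product transported from the composition of operators. -/
noncomputable def sharpOf (f g : R) : R := J.symm (ampL (kint (J f)) (J g))

/-- The involution transported from the adjunction of operators. -/
noncomputable def starOf (f : R) : R := J.symm (kadj (J f))

theorem kint_sharpOf (f g : R) : kint (J (sharpOf J f g)) = kint (J f) ∘L kint (J g) := by
  rw [sharpOf, LinearIsometryEquiv.apply_symm_apply, kint_ampL]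

theorem kint_starOf (f : R) : kint (J (starOf J f)) = ContinuousLinearMap.adjoint (kint (J f)) := by
  rw [starOf, LinearIsometryEquiv.apply_symm_apply, kint_kadj]

theorem kint_comp_injective : Function.Injective fun f => kint (J f) :=
  kint_injective.comp J.injective

/-- The algebraic identities hold for bounded operators and come back through the injective map
`kint ∘ J`. The metric axioms involve the Hilbert–Schmidt norm and are read on kernels instead. -/
theorem isHStarAlgebra_transport [CompleteSpace R] :
    IsHStarAlgebra R (sharpOf J) (starOf J) where
  complete := inferInstance
  add_mul x y z := kint_comp_injective J <| by
    simp only [map_add, kint_sharpOf, ContinuousLinearMap.add_comp]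
  mul_add x y z := kint_comp_injective J <| by
    simp only [map_add, kint_sharpOf, ContinuousLinearMap.comp_add]
  smul_mul c x y := kint_comp_injective J <| by
    simp only [map_smul, kint_sharpOf, ContinuousLinearMap.smul_comp]
  mul_smul c x y := kint_comp_injective J <| by
    simp only [map_smul, kint_sharpOf, ContinuousLinearMap.comp_smul]
  mul_assoc x y z := kint_comp_injective J <| by
    simp only [kint_sharpOf, ContinuousLinearMap.comp_assoc]
  norm_mul_le x y := by
    rw [sharpOf, LinearIsometryEquiv.norm_map]
    refine (norm_ampL_le _ _).trans ?_
    rw [← J.norm_map x, ← J.norm_map y]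
    exact mul_le_mul_of_nonneg_right (norm_kint_le _) (norm_nonneg _)
  star_add x y := kint_comp_injective J <| by simp only [map_add, kint_starOf]
  star_smul c x := kint_comp_injective J <| by
    simp only [map_smul, kint_starOf, LinearIsometryEquiv.map_smulₛₗ]
  star_star x := kint_comp_injective J <| by
    simp only [kint_starOf, ContinuousLinearMap.adjoint_adjoint]
  star_mul x y := kint_comp_injective J <| by
    simp only [kint_starOf, kint_sharpOf, ContinuousLinearMap.adjoint_comp]
  inner_mul x y z := by
    rw [← J.inner_map_map, ← J.inner_map_map y, sharpOf, sharpOf,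
      LinearIsometryEquiv.apply_symm_apply, LinearIsometryEquiv.apply_symm_apply, kint_starOf,
      inner_ampL]
  norm_star x := by
    rw [starOf, LinearIsometryEquiv.norm_map, norm_kadj, LinearIsometryEquiv.norm_map]
  mul_star_ne_zero x hx h := by
    have h1 : kint (J (sharpOf J x (starOf J x))) = 0 := by rw [h, map_zero, map_zero]
    rw [kint_sharpOf, kint_starOf] at h1
    have h2 : kint (J x) = 0 := by
      rw [← ContinuousLinearMap.adjoint_adjoint (kint (J x))]
      -- With T the operator of x, ‖T*φ‖² equals ⟨φ, TT*φ⟩ up to conjugation, and this vanishes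
      -- because TT* = 0.
      have h3 : ContinuousLinearMap.adjoint (kint (J x)) = 0 := by
        ext1 φ
        rw [zero_apply, ← inner_self_eq_zero (𝕜 := ℂ), ContinuousLinearMap.adjoint_inner_left,
          ← ContinuousLinearMap.comp_apply, h1, zero_apply, inner_zero_right]
      rw [h3, map_zero]
    exact hx (kint_comp_injective J (by simpa using h2))

end Transport

/-! ### Topology and measure on `S̃` -/

section ProjectiveSphere

variable {n : ℕ}

instance (n : ℕ) : TopologicalSpace (PSph n) :=
  inferInstanceAs (TopologicalSpace (Quotient (antipodal n)))

theorem PSph.mk_surjective : Function.Surjective (PSph.mk : Sph n → PSph n) :=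
  Quotient.mk_surjective

theorem PSph.mk_eq_mk {s t : Sph n} : PSph.mk s = PSph.mk t ↔ s = t ∨ s = -t :=
  Quotient.eq (r := antipodal n)

theorem PSph.mk_neg (s : Sph n) : PSph.mk (-s) = PSph.mk s := PSph.mk_eq_mk.2 (Or.inr rfl)

theorem PSph.continuous_mk : Continuous (PSph.mk : Sph n → PSph n) := continuous_quotient_mk'

/-- Openness is needed because products of open quotient maps are again quotient maps. It gives the
continuity of functions on S̃ × S̃ such as `absInner`. -/
theorem PSph.isOpenQuotientMap_mk : IsOpenQuotientMap (PSph.mk : Sph n → PSph n) where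
  surjective := PSph.mk_surjective
  continuous := PSph.continuous_mk
  isOpenMap U hU := by
    have h : PSph.mk ⁻¹' (PSph.mk '' U) = U ∪ (fun s : Sph n => -s) ⁻¹' U := by
      ext s
      simp only [Set.mem_preimage, Set.mem_image, Set.mem_union]
      constructor
      · rintro ⟨t, ht, hts⟩
        rcases PSph.mk_eq_mk.1 hts with rfl | rfl
        · exact Or.inl ht
        · exact Or.inr ht
      · rintro (h | h)
        · exact ⟨s, h, rfl⟩
        · exact ⟨-s, h, PSph.mk_neg s⟩
    have h2 : IsOpen (PSph.mk ⁻¹' (PSph.mk '' U)) := by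
      rw [h]; exact hU.union (hU.preimage continuous_neg)
    exact h2

theorem PSph.measurable_mk : Measurable (PSph.mk : Sph n → PSph n) := fun _ h => h

instance : CompactSpace (PSph n) := inferInstanceAs (CompactSpace (Quotient (antipodal n)))

/-- The symmetric matrix `s ᵗs`, as a function of the class of `s`. -/
noncomputable def veronese : PSph n → Fin n → Fin n → ℝ :=
  Quotient.lift (fun (s : Sph n) i j => (s : E n) i * (s : E n) j) (by
    rintro s t (rfl | rfl)
    · rfl
    · ext i j; simp)

theorem veronese_mk (s : Sph n) (i j : Fin n) :
    veronese (PSph.mk s) i j = (s : E n) i * (s : E n) j := rfl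

theorem continuous_veronese : Continuous (veronese : PSph n → Fin n → Fin n → ℝ) := by
  refine PSph.isOpenQuotientMap_mk.continuous_comp_iff.1 ?_
  refine continuous_pi fun i => continuous_pi fun j => ?_
  simp only [Function.comp_apply, veronese_mk]
  fun_prop

theorem Sph.sum_sq (s : Sph n) : ∑ i, (s : E n) i * (s : E n) i = 1 := by
  have h := norm_eq_of_mem_sphere s
  rw [EuclideanSpace.norm_eq, Real.sqrt_eq_one] at h
  simpa [sq] using h

/-- Applying s ᵗs = t ᵗt to t gives t = ⟨s, t⟩ s, and comparison of norms gives ⟨s, t⟩ = ±1. The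
resulting embedding in a Euclidean space makes S̃ Hausdorff and second countable, and its polynomial
coordinates separate points for Stone–Weierstrass. -/
theorem veronese_injective : Function.Injective (veronese : PSph n → Fin n → Fin n → ℝ) := by
  intro u v huv
  obtain ⟨s, rfl⟩ := PSph.mk_surjective u
  obtain ⟨t, rfl⟩ := PSph.mk_surjective v
  have h : ∀ i j, (s : E n) i * (s : E n) j = (t : E n) i * (t : E n) j :=
    fun i j => congrFun (congrFun huv i) j
  set c := ∑ j, (s : E n) j * (t : E n) j with hc
  have h1 : ∀ i, (t : E n) i = c * (s : E n) i := fun i => by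
    calc (t : E n) i = ∑ j, (t : E n) i * ((t : E n) j * (t : E n) j) := by
          rw [← Finset.mul_sum, Sph.sum_sq, mul_one]
      _ = ∑ j, (s : E n) i * ((s : E n) j * (t : E n) j) :=
          Finset.sum_congr rfl fun j _ => by rw [← mul_assoc, ← h, mul_assoc]
      _ = c * (s : E n) i := by rw [← Finset.mul_sum, mul_comm]
  have h2 : c * c = 1 := by
    calc c * c = ∑ i, (c * (s : E n) i) * (c * (s : E n) i) := by
          have : ∀ i, (c * (s : E n) i) * (c * (s : E n) i) =
            c * c * ((s : E n) i * (s : E n) i) := fun i => by ring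
          simp_rw [this]
          rw [← Finset.mul_sum, Sph.sum_sq, mul_one]
      _ = 1 := by simp_rw [← h1]; exact Sph.sum_sq t
  refine PSph.mk_eq_mk.2 ?_
  rcases mul_self_eq_one_iff.1 h2 with h3 | h3
  · left; ext i; rw [h1 i, h3, one_mul]
  · right; ext i
    have := h1 i
    rw [h3] at this
    simp [this]

instance : T2Space (PSph n) := T2Space.of_injective_continuous veronese_injective continuous_veronese

instance : SecondCountableTopology (PSph n) :=
  (continuous_veronese.isClosedEmbedding veronese_injective).isEmbedding.secondCountableTopology

instance : PolishSpace (Sph n) := Metric.isClosed_sphere.polishSpace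

instance : OpensMeasurableSpace (PSph n) where
  borel_le := MeasurableSpace.generateFrom_le fun _ hU =>
    (IsOpen.preimage PSph.continuous_mk hU).measurableSet

instance : BorelSpace (PSph n) :=
  Measurable.borelSpace_codomain PSph.measurable_mk PSph.mk_surjective

instance : IsFiniteMeasure (surf n) := by
  unfold surf
  rcases eq_or_ne ((volume : Measure (E n)).toSphere Set.univ) 0 with h | h
  · rw [Measure.measure_univ_eq_zero.1 h, smul_zero]; infer_instance
  · exact Measure.smul_finite _ (ENNReal.inv_ne_top.2 h)

section Nonempty

variable [NeZero n]

instance : IsProbabilityMeasure (surf n) := by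
  constructor
  rw [surf, Measure.smul_apply, smul_eq_mul]
  refine ENNReal.inv_mul_cancel ?_ (measure_ne_top _ _)
  rw [Ne, Measure.measure_univ_eq_zero]
  exact Measure.toSphere_ne_zero _

instance : IsProbabilityMeasure (nu n) :=
  Measure.isProbabilityMeasure_map PSph.measurable_mk.aemeasurable

end Nonempty

theorem measurePreserving_mk : MeasurePreserving (PSph.mk : Sph n → PSph n) (surf n) (nu n) :=
  ⟨PSph.measurable_mk, rfl⟩

theorem integral_nu {φ : PSph n → ℂ} (hφ : AEStronglyMeasurable φ (nu n)) :
    ∫ u, φ u ∂(nu n) = ∫ s, φ (PSph.mk s) ∂(surf n) :=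
  integral_map PSph.measurable_mk.aemeasurable hφ

theorem lintegral_nu {φ : PSph n → ENNReal} (hφ : Measurable φ) :
    ∫⁻ u, φ u ∂(nu n) = ∫⁻ s, φ (PSph.mk s) ∂(surf n) :=
  lintegral_map hφ PSph.measurable_mk

/-! #### Smooth functions -/

theorem IsSmooth.continuous {φ : PSph n → ℂ} (h : IsSmooth φ) : Continuous φ := by
  obtain ⟨Φ, hΦ, h1⟩ := h
  refine PSph.isOpenQuotientMap_mk.continuous_comp_iff.1 ?_
  have : φ ∘ PSph.mk = fun s : Sph n => Φ s := funext h1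
  rw [this]
  exact hΦ.continuous.comp continuous_subtype_val

theorem memLp_of_continuous [NeZero n] {φ : PSph n → ℂ} (h : Continuous φ) : MemLp φ 2 (nu n) :=
  ContinuousMap.memLp (μ := nu n) ℂ ⟨φ, h⟩

/-- The algebra of smooth functions on `S̃`. -/
def smoothSubalgebra (n : ℕ) : StarSubalgebra ℂ C(PSph n, ℂ) where
  carrier := {f | IsSmooth f}
  mul_mem' := by
    rintro f g ⟨F, hF, hf⟩ ⟨G, hG, hg⟩
    exact ⟨fun x => F x * G x, hF.mul hG, fun s => by simp [hf, hg]⟩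
  add_mem' := by
    rintro f g ⟨F, hF, hf⟩ ⟨G, hG, hg⟩
    exact ⟨fun x => F x + G x, hF.add hG, fun s => by simp [hf, hg]⟩
  algebraMap_mem' c := ⟨fun _ => c, contDiff_const, fun s => by simp⟩
  star_mem' := by
    rintro f ⟨F, hF, hf⟩
    exact ⟨fun x => conj (F x), Complex.conjCLE.contDiff.comp hF, fun s => by simp [hf]⟩

theorem smoothSubalgebra_separatesPoints :
    (smoothSubalgebra n).toSubalgebra.SeparatesPoints := by
  intro u v huv
  have h : ∃ i j, veronese u i j ≠ veronese v i j := by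
    by_contra! h
    exact huv (veronese_injective (funext fun i => funext fun j => h i j))
  obtain ⟨i, j, hij⟩ := h
  have hc : Continuous fun u : PSph n => veronese u i j :=
    (continuous_apply j).comp ((continuous_apply i).comp continuous_veronese)
  refine ⟨fun u => (veronese u i j : ℂ), ⟨⟨fun u => (veronese u i j : ℂ), by fun_prop⟩, ?_, rfl⟩,
    by simpa using hij⟩
  refine ⟨fun x => ((x i * x j : ℝ) : ℂ), ?_, fun s => rfl⟩
  refine Complex.ofRealCLM.contDiff.comp ?_
  exact (contDiff_piLp_apply 2 (i := i)).mul (contDiff_piLp_apply 2 (i := j))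

/-- Stone–Weierstrass makes smooth functions uniformly dense in C(S̃), and continuous functions are
dense in L². Both the existence and the uniqueness of U_σ rest on this. -/
theorem dense_smooth [NeZero n] :
    Dense {F : L2S n | ∃ φ : PSph n → ℂ, ∃ hφ : MemLp φ 2 (nu n), IsSmooth φ ∧ F = hφ.toLp φ} := by
  have h1 : Dense (smoothSubalgebra n : Set C(PSph n, ℂ)) := by
    have := ContinuousMap.starSubalgebra_topologicalClosure_eq_top_of_separatesPoints
      (smoothSubalgebra n) smoothSubalgebra_separatesPoints
    intro f
    have hf : f ∈ (smoothSubalgebra n).topologicalClosure := by rw [this]; trivial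
    exact hf
  have h3 : DenseRange (ContinuousMap.toLp 2 (nu n) ℂ : C(PSph n, ℂ) →L[ℂ] Lp ℂ 2 (nu n)) :=
    ContinuousMap.toLp_denseRange ℂ (nu n) ℂ (by simp)
  have h2 := h3.dense_image (ContinuousLinearMap.continuous _) h1
  refine h2.mono ?_
  rintro _ ⟨f, hf, rfl⟩
  refine ⟨f, memLp_of_continuous f.continuous, hf, ?_⟩
  refine Lp.ext ((ContinuousMap.coeFn_toLp (p := 2) (𝕜 := ℂ) (nu n) f).trans (MemLp.coeFn_toLp _).symm)

/-! #### Continuity of the action -/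

theorem absInner_mk (s t : Sph n) :
    absInner (PSph.mk s) (PSph.mk t) = |inner ℝ (s : E n) (t : E n)| := rfl

theorem stretch_mk (g : G n) (s : Sph n) : stretch g (PSph.mk s) = ‖linAct g (s : E n)‖ := rfl

theorem act_mk (g : G n) (s : Sph n) : act g (PSph.mk s) = PSph.mk (sphAct g s) := rfl

theorem continuous_linAct (g : G n) : Continuous (linAct g : E n → E n) := by
  unfold linAct
  fun_prop

theorem continuous_sphAct (g : G n) : Continuous (sphAct g : Sph n → Sph n) := by
  refine Continuous.subtype_mk ?_ _
  have h : Continuous fun s : Sph n => linAct g (s : E n) :=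
    (continuous_linAct g).comp continuous_subtype_val
  exact (h.norm.inv₀ fun s => norm_ne_zero_iff.2 (linAct_ne_zero g s.ne_zero)).smul h

theorem continuous_act (g : G n) : Continuous (act g : PSph n → PSph n) :=
  PSph.isOpenQuotientMap_mk.continuous_comp_iff.1
    (PSph.continuous_mk.comp (continuous_sphAct g))

theorem continuous_stretch (g : G n) : Continuous (stretch g : PSph n → ℝ) :=
  PSph.isOpenQuotientMap_mk.continuous_comp_iff.1
    ((continuous_linAct g).comp continuous_subtype_val).norm

theorem stretch_pos (g : G n) (u : PSph n) : 0 < stretch g u := by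
  obtain ⟨s, rfl⟩ := PSph.mk_surjective u
  exact norm_pos_iff.2 (linAct_ne_zero g s.ne_zero)

theorem continuous_absInner : Continuous fun p : PSph n × PSph n => absInner p.1 p.2 := by
  refine (PSph.isOpenQuotientMap_mk.prodMap PSph.isOpenQuotientMap_mk).continuous_comp_iff.1 ?_
  have h : ((fun p : PSph n × PSph n => absInner p.1 p.2) ∘ Prod.map PSph.mk PSph.mk) =
      fun p : Sph n × Sph n => |inner ℝ (p.1 : E n) (p.2 : E n)| := rfl
  rw [h]
  fun_prop

theorem absInner_nonneg (u v : PSph n) : 0 ≤ absInner u v := by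
  obtain ⟨s, rfl⟩ := PSph.mk_surjective u
  obtain ⟨t, rfl⟩ := PSph.mk_surjective v
  exact abs_nonneg _

theorem act_one (u : PSph n) : act 1 u = u := by
  obtain ⟨s, rfl⟩ := PSph.mk_surjective u
  rw [act_mk]
  congr 1
  apply Subtype.ext
  simp [sphAct, linAct_one]

theorem stretch_one (u : PSph n) : stretch 1 u = 1 := by
  obtain ⟨s, rfl⟩ := PSph.mk_surjective u
  simp [stretch_mk, linAct_one]

theorem stretch_mul (g h : G n) (u : PSph n) :
    stretch (g * h) u = stretch g (act h u) * stretch h u := by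
  obtain ⟨s, rfl⟩ := PSph.mk_surjective u
  have h0 : ‖linAct h (s : E n)‖ ≠ 0 := norm_ne_zero_iff.2 (linAct_ne_zero h s.ne_zero)
  simp only [act_mk, stretch_mk, sphAct, linAct_mul, linAct_smul, norm_smul, norm_inv, norm_norm]
  field_simp

theorem inner_linAct_theta (g : G n) (x y : E n) :
    inner ℝ (linAct g x) (linAct (theta g) y) = inner ℝ x y := by
  have h : Matrix.transpose g.1 * (theta g).1 = 1 := by
    rw [theta, Matrix.SpecialLinearGroup.coe_transpose, ← Matrix.transpose_mul,
      ← Matrix.SpecialLinearGroup.coe_mul, inv_mul_cancel]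
    simp
  simp only [linAct, EuclideanSpace.inner_eq_star_dotProduct, star_trivial]
  rw [dotProduct_comm, ← Matrix.vecMul_transpose, ← Matrix.dotProduct_mulVec,
    Matrix.mulVec_mulVec, h, Matrix.one_mulVec, dotProduct_comm]

/-- The pairing ⟨gx, θ(g)y⟩ equals ⟨x, y⟩, so only the two normalizations remain. This cocycle
identity yields both the invariance of the measure of X and the covariance of f ↦ f |⟨u, v⟩|^μ. -/
theorem absInner_act_theta (g : G n) (u v : PSph n) :
    absInner (act g u) (act (theta g) v) * (stretch g u * stretch (theta g) v) =
      absInner u v := by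
  have h1 := (stretch_pos g u).ne'
  have h2 := (stretch_pos (theta g) v).ne'
  obtain ⟨s, rfl⟩ := PSph.mk_surjective u
  obtain ⟨t, rfl⟩ := PSph.mk_surjective v
  rw [stretch_mk] at h1 h2
  simp only [act_mk, absInner_mk, stretch_mk, sphAct, real_inner_smul_left, real_inner_smul_right,
    inner_linAct_theta, abs_mul, abs_inv, abs_norm]
  field_simp

theorem theta_one : theta (1 : G n) = 1 := by
  apply Subtype.ext
  simp [theta]

theorem theta_inv (g : G n) : theta g⁻¹ = (theta g)⁻¹ := by
  refine eq_inv_of_mul_eq_one_left ?_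
  rw [← theta_mul, inv_mul_cancel, theta_one]

theorem theta_theta (g : G n) : theta (theta g) = g := by
  have h : theta (theta g) = Matrix.SpecialLinearGroup.transpose (theta g⁻¹) := by
    rw [theta_inv]; rfl
  rw [h]
  apply Subtype.ext
  simp [theta]

end ProjectiveSphere

/-! ### Polar coordinates -/

section Polar

variable {n : ℕ} [NeZero n]

/-- The area of the unit sphere. -/
noncomputable def sphereArea (n : ℕ) : ℝ := (volume : Measure (E n)).toSphere.real Set.univ

theorem sphereArea_pos : 0 < sphereArea n := by
  rw [sphereArea, Measure.real, ENNReal.toReal_pos_iff]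
  refine ⟨?_, measure_lt_top _ _⟩
  rw [pos_iff_ne_zero, Ne, Measure.measure_univ_eq_zero]
  exact Measure.toSphere_ne_zero _

theorem toSphere_eq : (volume : Measure (E n)).toSphere = ENNReal.ofReal (sphereArea n) • surf n := by
  rw [sphereArea, ofReal_measureReal, surf, smul_smul, ENNReal.mul_inv_cancel, one_smul]
  · rw [Ne, Measure.measure_univ_eq_zero]
    exact Measure.toSphere_ne_zero _
  · exact measure_ne_top _ _

/-- The measure of polar coordinates without the Jacobian. -/
noncomputable def polarMeasure (n : ℕ) : Measure (Sph n × ℝ) :=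
  (surf n).prod (volume.restrict (Set.Ioi 0))

theorem lintegral_polar {f : E n → ENNReal} (hf : Measurable f) :
    ∫⁻ x, f x = ENNReal.ofReal (sphereArea n) * ∫⁻ s, (∫⁻ r in Set.Ioi (0 : ℝ),
      ENNReal.ofReal (r ^ (n - 1)) * f (r • (s : E n))) ∂(surf n) := by
  have h1 : ∫⁻ x, f x = ∫⁻ x : ({0}ᶜ : Set (E n)), f x ∂((volume : Measure (E n)).comap (↑)) := by
    rw [lintegral_subtype_comap (measurableSet_singleton (0 : E n)).compl f,
      setLIntegral_congr (t := Set.univ) (by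
        rw [ae_eq_univ, compl_compl]; exact measure_singleton _), Measure.restrict_univ]
  have h2 := (Measure.measurePreserving_homeomorphUnitSphereProd
    (volume : Measure (E n))).lintegral_comp_emb (Homeomorph.measurableEmbedding _)
    (fun q => f (q.2.1 • (q.1 : E n)))
  have h3 : ∀ x : ({0}ᶜ : Set (E n)), ((homeomorphUnitSphereProd (E n) x).2.1 •
      ((homeomorphUnitSphereProd (E n) x).1 : E n)) = x := fun x => by
    have hx : ‖(x : E n)‖ ≠ 0 := norm_ne_zero_iff.2 x.2
    simp [smul_smul, hx]
  simp_rw [h3] at h2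
  rw [h1, h2, lintegral_prod, toSphere_eq, lintegral_smul_measure, smul_eq_mul]
  · congr 1
    refine lintegral_congr fun s => ?_
    rw [Measure.volumeIoiPow, lintegral_withDensity_eq_lintegral_mul]
    · simp only [Pi.mul_apply, finrank_euclideanSpace, Fintype.card_fin]
      rw [lintegral_subtype_comap measurableSet_Ioi
        (fun r : ℝ => ENNReal.ofReal (r ^ (n - 1)) * f (r • (s : E n)))]
    · fun_prop
    · exact hf.comp (by fun_prop)
  · exact (hf.comp (by fun_prop)).aemeasurable

theorem measurePreserving_polar :
    MeasurePreserving (fun p : Sph n × ℝ => p.2 • (p.1 : E n))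
      ((polarMeasure n).withDensity fun p => ENNReal.ofReal (sphereArea n * p.2 ^ (n - 1)))
      volume := by
  have hm : Measurable fun p : Sph n × ℝ => p.2 • (p.1 : E n) := by fun_prop
  refine ⟨hm, Measure.ext_of_lintegral _ fun f hf => ?_⟩
  rw [lintegral_map hf hm, lintegral_withDensity_eq_lintegral_mul _ (by fun_prop)
    (g := fun p : Sph n × ℝ => f (p.2 • (p.1 : E n))) (hf.comp hm), lintegral_polar hf,
    polarMeasure, lintegral_prod, ← lintegral_const_mul]
  · refine lintegral_congr fun s => ?_
    rw [← lintegral_const_mul]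
    · refine lintegral_congr fun r => ?_
      simp only [Pi.mul_apply]
      rw [ENNReal.ofReal_mul sphereArea_pos.le, mul_assoc]
    · have : Measurable fun r : ℝ => f (r • (s : E n)) := hf.comp (by fun_prop)
      fun_prop
  · have h : Measurable fun p : Sph n × ℝ => ENNReal.ofReal (p.2 ^ (n - 1)) * f (p.2 • (p.1 : E n)) :=
      Measurable.mul (by fun_prop) (hf.comp hm)
    exact h.lintegral_prod_right'
  · exact (Measurable.mul (by fun_prop) (hf.comp hm)).aemeasurable

theorem polar_density_nonneg : ∀ᵐ p ∂(polarMeasure n), 0 ≤ sphereArea n * p.2 ^ (n - 1) := by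
  have h : ∀ᵐ p ∂(polarMeasure n), 0 < p.2 :=
    Measure.quasiMeasurePreserving_snd.ae (ae_restrict_mem measurableSet_Ioi)
  filter_upwards [h] with p hp
  have := (sphereArea_pos (n := n)).le
  positivity

theorem integrable_polar {f : E n → ℂ} (hf : Integrable f) :
    Integrable (fun p : Sph n × ℝ => (sphereArea n * p.2 ^ (n - 1)) • f (p.2 • (p.1 : E n)))
      (polarMeasure n) := by
  have h := measurePreserving_polar.integrable_comp_of_integrable hf
  rw [integrable_withDensity_iff_integrable_smul' (by fun_prop) (by simp)] at h
  refine h.congr ?_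
  filter_upwards [polar_density_nonneg] with p hp
  rw [ENNReal.toReal_ofReal hp, Function.comp_apply]

theorem integral_polar {f : E n → ℂ} (hf : Integrable f) :
    ∫ x, f x = ∫ p, (sphereArea n * p.2 ^ (n - 1)) • f (p.2 • (p.1 : E n)) ∂(polarMeasure n) := by
  have h := measurePreserving_polar (n := n)
  rw [← h.map_eq, integral_map h.measurable.aemeasurable (by rw [h.map_eq]; exact hf.1),
    integral_withDensity_eq_integral_toReal_smul (by fun_prop) (by simp)]
  refine integral_congr_ae ?_
  filter_upwards [polar_density_nonneg] with p hp
  rw [ENNReal.toReal_ofReal hp]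

theorem integral_polar_iterated {f : E n → ℂ} (hf : Integrable f) :
    ∫ x, f x = sphereArea n * ∫ s, (∫ r in Set.Ioi (0 : ℝ), (r ^ (n - 1)) • f (r • (s : E n)))
      ∂(surf n) := by
  have h := integrable_polar hf
  rw [integral_polar hf, polarMeasure, integral_prod _ h, ← integral_const_mul]
  refine integral_congr_ae (Eventually.of_forall fun s => ?_)
  simp only [← integral_const_mul]
  refine integral_congr_ae (Eventually.of_forall fun r => ?_)
  simp [mul_assoc]

end Polar

/-! ### The action of `G` on the measure of the sphere -/

section ChangeOfVariables

variable {n : ℕ}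

theorem measurePreserving_linAct (g : G n) :
    MeasurePreserving (linAct g : E n → E n) volume volume := by
  have h1 : MeasurePreserving (fun x : Fin n → ℝ => g.1.mulVec x) volume volume := by
    refine ⟨by fun_prop, ?_⟩
    have h := Real.map_matrix_volume_pi_eq_smul_volume_pi (M := g.1) (by rw [g.2]; exact one_ne_zero)
    rw [g.2] at h
    simpa using! h
  exact (PiLp.volume_preserving_toLp (Fin n)).comp
    (h1.comp (PiLp.volume_preserving_ofLp (Fin n)))

variable [NeZero n]

/-- The radial projection onto the sphere. -/
noncomputable def sphProj (x : E n) : Sph n :=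
  ⟨if x = 0 then (e1 n : E n) else ‖x‖⁻¹ • x, by
    split_ifs with h
    · exact (e1 n).2
    · rw [mem_sphere_zero_iff_norm, norm_smul, norm_inv, norm_norm,
        inv_mul_cancel₀ (norm_ne_zero_iff.2 h)]⟩

theorem measurable_sphProj : Measurable (sphProj : E n → Sph n) := by
  refine Measurable.subtype_mk ?_
  exact Measurable.ite (measurableSet_singleton 0) measurable_const (by fun_prop)

theorem sphProj_coe {x : E n} (hx : x ≠ 0) : (sphProj x : E n) = ‖x‖⁻¹ • x := by
  simp [sphProj, hx]

theorem sphProj_smul {r : ℝ} (hr : 0 < r) (s : Sph n) : sphProj (r • (s : E n)) = s := by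
  apply Subtype.ext
  rw [sphProj_coe (smul_ne_zero hr.ne' s.ne_zero), norm_smul, norm_eq_of_mem_sphere, smul_smul,
    Real.norm_of_nonneg hr.le, mul_one, inv_mul_cancel₀ hr.ne', one_smul]

theorem sphProj_linAct_smul (g : G n) {r : ℝ} (hr : 0 < r) (s : Sph n) :
    sphProj (linAct g (r • (s : E n))) = sphAct g s := by
  apply Subtype.ext
  rw [sphProj_coe (linAct_ne_zero g (smul_ne_zero hr.ne' s.ne_zero)), linAct_smul, norm_smul,
    smul_smul, Real.norm_of_nonneg hr.le, sphAct, mul_inv, mul_right_comm, inv_mul_cancel₀ hr.ne',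
    one_mul]

theorem lintegral_radial {a : ℝ} (ha : 0 < a) :
    ∫⁻ r in Set.Ioi (0 : ℝ), ENNReal.ofReal (r ^ (n - 1)) *
      (Set.Iio 1).indicator (fun _ => (1 : ENNReal)) (r * a) =
      ENNReal.ofReal ((a ^ n)⁻¹) * ENNReal.ofReal ((n : ℝ)⁻¹) := by
  have h0 : (n : ℝ) ≠ 0 := NeZero.ne _
  have h1 : ∀ r : ℝ, ENNReal.ofReal (r ^ (n - 1)) *
      (Set.Iio 1).indicator (fun _ => (1 : ENNReal)) (r * a) =
      (Set.Iio a⁻¹).indicator (fun r => ENNReal.ofReal (r ^ (n - 1))) r := fun r => by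
    by_cases h : r * a < 1
    · have h' : r < a⁻¹ := by rwa [← one_div, lt_div_iff₀ ha]
      simp [h, h']
    · have h' : ¬ r < a⁻¹ := by rwa [← one_div, lt_div_iff₀ ha]
      simp [h, h']
  simp_rw [h1]
  rw [lintegral_indicator measurableSet_Iio, Measure.restrict_restrict measurableSet_Iio,
    Set.inter_comm, Set.Ioi_inter_Iio, Measure.restrict_congr_set Ioo_ae_eq_Ioc,
    ← ofReal_integral_eq_lintegral_ofReal]
  · rw [← intervalIntegral.integral_of_le (by positivity), integral_pow,
      ← ENNReal.ofReal_mul (by positivity)]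
    have hn : n - 1 + 1 = n := Nat.sub_add_cancel (NeZero.one_le)
    congr 1
    have hc : ((n - 1 : ℕ) : ℝ) + 1 = n := by exact_mod_cast hn
    rw [hn, hc, zero_pow (NeZero.ne n), sub_zero, inv_pow]
    rfl
  · exact (intervalIntegral.intervalIntegrable_pow (n - 1)).1
  · filter_upwards [ae_restrict_mem measurableSet_Ioc] with r hr
    exact pow_nonneg hr.1.le _

/-- F is extended to be constant on rays and cut off to the unit ball. Since det g = 1, composing
with g does not change the Lebesgue integral. On the ray through s the cutoff becomes r < 1/‖g(s)‖,
whose radial volume is ‖g(s)‖^(-n)/n. Comparison with the case g = 1 gives the Jacobian. -/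
theorem lintegral_sphAct (g : G n) {F : Sph n → ENNReal} (hF : Measurable F) :
    ∫⁻ s, ENNReal.ofReal ((‖linAct g (s : E n)‖ ^ n)⁻¹) * F (sphAct g s) ∂(surf n) =
      ∫⁻ s, F s ∂(surf n) := by
  set f : E n → ENNReal := fun x =>
    F (sphProj x) * (Set.Iio 1).indicator (fun _ => (1 : ENNReal)) ‖x‖ with hf
  have hfm : Measurable f :=
    (hF.comp measurable_sphProj).mul
      ((measurable_const.indicator measurableSet_Iio).comp measurable_norm)
  have hc1 : ENNReal.ofReal ((n : ℝ)⁻¹) ≠ 0 := by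
    have : 0 < (n : ℝ)⁻¹ := inv_pos.2 (Nat.cast_pos.2 (NeZero.pos n))
    exact (ENNReal.ofReal_pos.2 this).ne'
  have hc2 : ENNReal.ofReal (sphereArea n) ≠ 0 := by simpa using sphereArea_pos (n := n)
  have key : ∀ h : G n, ∫⁻ x, f (linAct h x) = ENNReal.ofReal (sphereArea n) *
      ((∫⁻ s, ENNReal.ofReal ((‖linAct h (s : E n)‖ ^ n)⁻¹) * F (sphAct h s) ∂(surf n)) *
        ENNReal.ofReal ((n : ℝ)⁻¹)) := by
    intro h
    rw [lintegral_polar (f := fun x => f (linAct h x)) (hfm.comp (continuous_linAct h).measurable)]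
    congr 1
    rw [← lintegral_mul_const]
    · refine lintegral_congr fun s => ?_
      have hpos : 0 < ‖linAct h (s : E n)‖ := norm_pos_iff.2 (linAct_ne_zero h s.ne_zero)
      rw [mul_right_comm, ← lintegral_radial hpos, ← lintegral_mul_const]
      · refine setLIntegral_congr_fun measurableSet_Ioi fun r hr => ?_
        have hr : 0 < r := hr
        simp only [hf]
        rw [sphProj_linAct_smul h hr, linAct_smul, norm_smul, Real.norm_of_nonneg hr.le]
        ring
      · exact Measurable.mul (by fun_prop)
          ((measurable_const.indicator measurableSet_Iio).comp (by fun_prop))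
    · refine Measurable.mul ?_ (hF.comp (continuous_sphAct h).measurable)
      have := ((continuous_linAct h).comp (continuous_subtype_val (p := fun x => x ∈ Metric.sphere (0 : E n) 1))).measurable
      exact ((this.norm.pow_const n).inv).ennreal_ofReal
  have h1 := key g
  rw [(measurePreserving_linAct g).lintegral_comp hfm] at h1
  have h2 := key 1
  simp only [linAct_one] at h2
  rw [h1] at h2
  have h3 := (ENNReal.mul_right_inj hc2 ENNReal.ofReal_ne_top).1 h2
  have h4 := (ENNReal.mul_left_inj hc1 ENNReal.ofReal_ne_top).1 h3
  rw [h4]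
  refine lintegral_congr fun s => ?_
  have h5 : sphAct 1 s = s := by apply Subtype.ext; simp [sphAct, linAct_one]
  rw [h5, norm_eq_of_mem_sphere]
  simp

theorem lintegral_act (g : G n) {F : PSph n → ENNReal} (hF : Measurable F) :
    ∫⁻ u, ENNReal.ofReal ((stretch g u ^ n)⁻¹) * F (act g u) ∂(nu n) = ∫⁻ u, F u ∂(nu n) := by
  rw [lintegral_nu hF, lintegral_nu, ← lintegral_sphAct g (F := fun s => F (PSph.mk s)) (hF.comp PSph.measurable_mk)]
  · rfl
  · exact ((((continuous_stretch g).measurable.pow_const n).inv).ennreal_ofReal).mul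
      (hF.comp (continuous_act g).measurable)

/-! ### The representations `π_μ` on `L²(S̃)` -/

/-- The line Re μ = -n/2 is exactly the one on which the squared modulus of the multiplier is the
Jacobian of the action on the sphere, hence the one on which π_μ is unitary. -/
theorem enorm_stretch_cpow_sq (g : G n) (u : PSph n) {μ : ℂ} (hμ : μ.re = -(n : ℝ) / 2) :
    ‖((stretch g u : ℝ) : ℂ) ^ μ‖ₑ ^ 2 = ENNReal.ofReal ((stretch g u ^ n)⁻¹) := by
  have hp := stretch_pos g u
  rw [← ofReal_norm, Complex.norm_cpow_eq_rpow_re_of_pos hp, ← ENNReal.ofReal_pow (by positivity),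
    ← Real.rpow_natCast _ 2, ← Real.rpow_mul hp.le, hμ]
  congr 1
  rw [show -(n : ℝ) / 2 * (2 : ℕ) = -(n : ℝ) by push_cast; ring, Real.rpow_neg hp.le,
    Real.rpow_natCast]

theorem measurable_stretch_cpow (g : G n) (μ : ℂ) :
    Measurable fun u => ((stretch g u : ℝ) : ℂ) ^ μ :=
  (Complex.measurable_ofReal.comp (continuous_stretch g).measurable).pow_const μ

theorem stretch_cpow_ne_zero (g : G n) (u : PSph n) (μ : ℂ) : ((stretch g u : ℝ) : ℂ) ^ μ ≠ 0 := by
  rw [Ne, Complex.cpow_eq_zero_iff]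
  have := (stretch_pos g u).ne'
  simp [this]

theorem isWeighted_act (g : G n) {μ : ℂ} (hμ : μ.re = -(n : ℝ) / 2) :
    IsWeighted (act g) (fun u => ((stretch g u : ℝ) : ℂ) ^ μ) (nu n) (nu n) where
  measurable_weight := measurable_stretch_cpow g μ
  ne_zero u := stretch_cpow_ne_zero g u μ
  preserving := by
    refine ⟨(continuous_act g).measurable, Measure.ext_of_lintegral _ fun F hF => ?_⟩
    simp_rw [enorm_stretch_cpow_sq g _ hμ]
    rw [lintegral_map hF (continuous_act g).measurable, lintegral_withDensity_eq_lintegral_mul _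
      (f := fun u => ENNReal.ofReal ((stretch g u ^ n)⁻¹))
      (((continuous_stretch g).measurable.pow_const n).inv).ennreal_ofReal
      (g := fun u => F (act g u)) (hF.comp (continuous_act g).measurable)]
    exact lintegral_act g hF

/-- The operator `π_μ(g)`. -/
noncomputable def repIsometry (μ : ℂ) (hμ : μ.re = -(n : ℝ) / 2) (g : G n) : L2S n →ₗᵢ[ℂ] L2S n :=
  (isWeighted_act g⁻¹ hμ).toLpIsometry

theorem repIsometry_coeFn {μ : ℂ} (hμ : μ.re = -(n : ℝ) / 2) (g : G n) (φ : L2S n) :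
    repIsometry μ hμ g φ =ᵐ[nu n] fun u => ((stretch g⁻¹ u : ℝ) : ℂ) ^ μ * φ (act g⁻¹ u) :=
  (isWeighted_act g⁻¹ hμ).toLpIsometry_coeFn φ

theorem repIsometry_one {μ : ℂ} (hμ : μ.re = -(n : ℝ) / 2) (φ : L2S n) :
    repIsometry μ hμ 1 φ = φ := by
  refine Lp.ext ?_
  filter_upwards [repIsometry_coeFn hμ 1 φ] with u hu
  rw [hu, inv_one, act_one, stretch_one]
  simp

theorem repIsometry_mul {μ : ℂ} (hμ : μ.re = -(n : ℝ) / 2) (g h : G n) (φ : L2S n) :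
    repIsometry μ hμ (g * h) φ = repIsometry μ hμ g (repIsometry μ hμ h φ) := by
  refine Lp.ext ?_
  filter_upwards [repIsometry_coeFn hμ (g * h) φ,
    repIsometry_coeFn hμ g (repIsometry μ hμ h φ),
    (isWeighted_act g⁻¹ hμ).quasiMeasurePreserving.ae (repIsometry_coeFn hμ h φ)] with u h1 h2 h3
  rw [h1, h2, h3, mul_inv_rev, act_mul, stretch_mul, Complex.ofReal_mul,
    Complex.mul_cpow_ofReal_nonneg (stretch_pos _ _).le (stretch_pos _ _).le]
  ring

/-- The unitary representation `π_μ`, for `Re μ = -n/2`. -/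
noncomputable def rep (μ : ℂ) (hμ : μ.re = -(n : ℝ) / 2) : G n →* (L2S n ≃ₗᵢ[ℂ] L2S n) where
  toFun g :=
    { (repIsometry μ hμ g).toLinearMap with
      invFun := repIsometry μ hμ g⁻¹
      left_inv := fun φ => by
        change repIsometry μ hμ g⁻¹ (repIsometry μ hμ g φ) = φ
        rw [← repIsometry_mul, inv_mul_cancel, repIsometry_one]
      right_inv := fun φ => by
        change repIsometry μ hμ g (repIsometry μ hμ g⁻¹ φ) = φ
        rw [← repIsometry_mul, mul_inv_cancel, repIsometry_one]
      norm_map' := (repIsometry μ hμ g).norm_map }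
  map_one' := by ext1 φ; exact repIsometry_one hμ φ
  map_mul' g h := by ext1 φ; exact repIsometry_mul hμ g h φ

theorem rep_apply {μ : ℂ} (hμ : μ.re = -(n : ℝ) / 2) (g : G n) (φ : L2S n) :
    rep μ hμ g φ = repIsometry μ hμ g φ := rfl

/-- The unitary representation `π_μ`, with values in the unitary group of `L²(S̃)`. -/
noncomputable def repUnitary (μ : ℂ) (hμ : μ.re = -(n : ℝ) / 2) :
    G n →* unitary (L2S n →L[ℂ] L2S n) :=
  (Unitary.linearIsometryEquiv (𝕜 := ℂ) (H := L2S n)).symm.toMonoidHom.comp (rep μ hμ)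

theorem repUnitary_apply {μ : ℂ} (hμ : μ.re = -(n : ℝ) / 2) (g : G n) (φ : L2S n) :
    (repUnitary μ hμ g : L2S n →L[ℂ] L2S n) φ = repIsometry μ hμ g φ := rfl

theorem isPiPlus_repUnitary {μ : ℂ} (hμ : μ.re = -(n : ℝ) / 2) : IsPiPlus μ (repUnitary μ hμ) := by
  intro g φ hφ
  rw [repUnitary_apply]
  refine ((isWeighted_act g⁻¹ hμ).toLpIsometry_toLp hφ).trans (Eventually.of_forall fun u => ?_)
  exact mul_comm _ _

end ChangeOfVariables

/-! ### Mellin transforms along rays -/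

section Rays

open scoped FourierTransform SchwartzMap

variable {n : ℕ}

/-- `∫₀^∞ r^(ζ-1) g(r x) dr`. -/
noncomputable def rayMellin (ζ : ℂ) (g : E n → ℂ) (x : E n) : ℂ :=
  mellin (fun r : ℝ => g (r • x)) ζ

/-- Homogeneity of degree -ζ is what converts the linear action of G on functions on ℝⁿ into the
multiplier of π_{-ζ} on the sphere. -/
theorem rayMellin_smul (ζ : ℂ) (g : E n → ℂ) {r : ℝ} (hr : 0 < r) (x : E n) :
    rayMellin ζ g (r • x) = (r : ℂ) ^ (-ζ) * rayMellin ζ g x := by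
  have h := mellin_comp_mul_right (fun t : ℝ => g (t • x)) ζ hr
  simp only [mul_smul] at h
  exact h

theorem schwartz_bound (g : 𝓢(E n, ℂ)) (N : ℕ) :
    ∃ C : ℝ, 0 < C ∧ ∀ x, ‖g x‖ ≤ C * ((1 + ‖x‖) ^ N)⁻¹ := by
  obtain ⟨C, hC⟩ : ∃ C : ℝ, ∀ x, (1 + ‖x‖) ^ N * ‖g x‖ ≤ C := by
    refine ⟨2 ^ N * ((Finset.Iic (N, 0)).sup fun m => SchwartzMap.seminorm ℝ m.1 m.2) g,
      fun x => ?_⟩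
    have := SchwartzMap.one_add_le_sup_seminorm_apply (𝕜 := ℝ) (m := (N, 0)) le_rfl le_rfl g x
    simpa using this
  refine ⟨max C 1, by positivity, fun x => ?_⟩
  have h : 0 < (1 + ‖x‖) ^ N := by positivity
  rw [← div_eq_mul_inv, le_div_iff₀ h, mul_comm]
  exact (hC x).trans (le_max_left _ _)

theorem integrableOn_majorant {ξ : ℝ} (hξ : 0 < ξ) {N : ℕ} (hN : ξ < N) :
    IntegrableOn (fun r : ℝ => r ^ (ξ - 1) * ((1 + r) ^ N)⁻¹) (Set.Ioi 0) := by
  refine mellin_convergent_of_isBigO_scalar (a := N) (b := 0) ?_ ?_ hN ?_ hξ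
  · refine ContinuousOn.locallyIntegrableOn (ContinuousOn.inv₀ (by fun_prop) fun r hr => ?_)
      measurableSet_Ioi
    have : (0 : ℝ) < r := hr
    positivity
  · refine Asymptotics.IsBigO.of_bound 1 ?_
    filter_upwards [eventually_gt_atTop 0] with r hr
    rw [one_mul, Real.rpow_neg hr.le, Real.rpow_natCast, Real.norm_of_nonneg (by positivity),
      Real.norm_of_nonneg (by positivity)]
    gcongr
    linarith
  · refine Asymptotics.IsBigO.of_bound 1 ?_
    filter_upwards [self_mem_nhdsWithin] with r hr
    have hr : (0 : ℝ) < r := hr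
    rw [one_mul, neg_zero, Real.rpow_zero, norm_one, Real.norm_of_nonneg (by positivity)]
    exact inv_le_one_of_one_le₀ (one_le_pow₀ (by linarith))

/-- The Mellin transform of `(1 + r)^(-N)`. -/
noncomputable def majorantMellin (ξ : ℝ) (N : ℕ) : ℝ :=
  ∫ r in Set.Ioi (0 : ℝ), r ^ (ξ - 1) * ((1 + r) ^ N)⁻¹

theorem majorant_scale {ξ ρ : ℝ} (hρ : 0 < ρ) (N : ℕ) {r : ℝ} (hr : 0 < r) :
    r ^ (ξ - 1) * ((1 + r * ρ) ^ N)⁻¹ =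
      ρ ^ (1 - ξ) * ((r * ρ) ^ (ξ - 1) * ((1 + r * ρ) ^ N)⁻¹) := by
  rw [Real.mul_rpow hr.le hρ.le, mul_comm (r ^ (ξ - 1)) (ρ ^ (ξ - 1)), mul_assoc, ← mul_assoc,
    ← Real.rpow_add hρ]
  simp

theorem integrableOn_majorant_scale {ξ ρ : ℝ} (hξ : 0 < ξ) {N : ℕ} (hN : ξ < N) (hρ : 0 < ρ) :
    IntegrableOn (fun r : ℝ => r ^ (ξ - 1) * ((1 + r * ρ) ^ N)⁻¹) (Set.Ioi 0) := by
  have h := (integrableOn_Ioi_comp_mul_right_iff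
    (fun r : ℝ => r ^ (ξ - 1) * ((1 + r) ^ N)⁻¹) 0 hρ).2 (by
      rw [zero_mul]; exact integrableOn_majorant hξ hN)
  have h2 : IntegrableOn (fun r : ℝ => ρ ^ (1 - ξ) * ((r * ρ) ^ (ξ - 1) * ((1 + r * ρ) ^ N)⁻¹))
      (Set.Ioi 0) := h.const_mul _
  refine h2.congr_fun (fun r hr => ?_) measurableSet_Ioi
  exact (majorant_scale hρ N hr).symm

theorem integral_majorant_scale {ξ ρ : ℝ} (hρ : 0 < ρ) (N : ℕ) :
    ∫ r in Set.Ioi (0 : ℝ), r ^ (ξ - 1) * ((1 + r * ρ) ^ N)⁻¹ =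
      ρ ^ (-ξ) * majorantMellin ξ N := by
  rw [setIntegral_congr_fun measurableSet_Ioi fun r hr => majorant_scale hρ N hr,
    integral_const_mul, integral_comp_mul_right_Ioi
      (fun r : ℝ => r ^ (ξ - 1) * ((1 + r) ^ N)⁻¹) 0 hρ, zero_mul, smul_eq_mul, ← mul_assoc,
    majorantMellin]
  congr 1
  rw [← Real.rpow_neg_one, ← Real.rpow_add hρ]
  congr 1
  ring

theorem norm_smul_le_majorant {g : 𝓢(E n, ℂ)} {N : ℕ} {C : ℝ}
    (hC : ∀ x, ‖g x‖ ≤ C * ((1 + ‖x‖) ^ N)⁻¹) (x : E n) {r : ℝ} (hr : 0 < r) :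
    ‖g (r • x)‖ ≤ C * ((1 + r * ‖x‖) ^ N)⁻¹ := by
  have := hC (r • x)
  rwa [norm_smul, Real.norm_of_nonneg hr.le] at this

theorem mellinConvergent_ray (g : 𝓢(E n, ℂ)) {x : E n} (hx : x ≠ 0) {ζ : ℂ} (hζ : 0 < ζ.re) :
    MellinConvergent (fun r : ℝ => g (r • x)) ζ := by
  obtain ⟨N, hN⟩ := exists_nat_gt ζ.re
  obtain ⟨C, -, hC⟩ := schwartz_bound g N
  rw [MellinConvergent, mellin_convergent_iff_norm subset_rfl measurableSet_Ioi
    (by fun_prop)]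
  refine ((integrableOn_majorant_scale hζ hN (norm_pos_iff.2 hx)).const_mul C).mono' ?_ ?_
  · refine AEStronglyMeasurable.mul ?_ (by fun_prop)
    exact (measurable_id.pow_const _).aestronglyMeasurable
  · filter_upwards [ae_restrict_mem measurableSet_Ioi] with r hr
    have hr : 0 < r := hr
    have := norm_smul_le_majorant hC x hr
    rw [norm_mul, norm_norm, Real.norm_of_nonneg (by positivity)]
    calc r ^ (ζ.re - 1) * ‖g (r • x)‖ ≤ r ^ (ζ.re - 1) * (C * ((1 + r * ‖x‖) ^ N)⁻¹) := by gcongr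
      _ = _ := by ring

theorem differentiableAt_mellin_ray (g : 𝓢(E n, ℂ)) {x : E n} (hx : x ≠ 0) {ζ : ℂ}
    (hζ : 0 < ζ.re) : DifferentiableAt ℂ (mellin fun r : ℝ => g (r • x)) ζ := by
  obtain ⟨N, hN⟩ := exists_nat_gt ζ.re
  obtain ⟨C, hC0, hC⟩ := schwartz_bound g N
  have hx' := norm_pos_iff.2 hx
  refine mellin_differentiableAt_of_isBigO_rpow (a := N) (b := 0)
    ((by fun_prop : Continuous fun r : ℝ => g (r • x)).locallyIntegrable.locallyIntegrableOn _)
    ?_ hN ?_ hζ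
  · refine Asymptotics.IsBigO.of_bound (C * (‖x‖ ^ N)⁻¹) ?_
    filter_upwards [eventually_gt_atTop 0] with r hr
    refine (norm_smul_le_majorant hC x hr).trans ?_
    rw [Real.rpow_neg hr.le, Real.rpow_natCast, Real.norm_of_nonneg (by positivity), mul_assoc,
      ← mul_inv, mul_comm (‖x‖ ^ N), ← mul_pow]
    gcongr
    linarith
  · refine Asymptotics.IsBigO.of_bound C ?_
    filter_upwards [self_mem_nhdsWithin] with r hr
    have hr : (0 : ℝ) < r := hr
    refine (norm_smul_le_majorant hC x hr).trans ?_
    rw [neg_zero, Real.rpow_zero, norm_one]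
    gcongr
    exact inv_le_one_of_one_le₀ (one_le_pow₀ (by nlinarith))

theorem exists_bound_rayMellin (g : 𝓢(E n, ℂ)) {ζ : ℂ} (hζ : 0 < ζ.re) :
    ∃ K : ℝ, ∀ s : Sph n, ‖rayMellin ζ g s‖ ≤ K := by
  obtain ⟨N, hN⟩ := exists_nat_gt ζ.re
  obtain ⟨C, hC0, hC⟩ := schwartz_bound g N
  refine ⟨C * majorantMellin ζ.re N, fun s => ?_⟩
  rw [rayMellin, mellin, majorantMellin, ← integral_const_mul]
  refine norm_integral_le_of_norm_le ((integrableOn_majorant hζ hN).const_mul C) ?_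
  filter_upwards [ae_restrict_mem measurableSet_Ioi] with r hr
  have hr : (0 : ℝ) < r := hr
  have := norm_smul_le_majorant hC (s : E n) hr
  rw [norm_eq_of_mem_sphere, mul_one] at this
  rw [norm_smul, Complex.norm_cpow_eq_rpow_re_of_pos hr, Complex.sub_re, Complex.one_re]
  calc r ^ (ζ.re - 1) * ‖g (r • (s : E n))‖ ≤ r ^ (ζ.re - 1) * (C * ((1 + r) ^ N)⁻¹) := by gcongr
    _ = _ := by ring

theorem aestronglyMeasurable_mellin_kernel {α : Type*} [MeasurableSpace α] (μ : Measure α)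
    [SFinite μ] {f : α × ℝ → ℂ} (hf : Measurable f) (ζ : ℂ) :
    AEStronglyMeasurable (fun p : α × ℝ => (p.2 : ℂ) ^ (ζ - 1) * f p)
      (μ.prod (volume.restrict (Set.Ioi 0))) := by
  refine (Measurable.mul ?_ hf).aestronglyMeasurable
  exact (Complex.measurable_ofReal.comp measurable_snd).pow_const _

theorem measurable_rayMellin {g : E n → ℂ} (hg : Continuous g) (ζ : ℂ) :
    StronglyMeasurable (rayMellin ζ g) := by
  have h : Measurable fun p : E n × ℝ => (p.2 : ℂ) ^ (ζ - 1) • g (p.2 • p.1) := by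
    simp only [smul_eq_mul]
    refine Measurable.mul ?_ (hg.measurable.comp
      (by fun_prop : Measurable fun p : E n × ℝ => p.2 • p.1))
    exact (Complex.measurable_ofReal.comp measurable_snd).pow_const _
  exact h.stronglyMeasurable.integral_prod_right

variable [NeZero n]

/-- Integrating over r first leaves a multiple of ‖x‖^(-Re ζ) (1 + ‖x‖)^(-N). This is integrable at
the origin because Re ζ < n, and at infinity because N > n. The same N also exceeds Re ζ, as the
integral along the ray requires. -/
theorem integrable_pairing (a c : 𝓢(E n, ℂ)) {ζ : ℂ} (h0 : 0 < ζ.re) (hn : ζ.re < n) :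
    Integrable (fun p : E n × ℝ => (p.2 : ℂ) ^ (ζ - 1) * (a p.1 * c (p.2 • p.1)))
      ((volume : Measure (E n)).prod (volume.restrict (Set.Ioi 0))) := by
  obtain ⟨N, hN⟩ := exists_nat_gt (n : ℝ)
  obtain ⟨A, hA0, hA⟩ := schwartz_bound a N
  obtain ⟨C, hC0, hC⟩ := schwartz_bound c N
  have hac : Measurable fun p : E n × ℝ => a p.1 * c (p.2 • p.1) :=
    (by fun_prop : Continuous fun p : E n × ℝ => a p.1 * c (p.2 • p.1)).measurable
  have hm := aestronglyMeasurable_mellin_kernel (volume : Measure (E n)) hac ζ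
  have hx : ∀ᵐ x : E n, x ≠ 0 := by simp [ae_iff]
  rw [integrable_prod_iff hm]
  constructor
  · filter_upwards [hx] with x hx
    have := (mellinConvergent_ray c hx h0).const_mul (a x)
    refine this.congr (Eventually.of_forall fun r => ?_)
    simp only [smul_eq_mul]
    ring
  · have hr : Integrable (fun x : E n => A * C * majorantMellin ζ.re N *
        (‖x‖ ^ (-ζ.re) * ((1 + ‖x‖) ^ N)⁻¹)) := by
      refine Integrable.const_mul ?_ _
      rw [integrable_fun_norm_addHaar (volume : Measure (E n)) (f := fun r : ℝ => r ^ (-ζ.re) * ((1 + r) ^ N)⁻¹)]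
      refine (integrableOn_majorant (ξ := n - ζ.re) (N := N) (by linarith) (by linarith)).congr_fun
        (fun r hr => ?_) measurableSet_Ioi
      have hr : (0 : ℝ) < r := hr
      simp only [finrank_euclideanSpace, Fintype.card_fin, smul_eq_mul]
      rw [← mul_assoc, ← Real.rpow_natCast r (n - 1), ← Real.rpow_add hr]
      congr 2
      rw [Nat.cast_sub NeZero.one_le]
      push_cast
      ring
    refine hr.mono' hm.norm.integral_prod_right' ?_
    filter_upwards [hx] with x hx
    have hx' := norm_pos_iff.2 hx
    rw [Real.norm_of_nonneg (integral_nonneg fun r => norm_nonneg _)]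
    calc ∫ r in Set.Ioi (0 : ℝ), ‖(r : ℂ) ^ (ζ - 1) * (a x * c (r • x))‖
        ≤ ∫ r in Set.Ioi (0 : ℝ), A * C * ((1 + ‖x‖) ^ N)⁻¹ *
          (r ^ (ζ.re - 1) * ((1 + r * ‖x‖) ^ N)⁻¹) := by
          refine integral_mono_of_nonneg (Eventually.of_forall fun r => norm_nonneg _)
            ((integrableOn_majorant_scale h0 (hn.trans hN) hx').const_mul _) ?_
          filter_upwards [ae_restrict_mem measurableSet_Ioi] with r hr
          have hr : (0 : ℝ) < r := hr
          have h1 := norm_smul_le_majorant hC x hr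
          have h2 := hA x
          rw [norm_mul, norm_mul, Complex.norm_cpow_eq_rpow_re_of_pos hr, Complex.sub_re,
            Complex.one_re]
          calc r ^ (ζ.re - 1) * (‖a x‖ * ‖c (r • x)‖)
              ≤ r ^ (ζ.re - 1) * ((A * ((1 + ‖x‖) ^ N)⁻¹) * (C * ((1 + r * ‖x‖) ^ N)⁻¹)) := by
                gcongr
            _ = _ := by ring
      _ = _ := by
          rw [integral_const_mul, integral_majorant_scale hx']
          ring

/-- Polar coordinates turn the Mellin transform of `∫ a(x) c(λ x) dx` into a pairing of the
Mellin transforms of `a` and `c` along the rays. -/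
theorem mellin_pairing (a c : 𝓢(E n, ℂ)) {ζ : ℂ} (h0 : 0 < ζ.re) (hn : ζ.re < n) :
    ∫ r in Set.Ioi (0 : ℝ), (r : ℂ) ^ (ζ - 1) * ∫ x, a x * c (r • x) =
      sphereArea n * ∫ s, rayMellin (n - ζ) a (s : E n) * rayMellin ζ c (s : E n) ∂(surf n) := by
  have hint := integrable_pairing a c h0 hn
  have h1 : ∀ x, ∫ r in Set.Ioi (0 : ℝ), (r : ℂ) ^ (ζ - 1) * (a x * c (r • x)) =
      a x * rayMellin ζ c x := fun x => by
    rw [rayMellin, mellin, ← integral_const_mul]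
    refine integral_congr_ae (Eventually.of_forall fun r => ?_)
    simp only [smul_eq_mul]
    ring
  simp_rw [← integral_const_mul]
  rw [integral_integral_swap (f := fun (r : ℝ) (x : E n) =>
    (r : ℂ) ^ (ζ - 1) * (a x * c (r • x))) hint.swap]
  simp_rw [h1]
  have h2 : Integrable fun x => a x * rayMellin ζ c x :=
    hint.integral_prod_left.congr (Eventually.of_forall h1)
  rw [integral_polar_iterated h2, integral_const_mul]
  congr 1
  apply integral_congr_ae
  refine Eventually.of_forall fun s => ?_
  simp only
  rw [rayMellin, mellin, ← integral_mul_const]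
  refine setIntegral_congr_fun measurableSet_Ioi fun r hr => ?_
  have hr : (0 : ℝ) < r := hr
  have hr' : (r : ℂ) ≠ 0 := by exact_mod_cast hr.ne'
  -- The Jacobian r^(n-1) and the homogeneity factor r^(-ζ) combine into the weight of the Mellin
  -- transform at n - ζ.
  have h3 : (r : ℂ) ^ ((n : ℂ) - ζ - 1) = (r : ℂ) ^ (n - 1) * (r : ℂ) ^ (-ζ) := by
    rw [← Complex.cpow_natCast, ← Complex.cpow_add _ _ hr']
    congr 1
    rw [Nat.cast_sub NeZero.one_le]
    push_cast
    ring
  simp only [rayMellin_smul ζ c hr, h3, smul_eq_mul, Complex.real_smul, Complex.ofReal_pow]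
  ring

/-! ### The Fourier transform and the Mellin transform -/

/-- The Fourier transform of a Schwartz function. -/
noncomputable abbrev hat (a : 𝓢(E n, ℂ)) : 𝓢(E n, ℂ) := 𝓕 a

/-- This is the multiplication formula for the Fourier transform attached to the symmetric form r⟨x,
y⟩, for which â is evaluated at ry. -/
theorem integral_fourier_smul (a b : 𝓢(E n, ℂ)) (r : ℝ) :
    ∫ x, a x * (hat b) (r • x) = ∫ x, b x * (hat a) (r • x) := by
  have h := VectorFourier.integral_fourierIntegral_smul_eq_flip (μ := (volume : Measure (E n)))
    (ν := (volume : Measure (E n))) (L := r • innerₗ (E n)) (f := a) (g := b)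
    Real.continuous_fourierChar (by
      simp only [LinearMap.smul_apply, innerₗ_apply_apply, smul_eq_mul]; fun_prop)
    a.integrable b.integrable
  have h1 : ∀ y, VectorFourier.fourierIntegral Real.fourierChar volume (r • innerₗ (E n)) a y =
      (hat a) (r • y) := fun y => by
    rw [hat, SchwartzMap.fourier_coe, Real.fourier_eq]
    simp only [VectorFourier.fourierIntegral, LinearMap.smul_apply, innerₗ_apply_apply,
      smul_eq_mul, real_inner_smul_right]
  have h2 : ∀ y, VectorFourier.fourierIntegral Real.fourierChar volume (r • innerₗ (E n)).flip b y =
      (hat b) (r • y) := fun y => by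
    rw [hat, SchwartzMap.fourier_coe, Real.fourier_eq]
    simp only [VectorFourier.fourierIntegral, LinearMap.flip_apply, LinearMap.smul_apply,
      innerₗ_apply_apply, smul_eq_mul, real_inner_smul_right, real_inner_comm]
  simp only [h1, h2, smul_eq_mul] at h
  rw [← h]
  simp_rw [mul_comm]

/-- Both sides are, up to the area of the sphere, Mellin transforms in r of the two equal integrals
of `integral_fourier_smul`. -/
theorem rayMellin_fourier_symm (a b : 𝓢(E n, ℂ)) {ζ : ℂ} (h0 : 0 < ζ.re) (hn : ζ.re < n) :
    ∫ s, rayMellin (n - ζ) a (s : E n) * rayMellin ζ (hat b) (s : E n) ∂(surf n) =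
      ∫ s, rayMellin (n - ζ) b (s : E n) * rayMellin ζ (hat a) (s : E n) ∂(surf n) := by
  have h1 := mellin_pairing a (hat b) h0 hn
  have h2 := mellin_pairing b (hat a) h0 hn
  simp_rw [integral_fourier_smul a b] at h1
  have h3 : (sphereArea n : ℂ) ≠ 0 := by exact_mod_cast sphereArea_pos.ne'
  exact mul_left_cancel₀ h3 (h1.symm.trans h2)

/-- The complex conjugate of a Schwartz function. -/
noncomputable def conjS (a : 𝓢(E n, ℂ)) : 𝓢(E n, ℂ) :=
  SchwartzMap.postcompCLM (𝕜 := ℝ) (Complex.conjCLE : ℂ →L[ℝ] ℂ) a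

theorem conjS_apply (a : 𝓢(E n, ℂ)) (x : E n) : conjS a x = conj (a x) := rfl

theorem fourier_conjS (a : 𝓢(E n, ℂ)) (x : E n) : hat (conjS a) x = conj ((𝓕⁻ a : 𝓢(E n, ℂ)) x) := by
  rw [hat, SchwartzMap.fourier_coe, SchwartzMap.fourierInv_coe, Real.fourier_eq', Real.fourierInv_eq',
    ← integral_conj]
  refine integral_congr_ae (Eventually.of_forall fun y => ?_)
  simp only [conjS_apply, smul_eq_mul, map_mul, ← Complex.exp_conj, Complex.conj_I,
    Complex.conj_ofReal]
  congr 2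
  push_cast
  ring

theorem rayMellin_conj (ζ : ℂ) {g g' : E n → ℂ} (h : ∀ x, g' x = conj (g x)) (x : E n) :
    rayMellin ζ g' x = conj (rayMellin (conj ζ) g x) := by
  rw [rayMellin, rayMellin, mellin, mellin, ← integral_conj]
  refine setIntegral_congr_fun measurableSet_Ioi fun r hr => ?_
  have hr : (0 : ℝ) < r := hr
  simp only [h, smul_eq_mul, map_mul]
  congr 1
  have harg : Complex.arg (r : ℂ) ≠ Real.pi := by
    rw [Complex.arg_ofReal_of_nonneg hr.le]; exact Real.pi_ne_zero.symm
  have := Complex.cpow_conj (r : ℂ) (conj ζ - 1) harg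
  rw [Complex.conj_ofReal] at this
  rw [← this]
  simp

/-- The map `M_{n-ζ} a ↦ M_ζ (hat a)` preserves the norm of `L²(S)` for `Re ζ = n/2`. -/
theorem integral_norm_sq_rayMellin_fourier (a : 𝓢(E n, ℂ)) {ζ : ℂ} (hζ : ζ.re = (n : ℝ) / 2) :
    ∫ s, ‖rayMellin (n - ζ) a (s : E n)‖ ^ 2 ∂(surf n) =
      ∫ s, ‖rayMellin ζ (hat a) (s : E n)‖ ^ 2 ∂(surf n) := by
  have hn : (0 : ℝ) < n := Nat.cast_pos.2 (NeZero.pos n)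
  have hc : conj ζ = n - ζ := by
    apply Complex.ext
    · simp [hζ]; ring
    · simp
  have hc' : conj ((n : ℂ) - ζ) = ζ := by rw [← hc, Complex.conj_conj]
  -- Take b to be the conjugate of â, so that b̂ is the conjugate of a. On the line Re ζ = n/2
  -- conjugation exchanges ζ and n - ζ, and both sides of the symmetry become integrals of squared
  -- moduli.
  have h := rayMellin_fourier_symm a (conjS (hat a)) (ζ := ζ) (by rw [hζ]; positivity)
    (by rw [hζ]; linarith)
  have h1 : ∀ x, hat (conjS (hat a)) x = conj (a x) := fun x => by
    rw [fourier_conjS, hat, FourierTransform.fourierInv_fourier_eq]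
  simp_rw [rayMellin_conj ζ h1, rayMellin_conj (n - ζ) (conjS_apply (hat a)), hc, hc'] at h
  have h2 : ∀ z : ℂ, z * conj z = ((‖z‖ ^ 2 : ℝ) : ℂ) := fun z => by
    rw [Complex.mul_conj, Complex.normSq_eq_norm_sq]
  have h3 : ∀ z : ℂ, conj z * z = ((‖z‖ ^ 2 : ℝ) : ℂ) := fun z => by rw [mul_comm, h2]
  simp_rw [h2, h3, integral_complex_ofReal] at h
  exact_mod_cast h

end Rays

/-! ### Gaussian subordination -/

section Gaussian

theorem ofReal_cpow_eq_exp {r : ℝ} (hr : 0 < r) (w : ℂ) :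
    (r : ℂ) ^ w = Complex.exp (Real.log r * w) := by
  rw [Complex.cpow_def_of_ne_zero (by exact_mod_cast hr.ne'), Complex.ofReal_log hr.le]

theorem one_div_pi_mul_sq_cpow {x : ℝ} (hx : x ≠ 0) (w : ℂ) :
    (1 / ((Real.pi * x ^ 2 : ℝ) : ℂ)) ^ w =
      (Real.pi : ℂ) ^ (-w) * ((|x| : ℝ) : ℂ) ^ (-2 * w) := by
  have h1 : (1 / ((Real.pi * x ^ 2 : ℝ) : ℂ)) = (((Real.pi * x ^ 2)⁻¹ : ℝ) : ℂ) := by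
    push_cast; rw [one_div]
  have h2 : 0 < |x| := abs_pos.2 hx
  rw [h1, ofReal_cpow_eq_exp (by positivity), ofReal_cpow_eq_exp Real.pi_pos,
    ofReal_cpow_eq_exp h2, ← Complex.exp_add, Real.log_inv, ← sq_abs x,
    Real.log_mul Real.pi_ne_zero (by positivity), Real.log_pow]
  congr 1
  push_cast
  ring

theorem one_div_pi_mul_sq_rpow {x : ℝ} (hx : x ≠ 0) (w : ℝ) :
    (1 / (Real.pi * x ^ 2)) ^ w = Real.pi ^ (-w) * |x| ^ (-2 * w) := by
  have h2 : 0 < |x| := abs_pos.2 hx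
  rw [one_div, ← sq_abs x, Real.inv_rpow (by positivity),
    Real.mul_rpow Real.pi_pos.le (by positivity), mul_inv, Real.rpow_neg Real.pi_pos.le]
  congr 1
  rw [← Real.rpow_natCast, ← Real.rpow_mul h2.le, ← Real.rpow_neg h2.le]
  congr 1
  push_cast
  ring

/-- The Mellin transform of a superposition of Gaussian functions. -/
theorem mellin_gaussian {α : Type*} [MeasurableSpace α] {μ : Measure α} [SFinite μ]
    {q : α → ℝ} {f : α → ℂ} (hq : Measurable q) (hf : Measurable f)
    (hq0 : ∀ᵐ x ∂μ, q x ≠ 0) {s : ℂ} (hs : 0 < s.re)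
    (hint : Integrable (fun x => ‖f x‖ * |q x| ^ (-2 * s.re)) μ) :
    mellin (fun t : ℝ => ∫ x, f x * Complex.exp (-(((Real.pi * q x ^ 2 : ℝ) : ℂ) * t)) ∂μ) s =
      Complex.Gamma s * (Real.pi : ℂ) ^ (-s) *
        ∫ x, f x * ((|q x| : ℝ) : ℂ) ^ (-2 * s) ∂μ := by
  have hpos : ∀ᵐ x ∂μ, 0 < Real.pi * q x ^ 2 := by
    filter_upwards [hq0] with x hx
    have := Real.pi_pos
    positivity
  have hm : AEStronglyMeasurable (fun p : α × ℝ => (p.2 : ℂ) ^ (s - 1) *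
      (f p.1 * Complex.exp (-(((Real.pi * q p.1 ^ 2 : ℝ) : ℂ) * p.2))))
      (μ.prod (volume.restrict (Set.Ioi 0))) :=
    aestronglyMeasurable_mellin_kernel μ (by fun_prop) s
  have hnorm : ∀ x, 0 < Real.pi * q x ^ 2 → ∀ t ∈ Set.Ioi (0 : ℝ), ‖(t : ℂ) ^ (s - 1) *
      (f x * Complex.exp (-(((Real.pi * q x ^ 2 : ℝ) : ℂ) * t)))‖ =
      ‖f x‖ * (t ^ (s.re - 1) * Real.exp (-(Real.pi * q x ^ 2 * t))) := by
    intro x hx t ht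
    rw [norm_mul, norm_mul, Complex.norm_cpow_eq_rpow_re_of_pos ht, Complex.norm_exp,
      Complex.sub_re, Complex.one_re, ← Complex.ofReal_mul, Complex.neg_re, Complex.ofReal_re]
    ring
  have hint2 : Integrable (fun p : α × ℝ => (p.2 : ℂ) ^ (s - 1) *
      (f p.1 * Complex.exp (-(((Real.pi * q p.1 ^ 2 : ℝ) : ℂ) * p.2))))
      (μ.prod (volume.restrict (Set.Ioi 0))) := by
    rw [integrable_prod_iff hm]
    constructor
    · filter_upwards [hpos, hm.prodMk_left] with x hx hmx
      rw [← integrable_norm_iff hmx]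
      have h : IntegrableOn (fun t : ℝ => ‖f x‖ *
          (t ^ (s.re - 1) * Real.exp (-(Real.pi * q x ^ 2 * t)))) (Set.Ioi 0) := by
        refine Integrable.const_mul ?_ _
        have := Real.integral_rpow_mul_exp_neg_mul_Ioi hs hx
        exact .of_integral_ne_zero (by rw [this]; have := Real.Gamma_pos_of_pos hs; positivity)
      exact h.congr_fun (fun t ht => (hnorm x hx t ht).symm) measurableSet_Ioi
    · have := hint.const_mul (Real.pi ^ (-s.re) * Real.Gamma s.re)
      refine this.congr ?_
      filter_upwards [hpos, hq0] with x hx hx0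
      rw [setIntegral_congr_fun measurableSet_Ioi (hnorm x hx), integral_const_mul,
        Real.integral_rpow_mul_exp_neg_mul_Ioi hs hx, one_div_pi_mul_sq_rpow hx0]
      ring
  rw [mellin]
  simp_rw [smul_eq_mul, ← integral_const_mul]
  rw [integral_integral_swap (f := fun (t : ℝ) (x : α) => (t : ℂ) ^ (s - 1) *
      (f x * Complex.exp (-(((Real.pi * q x ^ 2 : ℝ) : ℂ) * t)))) hint2.swap]
  refine integral_congr_ae ?_
  filter_upwards [hpos, hq0] with x hx hx0
  have h1 := Complex.integral_cpow_mul_exp_neg_mul_Ioi hs hx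
  rw [one_div_pi_mul_sq_cpow hx0] at h1
  have h2 : ∀ t : ℝ, (t : ℂ) ^ (s - 1) *
      (f x * Complex.exp (-(((Real.pi * q x ^ 2 : ℝ) : ℂ) * t))) =
      f x * ((t : ℂ) ^ (s - 1) * Complex.exp (-(((Real.pi * q x ^ 2 : ℝ) : ℂ) * t))) :=
    fun t => by ring
  simp_rw [h2]
  rw [integral_const_mul, h1]
  ring

theorem integrable_of_even {f : ℝ → ℂ} (he : ∀ x, f (-x) = f x)
    (hf : IntegrableOn f (Set.Ioi 0)) : Integrable f := by
  rw [← integrableOn_univ, ← Set.Iio_union_Ici (a := (0 : ℝ)), integrableOn_union,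
    integrableOn_Ici_iff_integrableOn_Ioi]
  refine ⟨?_, hf⟩
  rw [← (Measure.measurePreserving_neg (volume : Measure ℝ)).integrableOn_comp_preimage
    (Homeomorph.neg ℝ).measurableEmbedding]
  simpa [Function.comp_def, he] using hf

theorem integral_of_even {f : ℝ → ℂ} (he : ∀ x, f (-x) = f x)
    (hf : IntegrableOn f (Set.Ioi 0)) : ∫ x, f x = 2 * ∫ x in Set.Ioi 0, f x := by
  have h := integrable_of_even he hf
  rw [← intervalIntegral.integral_Iic_add_Ioi h.integrableOn h.integrableOn (b := (0 : ℝ))]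
  have h1 := integral_comp_neg_Ioi (0 : ℝ) f
  simp only [he, neg_zero] at h1
  rw [← h1]
  ring

end Gaussian

/-! ### The Fourier transform and the powers |⟨s, x⟩|^z -/

section FunctionalEquation

open scoped FourierTransform SchwartzMap

variable {n : ℕ} [NeZero n]

theorem integrable_abs_rpow_mul_gaussian {a : ℝ} (ha : -1 < a) :
    Integrable fun t : ℝ => |t| ^ a * Real.exp (-Real.pi * t ^ 2) := by
  have h : Integrable fun t : ℝ => ((|t| ^ a * Real.exp (-Real.pi * t ^ 2) : ℝ) : ℂ) := by
    refine integrable_of_even (fun x => by simp) ?_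
    refine Integrable.ofReal ?_
    refine (integrableOn_rpow_mul_exp_neg_mul_sq Real.pi_pos ha).congr_fun (fun t ht => ?_)
      measurableSet_Ioi
    simp only
    rw [abs_of_pos ht]
    rfl
  simpa only [Complex.ofReal_re, RCLike.re_to_complex] using h.re

/-- The Gaussian factorizes over the coordinates, and only the first factor carries the singular
power. A general direction s is reduced to this one by a reflection taking e₁ to s. -/
theorem integrable_coord_rpow_mul_gaussian {a : ℝ} (ha : -1 < a) :
    Integrable fun x : E n => |x 0| ^ a * Real.exp (-Real.pi * ‖x‖ ^ 2) := by
  have h : Integrable (fun x : Fin n → ℝ =>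
      ∏ i, ((if i = 0 then |x i| ^ a else 1) * Real.exp (-Real.pi * x i ^ 2))) := by
    refine Integrable.fintype_prod (f := fun (i : Fin n) (t : ℝ) =>
      (if i = 0 then |t| ^ a else 1) * Real.exp (-Real.pi * t ^ 2)) fun i => ?_
    by_cases hi : i = 0
    · simpa [hi] using integrable_abs_rpow_mul_gaussian ha
    · simpa [hi] using integrable_exp_neg_mul_sq Real.pi_pos
  rw [← (PiLp.volume_preserving_toLp (Fin n)).integrable_comp_emb
    (MeasurableEquiv.toLp 2 (Fin n → ℝ)).measurableEmbedding]
  refine h.congr (Eventually.of_forall fun x => ?_)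
  simp only [Finset.prod_mul_distrib, Finset.prod_ite_eq', Finset.mem_univ, if_true,
    Function.comp_apply, ← Real.exp_sum, ← Finset.mul_sum]
  simp [EuclideanSpace.norm_sq_eq]

theorem exists_isometry_e1 (s : Sph n) : ∃ L : E n ≃ₗᵢ[ℝ] E n, L (e1 n : E n) = s :=
  ⟨_, Submodule.reflection_sub (v := (e1 n : E n)) (w := (s : E n)) (by
    rw [norm_eq_of_mem_sphere, norm_eq_of_mem_sphere])⟩

theorem inner_e1 (x : E n) : inner ℝ (e1 n : E n) x = x 0 := by
  simp [e1, EuclideanSpace.inner_single_left]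

theorem integrable_inner_rpow_mul_gaussian (s : Sph n) {a : ℝ} (ha : -1 < a) :
    Integrable fun x : E n => |inner ℝ (s : E n) x| ^ a * Real.exp (-Real.pi * ‖x‖ ^ 2) := by
  obtain ⟨L, hL⟩ := exists_isometry_e1 s
  rw [← L.measurePreserving.integrable_comp_emb L.toHomeomorph.measurableEmbedding]
  refine (integrable_coord_rpow_mul_gaussian ha).congr (Eventually.of_forall fun x => ?_)
  simp only [Function.comp_apply, ← hL, LinearIsometryEquiv.inner_map_map, inner_e1,
    LinearIsometryEquiv.norm_map]

theorem ae_inner_ne_zero (s : Sph n) : ∀ᵐ x : E n, inner ℝ (s : E n) x ≠ 0 := by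
  have h : (LinearMap.ker (innerₗ (E n) (s : E n))) ≠ ⊤ := by
    intro h
    have h1 : (s : E n) ∈ LinearMap.ker (innerₗ (E n) (s : E n)) := by rw [h]; trivial
    simp at h1
  have h2 := Measure.addHaar_submodule (volume : Measure (E n)) _ h
  rw [ae_iff]
  refine measure_mono_null (fun x hx => ?_) h2
  simpa using hx

theorem hat_even {g : 𝓢(E n, ℂ)} (hg : ∀ x, g (-x) = g x) (x : E n) : hat g (-x) = hat g x := by
  rw [hat, SchwartzMap.fourier_coe, Real.fourier_eq, Real.fourier_eq, ← integral_neg_eq_self]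
  refine integral_congr_ae (Eventually.of_forall fun y => ?_)
  simp [hg]

/-- The Gaussian averages of `f` along `⟨s, x⟩` and of its Fourier transform along the line `ℝ s`. -/
theorem integral_gaussian_eq (f : 𝓢(E n, ℂ)) (s : E n) {t : ℝ} (ht : 0 < t) :
    ∫ x, f x * Complex.exp (-(((Real.pi * inner ℝ s x ^ 2 : ℝ) : ℂ) * t)) =
      (t : ℂ) ^ (-(1 / 2) : ℂ) * ∫ τ : ℝ, hat f (τ • s) *
        Complex.exp (-(((Real.pi * τ ^ 2 : ℝ) : ℂ) * (t⁻¹ : ℝ))) := by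
  have htc : (t : ℂ) ≠ 0 := by exact_mod_cast ht.ne'
  set b : ℂ := ((t⁻¹ : ℝ) : ℂ) with hb
  have hbre : 0 < b.re := by rw [hb, Complex.ofReal_re]; positivity
  have hbi : Integrable fun τ : ℝ => Complex.exp (-Real.pi * b * τ ^ 2) := by
    have := integrable_cexp_neg_mul_sq (b := Real.pi * b) (by
      rw [hb, ← Complex.ofReal_mul, Complex.ofReal_re]
      have := Real.pi_pos
      positivity)
    simpa only [neg_mul] using this
  -- This form pairs ℝⁿ with ℝ through the line ℝs. The transform of f is then f̂ restricted to the
  -- line, and the transform of the one-variable Gaussian is a Gaussian evaluated at ⟨s, x⟩.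
  let B : E n →ₗ[ℝ] ℝ →ₗ[ℝ] ℝ := LinearMap.mk₂ ℝ (fun x τ => τ * inner ℝ s x)
    (fun x y τ => by rw [inner_add_right, mul_add])
    (fun c x τ => by rw [real_inner_smul_right, smul_eq_mul]; ring)
    (fun x τ τ' => by rw [add_mul]) (fun c x τ => by rw [smul_eq_mul, smul_eq_mul, mul_assoc])
  have hB : ∀ x τ, B x τ = τ * inner ℝ s x := fun _ _ => rfl
  have h := VectorFourier.integral_fourierIntegral_smul_eq_flip (μ := (volume : Measure (E n)))
    (ν := (volume : Measure ℝ)) (L := B) (f := f)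
    (g := fun τ : ℝ => Complex.exp (-Real.pi * b * τ ^ 2)) Real.continuous_fourierChar
    (by simp only [hB]; fun_prop) f.integrable hbi
  have h1 : ∀ τ, VectorFourier.fourierIntegral Real.fourierChar volume B f τ = hat f (τ • s) :=
    fun τ => by
      rw [hat, SchwartzMap.fourier_coe, Real.fourier_eq]
      simp only [VectorFourier.fourierIntegral, hB, real_inner_smul_right, real_inner_comm]
  have h2 : ∀ x, VectorFourier.fourierIntegral Real.fourierChar volume B.flip
      (fun τ : ℝ => Complex.exp (-Real.pi * b * τ ^ 2)) x =
      (t : ℂ) ^ (1 / 2 : ℂ) * Complex.exp (-(((Real.pi * inner ℝ s x ^ 2 : ℝ) : ℂ) * t)) :=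
    fun x => by
      have h3 := congrFun (fourier_gaussian_pi hbre) (inner ℝ s x)
      rw [Real.fourier_real_eq] at h3
      have h4 : VectorFourier.fourierIntegral Real.fourierChar volume B.flip
          (fun τ : ℝ => Complex.exp (-Real.pi * b * τ ^ 2)) x =
          ∫ v : ℝ, Real.fourierChar (-(v * inner ℝ s x)) •
            Complex.exp (-Real.pi * b * v ^ 2) := rfl
      rw [h4, h3, hb]
      have h5 : ((t⁻¹ : ℝ) : ℂ) ^ (1 / 2 : ℂ) = ((t : ℂ) ^ (1 / 2 : ℂ))⁻¹ := by
        rw [ofReal_cpow_eq_exp ht, ofReal_cpow_eq_exp (inv_pos.2 ht), ← Complex.exp_neg,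
          Real.log_inv]
        congr 1
        push_cast
        ring
      rw [h5, one_div, inv_inv]
      congr 2
      push_cast
      field_simp
  simp only [h1, h2, smul_eq_mul] at h
  have h6 : ∀ τ : ℝ, Complex.exp (-(((Real.pi * τ ^ 2 : ℝ) : ℂ) * b)) =
      Complex.exp (-Real.pi * b * τ ^ 2) := fun τ => by
    congr 1
    push_cast
    ring
  simp_rw [h6, h]
  rw [← integral_const_mul]
  refine integral_congr_ae (Eventually.of_forall fun x => ?_)
  have h7 : (t : ℂ) ^ (-(1 / 2) : ℂ) * (t : ℂ) ^ (1 / 2 : ℂ) = 1 := by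
    rw [← Complex.cpow_add _ _ htc]; simp
  linear_combination (-(f x * Complex.exp (-(((Real.pi * inner ℝ s x ^ 2 : ℝ) : ℂ) * t)))) * h7

/-- The functional equation relating `|⟨s, x⟩|^z` and the Fourier transform. -/
theorem functional_equation (f : 𝓢(E n, ℂ)) (hfe : ∀ x, f (-x) = f x) {C : ℝ}
    (hC : ∀ x, ‖f x‖ ≤ C * Real.exp (-Real.pi * ‖x‖ ^ 2)) (s : Sph n) {z : ℂ}
    (hz1 : -1 < z.re) (hz0 : z.re < 0) :
    Complex.Gamma (-z / 2) * (Real.pi : ℂ) ^ (z / 2) *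
        ∫ x, f x * ((|inner ℝ (s : E n) x| : ℝ) : ℂ) ^ z =
      Complex.Gamma ((z + 1) / 2) * (Real.pi : ℂ) ^ (-((z + 1) / 2)) *
        (2 * rayMellin (-z) (hat f) (s : E n)) := by
  -- The exponents -z/2 here and (z+1)/2 below make the superposed Gaussians produce |⟨s, x⟩|^z and
  -- |τ|^(-z-1). Both have positive real part exactly in the strip -1 < Re z < 0.
  have h1 := mellin_gaussian (μ := (volume : Measure (E n))) (q := fun x => inner ℝ (s : E n) x)
    (f := f) (s := -z / 2) (by fun_prop) (by fun_prop) (ae_inner_ne_zero s) (by simpa using hz0)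
    (by
      have h := (integrable_inner_rpow_mul_gaussian s hz1).const_mul C
      refine h.mono' ((f.continuous.measurable.norm.mul
        (Measurable.pow_const (by fun_prop) _)).aestronglyMeasurable) (Eventually.of_forall fun x => ?_)
      have h2 : -2 * (-z / 2).re = z.re := by simp; ring
      rw [h2, Real.norm_of_nonneg (by positivity)]
      calc _ ≤ (C * Real.exp (-Real.pi * ‖x‖ ^ 2)) * |inner ℝ (s : E n) x| ^ z.re := by
            gcongr; exact hC x
        _ = _ := by ring)
  have hmc : MellinConvergent (fun r : ℝ => hat f (r • (s : E n))) (-z) :=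
    mellinConvergent_ray (hat f) s.ne_zero (by simpa using hz0)
  have heven : ∀ τ : ℝ, hat f ((-τ) • (s : E n)) = hat f (τ • (s : E n)) := fun τ => by
    rw [neg_smul, hat_even hfe]
  have hio : IntegrableOn (fun τ : ℝ => hat f (τ • (s : E n)) * ((|τ| : ℝ) : ℂ) ^ (-z - 1))
      (Set.Ioi 0) := by
    refine IntegrableOn.congr_fun hmc (fun τ hτ => ?_) measurableSet_Ioi
    have hτ : (0 : ℝ) < τ := hτ
    simp only [smul_eq_mul]
    rw [abs_of_pos hτ, mul_comm]
  have hie : ∀ τ : ℝ, hat f ((-τ) • (s : E n)) * ((|-τ| : ℝ) : ℂ) ^ (-z - 1) =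
      hat f (τ • (s : E n)) * ((|τ| : ℝ) : ℂ) ^ (-z - 1) := fun τ => by rw [heven, abs_neg]
  have h2 := mellin_gaussian (μ := (volume : Measure ℝ)) (q := fun τ => τ)
    (f := fun τ : ℝ => hat f (τ • (s : E n))) (s := (z + 1) / 2) (by fun_prop) (by fun_prop)
    (by simp [ae_iff]) (by simp; linarith)
    (by
      refine (integrable_of_even hie hio).norm.congr ?_
      have h0 : ∀ᵐ τ : ℝ, τ ≠ 0 := by simp [ae_iff]
      filter_upwards [h0] with τ hτ
      rw [norm_mul, Complex.norm_cpow_eq_rpow_re_of_pos (abs_pos.2 hτ)]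
      congr 2
      simp
      ring)
  have h3 : -2 * (-z / 2) = z := by ring
  have h4 : -2 * ((z + 1) / 2) = -z - 1 := by ring
  have h5 : -(-z / 2) = z / 2 := by ring
  rw [h3, h5] at h1
  rw [h4, integral_of_even hie hio] at h2
  have h6 : ∫ τ in Set.Ioi (0 : ℝ), hat f (τ • (s : E n)) * ((|τ| : ℝ) : ℂ) ^ (-z - 1) =
      rayMellin (-z) (hat f) (s : E n) := by
    rw [rayMellin, mellin]
    refine setIntegral_congr_fun measurableSet_Ioi fun τ hτ => ?_
    have hτ : (0 : ℝ) < τ := hτ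
    simp only [smul_eq_mul]
    rw [abs_of_pos hτ, mul_comm]
  rw [h6] at h2
  rw [← h1, ← h2]
  set K : ℝ → ℂ := fun u => ∫ τ : ℝ, hat f (τ • (s : E n)) *
    Complex.exp (-(((Real.pi * τ ^ 2 : ℝ) : ℂ) * u)) with hK
  -- By `integral_gaussian_eq` the first Gaussian average is t^(-1/2) K(1/t). Inverting t sends its
  -- Mellin transform at -z/2 to that of K at (z+1)/2.
  have h7 := mellin_cpow_smul (fun t : ℝ => K t⁻¹) (-z / 2) (-(1 / 2))
  rw [mellin_comp_inv K] at h7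
  have h8 : -(-z / 2 + -(1 / 2)) = (z + 1) / 2 := by ring
  rw [h8] at h7
  rw [← h7, mellin, mellin]
  refine setIntegral_congr_fun measurableSet_Ioi fun t ht => ?_
  simp only [integral_gaussian_eq f (s : E n) ht, smul_eq_mul, hK]

end FunctionalEquation

/-! ### Lifting smooth functions on the sphere to Schwartz functions -/

section Lift

open scoped SchwartzMap

variable {n : ℕ} [NeZero n]

/-- A bump function supported in `[1/2, 3/2]`. -/
noncomputable def radialBump : ContDiffBump (1 : ℝ) := ⟨1 / 4, 1 / 2, by norm_num, by norm_num⟩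

theorem radialBump_eq_zero {r : ℝ} (hr : r < 1 / 2 ∨ 3 / 2 < r) : radialBump r = 0 := by
  refine radialBump.zero_of_le_dist ?_
  change (1 / 2 : ℝ) ≤ _
  rw [Real.dist_eq]
  rcases hr with h | h
  · exact (by linarith : (1 / 2 : ℝ) ≤ -(r - 1)).trans (neg_le_abs _)
  · exact (by linarith : (1 / 2 : ℝ) ≤ r - 1).trans (le_abs_self _)

/-- The radial function `η(r) r^(-iτ)`. -/
noncomputable def radial (τ r : ℝ) : ℂ :=
  (radialBump r : ℂ) * Complex.exp (-(Complex.I * τ) * (Real.log r : ℂ))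

theorem radial_eq_zero (τ : ℝ) {r : ℝ} (hr : r < 1 / 2 ∨ 3 / 2 < r) : radial τ r = 0 := by
  rw [radial, radialBump_eq_zero hr, Complex.ofReal_zero, zero_mul]

theorem contDiffAt_radial (τ : ℝ) {r : ℝ} (hr : r ≠ 0) : ContDiffAt ℝ ∞ (radial τ) r := by
  have h1 : ContDiffAt ℝ ∞ (fun r : ℝ => (radialBump r : ℂ)) r :=
    Complex.ofRealCLM.contDiff.contDiffAt.comp r radialBump.contDiffAt
  have h2 : ContDiffAt ℝ ∞ (fun r : ℝ => (Real.log r : ℂ)) r :=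
    Complex.ofRealCLM.contDiff.contDiffAt.comp r (Real.contDiffAt_log.2 hr)
  exact h1.mul (contDiffAt_const.mul h2).cexp

/-- The Mellin transform of `radial`. -/
noncomputable def radialMellin (τ : ℝ) : ℂ → ℂ := mellin (radial τ)

theorem differentiable_radialMellin (τ : ℝ) : Differentiable ℂ (radialMellin τ) := fun ζ => by
  refine mellin_differentiableAt_of_isBigO_rpow (a := ζ.re + 1) (b := ζ.re - 1) ?_ ?_
    (by linarith) ?_ (by linarith)
  · refine ContinuousOn.locallyIntegrableOn (fun r hr => ?_) measurableSet_Ioi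
    exact (contDiffAt_radial τ (ne_of_gt hr)).continuousAt.continuousWithinAt
  · refine Asymptotics.IsBigO.of_bound 0 ?_
    filter_upwards [eventually_gt_atTop (3 / 2 : ℝ)] with r hr
    rw [radial_eq_zero τ (Or.inr hr)]
    simp
  · refine Asymptotics.IsBigO.of_bound 0 ?_
    filter_upwards [mem_nhdsWithin_of_mem_nhds (Iio_mem_nhds (by norm_num : (0 : ℝ) < 1 / 2))]
      with r hr
    rw [radial_eq_zero τ (Or.inl hr)]
    simp

/-- When Im ζ = τ the factor r^(-iτ) cancels the phase of r^(ζ-1). What remains is the integral of a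
nonnegative function that is positive near r = 1. -/
theorem radialMellin_ne_zero {ζ : ℂ} {τ : ℝ} (h : ζ.im = τ) : radialMellin τ ζ ≠ 0 := by
  have h1 : radialMellin τ ζ =
      ((∫ r in Set.Ioi (0 : ℝ), r ^ (ζ.re - 1) * radialBump r : ℝ) : ℂ) := by
    rw [radialMellin, mellin, ← integral_complex_ofReal]
    refine setIntegral_congr_fun measurableSet_Ioi fun r hr => ?_
    have hr : (0 : ℝ) < r := hr
    simp only [smul_eq_mul, radial]
    push_cast
    rw [Complex.ofReal_cpow hr.le, ofReal_cpow_eq_exp hr, ofReal_cpow_eq_exp hr,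
      mul_left_comm, ← Complex.exp_add, mul_comm]
    congr 2
    have h2 : ζ = ζ.re + τ * Complex.I := by rw [← h, Complex.re_add_im]
    rw [h2]
    simp
    ring
  rw [h1, Complex.ofReal_ne_zero]
  refine ne_of_gt ?_
  have hcont : ContinuousOn (fun r : ℝ => r ^ (ζ.re - 1) * radialBump r) (Set.Icc (1 / 2) (3 / 2)) :=
    ContinuousOn.mul (fun r hr => (Real.continuousAt_rpow_const _ _
      (Or.inl (by have := hr.1; intro h0; rw [h0] at this; norm_num at this))).continuousWithinAt)
      radialBump.continuous.continuousOn
  have hint : IntegrableOn (fun r : ℝ => r ^ (ζ.re - 1) * radialBump r) (Set.Ioi 0) := by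
    refine (hcont.integrableOn_Icc).of_forall_sdiff_eq_zero measurableSet_Ioi fun r hr => ?_
    have : r < 1 / 2 ∨ 3 / 2 < r := by
      by_contra hc
      push Not at hc
      exact hr.2 hc
    rw [radialBump_eq_zero this, mul_zero]
  rw [setIntegral_pos_iff_support_of_nonneg_ae]
  · refine lt_of_lt_of_le (?_ : 0 < volume (Set.Ioo (3 / 4 : ℝ) (5 / 4))) (measure_mono ?_)
    · rw [Real.volume_Ioo]; norm_num
    · intro r hr
      have h0 : (0 : ℝ) < r := lt_trans (by norm_num) hr.1
      refine ⟨?_, h0⟩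
      have : radialBump r = 1 := by
        refine radialBump.one_of_mem_closedBall ?_
        change dist r 1 ≤ 1 / 4
        rw [Real.dist_eq, abs_le]
        constructor <;> linarith [hr.1, hr.2]
      simp only [Function.mem_support, this, mul_one]
      exact (Real.rpow_pos_of_pos h0 _).ne'
  · filter_upwards [ae_restrict_mem measurableSet_Ioi] with r hr
    exact mul_nonneg (Real.rpow_nonneg (le_of_lt hr) _) radialBump.nonneg
  · exact hint

theorem PSph.mk_sphProj_neg (x : E n) : PSph.mk (sphProj (-x)) = PSph.mk (sphProj x) := by
  by_cases hx : x = 0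
  · simp [hx]
  · rw [← PSph.mk_neg]
    congr 1
    apply Subtype.ext
    change -(sphProj (-x) : E n) = _
    rw [sphProj_coe (neg_ne_zero.2 hx), sphProj_coe hx]
    simp

/-- An even Schwartz function with prescribed restrictions to the sphere and to the rays. -/
theorem exists_lift (τ : ℝ) {φ : PSph n → ℂ} (hφ : IsSmooth φ) :
    ∃ g : 𝓢(E n, ℂ), (∀ x, g (-x) = g x) ∧
      (∀ (s : Sph n) (r : ℝ), 0 < r → g (r • (s : E n)) = radial τ r * φ (PSph.mk s)) ∧
      ∃ C : ℝ, ∀ x, ‖g x‖ ≤ C * Real.exp (-Real.pi * ‖x‖ ^ 2) := by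
  obtain ⟨Φ, hΦ, hΦφ⟩ := hφ
  let f : E n → ℂ := fun x => radial τ ‖x‖ * φ (PSph.mk (sphProj x))
  have hf0 : ∀ x, (‖x‖ < 1 / 2 ∨ 3 / 2 < ‖x‖) → f x = 0 := fun x hx => by
    simp only [f, radial_eq_zero τ hx, zero_mul]
  have hsmooth : ContDiff ℝ ∞ f := by
    rw [contDiff_iff_contDiffAt]
    intro x
    by_cases hx : x = 0
    · subst hx
      refine (contDiffAt_const (c := (0 : ℂ))).congr_of_eventuallyEq ?_
      filter_upwards [Metric.ball_mem_nhds (0 : E n) (by norm_num : (0 : ℝ) < 1 / 2)] with x hx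
      exact hf0 x (Or.inl (by simpa using hx))
    · have h : ContDiffAt ℝ ∞ (fun x : E n => radial τ ‖x‖ * Φ (‖x‖⁻¹ • x)) x := by
        have hn : ContDiffAt ℝ ∞ (fun x : E n => ‖x‖) x := contDiffAt_norm ℝ hx
        refine ContDiffAt.mul ((contDiffAt_radial τ (norm_ne_zero_iff.2 hx)).comp x hn) ?_
        exact hΦ.contDiffAt.comp x ((hn.inv (norm_ne_zero_iff.2 hx)).smul contDiffAt_id)
      refine h.congr_of_eventuallyEq ?_
      filter_upwards [isOpen_ne.mem_nhds hx] with y hy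
      simp only [f]
      rw [hΦφ, sphProj_coe hy]
  have hsupp : HasCompactSupport f := by
    refine HasCompactSupport.of_support_subset_isCompact (isCompact_closedBall (0 : E n) (3 / 2))
      fun x hx => ?_
    rw [mem_closedBall_zero_iff]
    by_contra hc
    push Not at hc
    exact hx (hf0 x (Or.inr hc))
  refine ⟨hsupp.toSchwartzMap hsmooth, fun x => ?_, fun s r hr => ?_, ?_⟩
  · change f (-x) = f x
    simp only [f, norm_neg, PSph.mk_sphProj_neg]
  · change f (r • (s : E n)) = _
    simp only [f, sphProj_smul hr, norm_smul, norm_eq_of_mem_sphere, mul_one,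
      Real.norm_of_nonneg hr.le]
  · obtain ⟨C, hC⟩ := hsupp.exists_bound_of_continuous hsmooth.continuous
    have hC0 : 0 ≤ C := (norm_nonneg _).trans (hC 0)
    -- The support lies in the ball of radius 3/2, where e^(π(3/2)²) e^(-π‖x‖²) is at least 1.
    refine ⟨C * Real.exp (Real.pi * (3 / 2) ^ 2), fun x => ?_⟩
    change ‖f x‖ ≤ _
    by_cases hx : 3 / 2 < ‖x‖
    · rw [hf0 x (Or.inr hx), norm_zero]
      positivity
    · push Not at hx
      refine (hC x).trans ?_
      rw [mul_assoc, ← Real.exp_add]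
      refine le_mul_of_one_le_right hC0 (Real.one_le_exp ?_)
      have : ‖x‖ ^ 2 ≤ (3 / 2) ^ 2 := by gcongr
      have := mul_le_mul_of_nonneg_left this Real.pi_pos.le
      linarith

theorem rayMellin_lift {τ : ℝ} {φ : PSph n → ℂ} {g : E n → ℂ} {s : Sph n}
    (hg : ∀ r : ℝ, 0 < r → g (r • (s : E n)) = radial τ r * φ (PSph.mk s)) (ζ : ℂ) :
    rayMellin ζ g (s : E n) = radialMellin τ ζ * φ (PSph.mk s) := by
  rw [rayMellin, radialMellin, mellin, mellin, ← integral_mul_const]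
  refine setIntegral_congr_fun measurableSet_Ioi fun r hr => ?_
  simp only [hg r hr, smul_eq_mul, mul_assoc]

end Lift

/-! ### The integrals `∫ |⟨s, t⟩|^z φ(t) dt` -/

section Kernel

variable {n : ℕ} [NeZero n]

theorem absInner_le_one (u v : PSph n) : absInner u v ≤ 1 := by
  obtain ⟨s, rfl⟩ := PSph.mk_surjective u
  obtain ⟨t, rfl⟩ := PSph.mk_surjective v
  rw [absInner_mk]
  have := abs_real_inner_le_norm (s : E n) (t : E n)
  rwa [norm_eq_of_mem_sphere, norm_eq_of_mem_sphere, mul_one] at this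

theorem measurable_absInner_left (u : PSph n) : Measurable fun v => absInner u v :=
  (continuous_absInner.comp (by fun_prop : Continuous fun v : PSph n => (u, v))).measurable

instance : (ae ((volume : Measure ℝ).restrict (Set.Ioi 0))).NeBot := by
  rw [ae_neBot, Ne, Measure.restrict_eq_zero, Real.volume_Ioi]
  simp

theorem ae_radius_pos : ∀ᵐ p ∂(polarMeasure n), 0 < p.2 :=
  Measure.quasiMeasurePreserving_snd.ae (ae_restrict_mem measurableSet_Ioi)

/-- The hyperplane orthogonal to s is a null set of ℝⁿ. As it is a cone, polar coordinates and
Fubini make its trace on the sphere a null set. -/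
theorem ae_absInner_ne_zero (u : PSph n) : ∀ᵐ v ∂(nu n), absInner u v ≠ 0 := by
  obtain ⟨s, rfl⟩ := PSph.mk_surjective u
  have h0 : MeasurableSet {v | absInner (PSph.mk s) v ≠ 0} :=
    (measurableSet_eq_fun (measurable_absInner_left _) measurable_const).compl
  rw [nu, ae_map_iff PSph.measurable_mk.aemeasurable h0]
  have h1 := measurePreserving_polar.quasiMeasurePreserving.ae (ae_inner_ne_zero s)
  rw [ae_withDensity_iff (by fun_prop)] at h1
  have h2 : ∀ᵐ p ∂(polarMeasure n), inner ℝ (s : E n) (p.1 : E n) ≠ 0 := by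
    filter_upwards [h1, ae_radius_pos] with p hp hp0 h0
    refine hp ?_ ?_
    · have := sphereArea_pos (n := n)
      rw [Ne, ENNReal.ofReal_eq_zero, not_le]
      positivity
    · rw [real_inner_smul_right, h0, mul_zero]
  have h3 := Measure.ae_ae_of_ae_prod h2
  filter_upwards [h3] with t ht
  obtain ⟨r, hr⟩ := (ht : ∀ᵐ r ∂(volume.restrict (Set.Ioi (0 : ℝ))), _).exists
  simpa [absInner_mk] using hr

/-- In polar coordinates the Gaussian integral of |⟨s, x⟩|^a is finite, so by Fubini some sphere of
positive radius r has an integrable slice. On that slice the Gaussian and the powers of r are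
constants, which are divided out. -/
theorem integrable_absInner_rpow (u : PSph n) {a : ℝ} (ha : -1 < a) :
    Integrable (fun v => absInner u v ^ a) (nu n) := by
  obtain ⟨s, rfl⟩ := PSph.mk_surjective u
  refine (measurePreserving_mk.integrable_comp
    ((measurable_absInner_left _).pow_const _).aestronglyMeasurable).1 ?_
  have h1 := integrable_polar ((integrable_inner_rpow_mul_gaussian s ha).ofReal (𝕜 := ℂ))
  obtain ⟨r, hr, hr0⟩ := (h1.prod_left_ae.and (ae_restrict_mem measurableSet_Ioi)).exists
  have hr0 : (0 : ℝ) < r := hr0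
  have hA := sphereArea_pos (n := n)
  have h2 := (hr.const_mul (((sphereArea n * r ^ (n - 1) *
    (r ^ a * Real.exp (-Real.pi * r ^ 2)) : ℝ) : ℂ)⁻¹)).re
  refine h2.congr (Eventually.of_forall fun t => ?_)
  have h3 : 0 < sphereArea n * r ^ (n - 1) * (r ^ a * Real.exp (-Real.pi * r ^ 2)) := by positivity
  simp only [Function.comp_apply, absInner_mk, real_inner_smul_right, abs_mul, abs_of_pos hr0,
    norm_smul, norm_eq_of_mem_sphere, mul_one, Real.norm_of_nonneg hr0.le, Complex.real_smul]
  rw [Real.mul_rpow hr0.le (abs_nonneg _), ← Complex.ofReal_inv]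
  simp only [RCLike.re_to_complex, Complex.re_ofReal_mul, RCLike.ofReal_eq_complex_ofReal, Complex.ofReal_re]
  field_simp

/-- The integral `∫ |⟨s, t⟩|^z φ(t) dt`. -/
noncomputable def cosTransform (φ : PSph n → ℂ) (u : PSph n) (z : ℂ) : ℂ :=
  ∫ v, (absInner u v : ℂ) ^ z * φ v ∂(nu n)

theorem integrable_absInner_cpow (u : PSph n) {φ : PSph n → ℂ} (hφ : Continuous φ) {z : ℂ}
    (hz : -1 < z.re) : Integrable (fun v => (absInner u v : ℂ) ^ z * φ v) (nu n) := by
  obtain ⟨C, hC⟩ := hφ.bounded_above_of_compact_support (HasCompactSupport.of_compactSpace φ)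
  have h := (integrable_absInner_rpow u hz).mul_const C
  refine h.mono' ?_ ?_
  · exact (((Complex.measurable_ofReal.comp (measurable_absInner_left u)).pow_const z).mul
      hφ.measurable).aestronglyMeasurable
  · filter_upwards [ae_absInner_ne_zero u] with v hv
    rw [norm_mul, Complex.norm_cpow_eq_rpow_re_of_pos (lt_of_le_of_ne (absInner_nonneg u v) hv.symm)]
    gcongr
    · exact Real.rpow_nonneg (absInner_nonneg u v) _
    · exact hC v

theorem differentiableAt_cosTransform (u : PSph n) {φ : PSph n → ℂ} (hφ : Continuous φ) {z : ℂ}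
    (hz : -1 < z.re) : DifferentiableAt ℂ (cosTransform φ u) z := by
  obtain ⟨C, hC⟩ := hφ.bounded_above_of_compact_support (HasCompactSupport.of_compactSpace φ)
  -- The exponent drops by at most δ on the ball of radius δ, and absorbing the logarithm costs
  -- another δ. The value (Re z + 1)/4 keeps Re z - 2δ above -1.
  set δ : ℝ := (z.re + 1) / 4 with hδ
  have hδ0 : 0 < δ := by rw [hδ]; linarith
  have hmeas : Measurable fun v => (absInner u v : ℂ) :=
    Complex.measurable_ofReal.comp (measurable_absInner_left u)
  refine (hasDerivAt_integral_of_dominated_loc_of_deriv_le (μ := nu n)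
    (F := fun z v => (absInner u v : ℂ) ^ z * φ v)
    (F' := fun z v => (absInner u v : ℂ) ^ z * Complex.log (absInner u v) * φ v)
    (bound := fun v => absInner u v ^ (z.re - 2 * δ) * (1 / δ) * C)
    (Metric.ball_mem_nhds z hδ0) ?_ (integrable_absInner_cpow u hφ hz) ?_ ?_ ?_ ?_).2.differentiableAt
  · exact Eventually.of_forall fun w =>
      ((hmeas.pow_const w).mul hφ.measurable).aestronglyMeasurable
  · exact (((hmeas.pow_const z).mul (Complex.measurable_log.comp hmeas)).mul
      hφ.measurable).aestronglyMeasurable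
  · filter_upwards [ae_absInner_ne_zero u] with v hv w hw
    have hv0 : 0 < absInner u v := lt_of_le_of_ne (absInner_nonneg u v) hv.symm
    have hw1 : z.re - δ < w.re := by
      have h1 := (Complex.abs_re_le_norm (w - z)).trans_lt (by simpa [dist_eq_norm] using hw)
      rw [Complex.sub_re, abs_lt] at h1
      linarith [h1.1]
    have h2 := Real.abs_log_mul_self_rpow_lt _ δ hv0 (absInner_le_one u v) hδ0
    rw [norm_mul, norm_mul, Complex.norm_cpow_eq_rpow_re_of_pos hv0, ← Complex.ofReal_log hv0.le,
      Complex.norm_real, Real.norm_eq_abs]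
    have h3 : absInner u v ^ w.re ≤ absInner u v ^ (z.re - 2 * δ) * absInner u v ^ δ := by
      rw [← Real.rpow_add hv0]
      exact Real.rpow_le_rpow_of_exponent_ge hv0 (absInner_le_one u v) (by linarith)
    rw [abs_mul, abs_of_nonneg (Real.rpow_nonneg hv0.le δ)] at h2
    refine mul_le_mul ?_ (hC v) (norm_nonneg _) (by positivity)
    calc absInner u v ^ w.re * |Real.log (absInner u v)|
        ≤ absInner u v ^ (z.re - 2 * δ) * absInner u v ^ δ * |Real.log (absInner u v)| := by gcongr
      _ = absInner u v ^ (z.re - 2 * δ) * (|Real.log (absInner u v)| * absInner u v ^ δ) := by ring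
      _ ≤ _ := by gcongr
  · exact ((integrable_absInner_rpow u (by rw [hδ]; linarith)).mul_const _).mul_const _
  · filter_upwards [ae_absInner_ne_zero u] with v hv w _
    have h := (hasDerivAt_id w).const_cpow (c := (absInner u v : ℂ))
      (Or.inl (by exact_mod_cast hv))
    simpa using h.mul_const (φ v)

end Kernel

/-! ### The meromorphic continuation -/

section Continuation

open scoped FourierTransform SchwartzMap Topology

variable {n : ℕ} [NeZero n]

theorem integral_inner_cpow_mul {τ : ℝ} {φ : PSph n → ℂ} {g : 𝓢(E n, ℂ)}
    (hg : ∀ (s : Sph n) (r : ℝ), 0 < r → g (r • (s : E n)) = radial τ r * φ (PSph.mk s))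
    (hφ : Measurable φ)
    {C : ℝ} (hC : ∀ x, ‖g x‖ ≤ C * Real.exp (-Real.pi * ‖x‖ ^ 2)) (s : Sph n) {z : ℂ}
    (hz1 : -1 < z.re) :
    ∫ x, g x * ((|inner ℝ (s : E n) x| : ℝ) : ℂ) ^ z =
      sphereArea n * (radialMellin τ (z + n) * cosTransform φ (PSph.mk s) z) := by
  have hint : Integrable fun x => g x * ((|inner ℝ (s : E n) x| : ℝ) : ℂ) ^ z := by
    refine ((integrable_inner_rpow_mul_gaussian s hz1).const_mul C).mono'
      (g.continuous.measurable.mul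
        (Measurable.pow_const (by fun_prop) _)).aestronglyMeasurable ?_
    filter_upwards [ae_inner_ne_zero s] with x hx
    rw [norm_mul, Complex.norm_cpow_eq_rpow_re_of_pos (abs_pos.2 hx)]
    calc _ ≤ (C * Real.exp (-Real.pi * ‖x‖ ^ 2)) * |inner ℝ (s : E n) x| ^ z.re := by
          gcongr; exact hC x
      _ = _ := by ring
  rw [integral_polar_iterated hint, cosTransform, integral_nu, radialMellin, mellin]
  · congr 1
    rw [← integral_const_mul]
    refine integral_congr_ae (Eventually.of_forall fun t => ?_)
    simp only
    rw [← integral_mul_const]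
    refine setIntegral_congr_fun measurableSet_Ioi fun r hr => ?_
    have hr : (0 : ℝ) < r := hr
    have hr' : (r : ℂ) ≠ 0 := by exact_mod_cast hr.ne'
    have h3 : (r : ℂ) ^ (z + n - 1) = (r : ℂ) ^ (n - 1) * (r : ℂ) ^ z := by
      rw [← Complex.cpow_natCast, ← Complex.cpow_add _ _ hr']
      congr 1
      rw [Nat.cast_sub NeZero.one_le]
      push_cast
      ring
    simp only [hg t r hr, absInner_mk, real_inner_smul_right, abs_mul, abs_of_pos hr,
      Complex.ofReal_mul, Complex.mul_cpow_ofReal_nonneg hr.le (abs_nonneg _), h3, smul_eq_mul,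
      Complex.real_smul, Complex.ofReal_pow]
    ring
  · exact ((Complex.measurable_ofReal.comp (measurable_absInner_left _)).pow_const z).mul
      hφ |>.aestronglyMeasurable

/-- The factor of the functional equation. -/
noncomputable def kappa (n : ℕ) (z : ℂ) : ℂ :=
  2 / sphereArea n * (Real.pi : ℂ) ^ (-z - 1 / 2) * Complex.Gamma ((z + 1) / 2) *
    (Complex.Gamma (-z / 2))⁻¹

/-- This is the functional equation in polar coordinates. Its interest is that the Mellin transform
on the right converges for all Re z < 0, whereas the cosine integral on the left requires Re z > -1.
-/
theorem radialMellin_mul_cosTransform {τ : ℝ} {φ : PSph n → ℂ} {g : 𝓢(E n, ℂ)}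
    (hge : ∀ x, g (-x) = g x)
    (hg : ∀ (s : Sph n) (r : ℝ), 0 < r → g (r • (s : E n)) = radial τ r * φ (PSph.mk s))
    (hφ : Measurable φ)
    {C : ℝ} (hC : ∀ x, ‖g x‖ ≤ C * Real.exp (-Real.pi * ‖x‖ ^ 2)) (s : Sph n) {z : ℂ}
    (hz1 : -1 < z.re) (hz0 : z.re < 0) :
    radialMellin τ (z + n) * cosTransform φ (PSph.mk s) z =
      kappa n z * rayMellin (-z) (hat g) (s : E n) := by
  have h := functional_equation g hge hC s hz1 hz0
  rw [integral_inner_cpow_mul hg hφ hC s hz1] at h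
  have h1 : (sphereArea n : ℂ) ≠ 0 := by exact_mod_cast (sphereArea_pos (n := n)).ne'
  have h2 : Complex.Gamma (-z / 2) ≠ 0 := Complex.Gamma_ne_zero_of_re_pos (by simpa using hz0)
  have hpi : (Real.pi : ℂ) ≠ 0 := by exact_mod_cast Real.pi_ne_zero
  have h3 : (Real.pi : ℂ) ^ (-((z + 1) / 2)) =
      (Real.pi : ℂ) ^ (-z - 1 / 2) * (Real.pi : ℂ) ^ (z / 2) := by
    rw [← Complex.cpow_add _ _ hpi]
    congr 1
    ring
  have h4 : (Real.pi : ℂ) ^ (z / 2) ≠ 0 := by rw [Complex.cpow_ne_zero_iff]; exact Or.inl hpi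
  rw [h3] at h
  have h5 : Complex.Gamma (-z / 2) * (Real.pi : ℂ) ^ (z / 2) * sphereArea n ≠ 0 :=
    mul_ne_zero (mul_ne_zero h2 h4) h1
  refine mul_left_cancel₀ h5 ?_
  rw [kappa]
  linear_combination h + (-2 * (Real.pi : ℂ) ^ (-z - 1 / 2) * (Real.pi : ℂ) ^ (z / 2) *
    Complex.Gamma ((z + 1) / 2) * rayMellin (-z) (hat g) (s : E n)) *
    (mul_inv_cancel₀ h2) + (-2 * (Real.pi : ℂ) ^ (-z - 1 / 2) * (Real.pi : ℂ) ^ (z / 2) *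
    Complex.Gamma ((z + 1) / 2) * rayMellin (-z) (hat g) (s : E n)) *
    (Complex.Gamma (-z / 2) * (Complex.Gamma (-z / 2))⁻¹) * (mul_inv_cancel₀ h1)

theorem meromorphic_kappa : Meromorphic (kappa n) := fun z => by
  have hpi : (Real.pi : ℂ) ≠ 0 := by exact_mod_cast Real.pi_ne_zero
  have h1 : AnalyticAt ℂ (fun z : ℂ => (Real.pi : ℂ) ^ (-z - 1 / 2)) z := by
    have : Differentiable ℂ (fun z : ℂ => (Real.pi : ℂ) ^ (-z - 1 / 2)) := fun z =>
      DifferentiableAt.const_cpow (by fun_prop) (Or.inl hpi)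
    exact this.analyticAt z
  have h2 : MeromorphicAt (fun z : ℂ => Complex.Gamma ((z + 1) / 2)) z :=
    (Meromorphic.Gamma _).comp_analyticAt (f := Complex.Gamma) (by fun_prop)
  have h3 : MeromorphicAt (fun z : ℂ => Complex.Gamma (-z / 2)) z :=
    (Meromorphic.Gamma _).comp_analyticAt (f := Complex.Gamma) (by fun_prop)
  exact (((MeromorphicAt.const _ _).mul h1.meromorphicAt).mul h2).mul h3.inv

/-- The poles of Γ((z+1)/2) are real and 1/Γ is entire. At the point -μ-n the imaginary part is -σ,
so σ ≠ 0 keeps it away from the poles. -/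
theorem analyticAt_kappa {z : ℂ} (hz : z.im ≠ 0) : AnalyticAt ℂ (kappa n) z := by
  have hpi : (Real.pi : ℂ) ≠ 0 := by exact_mod_cast Real.pi_ne_zero
  have hd : DifferentiableOn ℂ (kappa n) {z | z.im ≠ 0} := fun z hz => by
    refine DifferentiableAt.differentiableWithinAt ?_
    have h1 : DifferentiableAt ℂ (fun z : ℂ => (Real.pi : ℂ) ^ (-z - 1 / 2)) z :=
      DifferentiableAt.const_cpow (by fun_prop) (Or.inl hpi)
    have h2 : DifferentiableAt ℂ (fun z : ℂ => Complex.Gamma ((z + 1) / 2)) z := by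
      refine DifferentiableAt.fun_comp' z (Complex.differentiableAt_Gamma _ fun m hm => hz ?_)
        (by fun_prop)
      have := congrArg Complex.im hm
      simpa using this
    have h3 : DifferentiableAt ℂ (fun z : ℂ => (Complex.Gamma (-z / 2))⁻¹) z :=
      DifferentiableAt.fun_comp' (g := fun w => (Complex.Gamma w)⁻¹) z
        (Complex.differentiable_one_div_Gamma _) (by fun_prop)
    exact ((h1.const_mul _).mul h2).mul h3
  exact hd.analyticAt ((isOpen_ne_fun Complex.continuous_im continuous_const).mem_nhds hz)

theorem analyticAt_mellin_ray (g : 𝓢(E n, ℂ)) {x : E n} (hx : x ≠ 0) {ζ : ℂ}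
    (hζ : 0 < ζ.re) : AnalyticAt ℂ (mellin fun r : ℝ => g (r • x)) ζ := by
  have hd : DifferentiableOn ℂ (mellin fun r : ℝ => g (r • x)) {ζ | 0 < ζ.re} := fun ζ hζ =>
    (differentiableAt_mellin_ray g hx hζ).differentiableWithinAt
  exact hd.analyticAt ((isOpen_lt continuous_const Complex.continuous_re).mem_nhds hζ)

theorem analyticAt_cosTransform (u : PSph n) {φ : PSph n → ℂ} (hφ : Continuous φ) {z : ℂ}
    (hz : -1 < z.re) : AnalyticAt ℂ (cosTransform φ u) z := by
  have hd : DifferentiableOn ℂ (cosTransform φ u) {z | -1 < z.re} := fun z hz =>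
    (differentiableAt_cosTransform u hφ hz).differentiableWithinAt
  exact hd.analyticAt ((isOpen_lt continuous_const Complex.continuous_re).mem_nhds hz)

theorem eventually_radialMellin_ne_zero (τ : ℝ) (z : ℂ) :
    ∀ᶠ w in 𝓝[≠] z, radialMellin τ w ≠ 0 := by
  have ha : ∀ w, AnalyticAt ℂ (radialMellin τ) w := (differentiable_radialMellin τ).analyticAt
  rcases (ha z).eventually_eq_zero_or_eventually_ne_zero with h | h
  · have h0 : radialMellin τ = 0 :=
      AnalyticOnNhd.eq_of_eventuallyEq (fun w _ => ha w) (fun w _ => analyticAt_const) h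
    exact absurd (congrFun h0 (Complex.I * τ)) (radialMellin_ne_zero (by simp))
  · exact h

/-- The continuation of `w ↦ ∫ |⟨s, t⟩|^(-w-n) φ(t) dt`. -/
theorem isAValue_lift {σ : ℝ} (hn : 2 ≤ n) (hσ : σ ≠ 0) {φ : PSph n → ℂ} (hφ : Continuous φ)
    {g : 𝓢(E n, ℂ)} (hge : ∀ x, g (-x) = g x)
    (hg : ∀ (s : Sph n) (r : ℝ), 0 < r → g (r • (s : E n)) = radial (-σ) r * φ (PSph.mk s))
    {C : ℝ} (hC : ∀ x, ‖g x‖ ≤ C * Real.exp (-Real.pi * ‖x‖ ^ 2)) (s : Sph n) :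
    IsAValue (param n σ) φ (PSph.mk s)
      (kappa n (-param n σ - n) * rayMellin (param n σ + n) (hat g) (s : E n) /
        radialMellin (-σ) (-param n σ)) := by
  set F₂ : ℂ → ℂ := fun w => kappa n (-w - n) * rayMellin (w + n) (hat g) (s : E n) /
    radialMellin (-σ) (-w) with hF₂
  -- The integral is available for Re w < 1 - n and F₂ for Re w > -n. The two are glued along Re w =
  -- 1 - n, and `key` shows that they agree in the overlap, away from the zeros of the denominator.
  set F : ℂ → ℂ := fun w => if w.re < 1 - (n : ℝ) then cosTransform φ (PSph.mk s) (-w - n)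
    else F₂ w with hF
  have hn' : (2 : ℝ) ≤ n := by exact_mod_cast hn
  have key : ∀ w : ℂ, -(n : ℝ) < w.re → radialMellin (-σ) (-w) ≠ 0 → F w = F₂ w := by
    intro w hw hc
    by_cases h : w.re < 1 - (n : ℝ)
    · have h1 := radialMellin_mul_cosTransform hge hg hφ.measurable hC s (z := -w - n)
        (by simp; linarith) (by simp; linarith)
      have h2 : -w - (n : ℂ) + n = -w := by ring
      have h3 : -(-w - (n : ℂ)) = w + n := by ring
      rw [h2, h3] at h1
      simp only [hF, hF₂, if_pos h]
      rw [eq_div_iff hc, ← h1, mul_comm]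
    · simp only [hF, if_neg h]
  have hopen : ∀ w : ℂ, -(n : ℝ) < w.re → ∀ᶠ w in 𝓝 w, -(n : ℝ) < w.re := fun w hw =>
    (isOpen_lt continuous_const Complex.continuous_re).mem_nhds hw
  have hray : ∀ w : ℂ, -(n : ℝ) < w.re →
      AnalyticAt ℂ (fun w => rayMellin (w + n) (hat g) (s : E n)) w := fun w hw =>
    (analyticAt_mellin_ray (hat g) s.ne_zero (ζ := w + n) (by simp; linarith)).fun_comp
      (f := fun w : ℂ => w + n) (by fun_prop)
  have hrad : ∀ w : ℂ, AnalyticAt ℂ (fun w => radialMellin (-σ) (-w)) w := fun w =>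
    ((differentiable_radialMellin (-σ)).comp differentiable_neg).analyticAt w
  have hre : (param n σ).re = -(n : ℝ) / 2 := by simp [param]
  have him : (param n σ).im = σ := by simp [param]
  have hc0 : radialMellin (-σ) (-param n σ) ≠ 0 := radialMellin_ne_zero (by simp [him])
  have hμ : -(n : ℝ) < (param n σ).re := by rw [hre]; linarith
  -- When n = 2 the point μ lies on the gluing line itself, so agreement with F₂ is needed in a full
  -- neighbourhood, on both sides of the line.
  have hFF : F =ᶠ[𝓝 (param n σ)] F₂ := by
    filter_upwards [hopen _ hμ, (hrad (param n σ)).continuousAt.eventually_ne hc0] with w h1 h2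
    exact key w h1 h2
  refine ⟨F, fun w => ?_, ?_, hFF.eq_of_nhds, fun w hw => ?_⟩
  · by_cases h : w.re < 1 - (n : ℝ)
    · have h1 : AnalyticAt ℂ (fun w => cosTransform φ (PSph.mk s) (-w - n)) w :=
        (analyticAt_cosTransform (PSph.mk s) hφ (z := -w - n) (by simp; linarith)).fun_comp
          (f := fun w : ℂ => -w - n) (by fun_prop)
      refine (h1.congr ?_).meromorphicAt
      filter_upwards [(isOpen_lt Complex.continuous_re continuous_const).mem_nhds h] with w hw
      exact (if_pos hw).symm
    · have hw : -(n : ℝ) < w.re := by linarith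
      have h1 : MeromorphicAt F₂ w :=
        (((meromorphic_kappa _).comp_analyticAt (f := kappa n) (g := fun w : ℂ => -w - n)
          (by fun_prop)).mul (hray w hw).meromorphicAt).div (hrad w).meromorphicAt
      refine h1.congr ?_
      -- F and F₂ may disagree at a zero of the denominator. Such zeros are isolated, and meromorphy
      -- only concerns punctured neighbourhoods.
      have h2 : ∀ᶠ w in 𝓝[≠] w, radialMellin (-σ) (-w) ≠ 0 := by
        refine Tendsto.eventually (p := fun v => radialMellin (-σ) v ≠ 0) ?_ (eventually_radialMellin_ne_zero (-σ) (-w))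
        refine tendsto_nhdsWithin_of_tendsto_nhds_of_eventually_within _
          (continuous_neg.continuousAt.tendsto.mono_left nhdsWithin_le_nhds) ?_
        filter_upwards [self_mem_nhdsWithin] with v hv
        simpa using hv
      filter_upwards [h2, nhdsWithin_le_nhds (hopen w hw)] with v h3 h4
      exact (key v h4 h3).symm
  · refine AnalyticAt.congr ?_ hFF.symm
    refine ((AnalyticAt.fun_comp (g := kappa n) (f := fun w : ℂ => -w - n)
      (analyticAt_kappa ?_) (by fun_prop)).mul (hray _ hμ)).div (hrad _) hc0
    simp [him, hσ]
  · simp only [hF, if_pos hw]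
    rfl

/-- Two continuations agree near w = -n, a point of the half-plane of convergence. Their difference
has infinite order there, hence everywhere in the plane, and analyticity at μ turns agreement near μ
into agreement at μ. -/
theorem IsAValue.unique {μ : ℂ} {φ : PSph n → ℂ} {s : PSph n} {z₁ z₂ : ℂ}
    (h₁ : IsAValue μ φ s z₁) (h₂ : IsAValue μ φ s z₂) : z₁ = z₂ := by
  obtain ⟨F₁, hm₁, ha₁, rfl, he₁⟩ := h₁
  obtain ⟨F₂, hm₂, ha₂, rfl, he₂⟩ := h₂
  have hD : Meromorphic (F₁ - F₂) := hm₁.sub hm₂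
  have h1 : meromorphicOrderAt (F₁ - F₂) (-(n : ℂ)) = ⊤ := by
    rw [meromorphicOrderAt_eq_top_iff]
    refine nhdsWithin_le_nhds ?_
    have : (-(n : ℂ)).re < 1 - (n : ℝ) := by simp
    filter_upwards [(isOpen_lt Complex.continuous_re continuous_const).mem_nhds this] with w hw
    rw [Pi.sub_apply, he₁ w hw, he₂ w hw, sub_self]
  have h2 : meromorphicOrderAt (F₁ - F₂) μ = ⊤ := by
    by_contra hc
    exact hD.exists_meromorphicOrderAt_ne_top_iff_forall.1 ⟨μ, hc⟩ _ h1
  rw [meromorphicOrderAt_eq_top_iff] at h2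
  have h3 : ∀ᶠ w in 𝓝[≠] μ, F₁ w = F₂ w := h2.mono fun w hw => sub_eq_zero.1 hw
  exact ((ha₁.frequently_eq_iff_eventually_eq ha₂).1 h3.frequently).self_of_nhds

end Continuation

/-! ### The intertwining operator -/

section Intertwiner

open scoped FourierTransform SchwartzMap Topology

variable {n : ℕ}

/-- Even Schwartz functions. -/
def evenS (n : ℕ) : Submodule ℂ 𝓢(E n, ℂ) where
  carrier := {g | ∀ x, g (-x) = g x}
  add_mem' := fun ha hb x => by rw [add_apply, add_apply, ha x, hb x]
  zero_mem' := fun _ => rfl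
  smul_mem' := fun c a ha x => by rw [smul_apply, smul_apply, ha x]

/-- `∫₀^∞ r^(ζ-1) g(r s) dr` as a function of the class of `s` in `S̃`. -/
noncomputable def pMellin (ζ : ℂ) (g : evenS n) (u : PSph n) : ℂ :=
  Quotient.lift (fun s : Sph n => rayMellin ζ (g : 𝓢(E n, ℂ)) (s : E n)) (by
    rintro s t (rfl | rfl)
    · rfl
    · simp only [rayMellin]
      congr 1
      funext r
      change (g : 𝓢(E n, ℂ)) (r • -(t : E n)) = _
      rw [smul_neg, g.2]) u

theorem pMellin_mk (ζ : ℂ) (g : evenS n) (s : Sph n) :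
    pMellin ζ g (PSph.mk s) = rayMellin ζ (g : 𝓢(E n, ℂ)) (s : E n) := rfl

theorem measurable_pMellin (ζ : ℂ) (g : evenS n) : Measurable (pMellin ζ g) :=
  measurable_from_quotient.2
    ((measurable_rayMellin (g : 𝓢(E n, ℂ)).continuous ζ).measurable.comp measurable_subtype_coe)

variable [NeZero n]

theorem memLp_pMellin {ζ : ℂ} (hζ : 0 < ζ.re) (g : evenS n) : MemLp (pMellin ζ g) 2 (nu n) := by
  obtain ⟨K, hK⟩ := exists_bound_rayMellin (g : 𝓢(E n, ℂ)) hζ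
  refine MemLp.of_bound (measurable_pMellin ζ g).aestronglyMeasurable K
    (Eventually.of_forall fun u => ?_)
  obtain ⟨s, rfl⟩ := PSph.mk_surjective u
  exact hK s

/-- `g ↦ ∫₀^∞ r^(ζ-1) g(r ·) dr` as a linear map to `L²(S̃)`. -/
noncomputable def rayL (ζ : ℂ) (hζ : 0 < ζ.re) : evenS n →ₗ[ℂ] L2S n where
  toFun g := (memLp_pMellin hζ g).toLp _
  map_add' a b := by
    rw [← MemLp.toLp_add]
    refine MemLp.toLp_congr _ _ (Eventually.of_forall fun u => ?_)
    obtain ⟨s, rfl⟩ := PSph.mk_surjective u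
    rw [Pi.add_apply, pMellin_mk, pMellin_mk, pMellin_mk]
    exact (hasMellin_add (mellinConvergent_ray (a : 𝓢(E n, ℂ)) s.ne_zero hζ)
      (mellinConvergent_ray (b : 𝓢(E n, ℂ)) s.ne_zero hζ)).2
  map_smul' c a := by
    rw [RingHom.id_apply, ← MemLp.toLp_const_smul]
    refine MemLp.toLp_congr _ _ (Eventually.of_forall fun u => ?_)
    obtain ⟨s, rfl⟩ := PSph.mk_surjective u
    rw [Pi.smul_apply, pMellin_mk, pMellin_mk]
    exact mellin_const_smul (fun r : ℝ => (a : 𝓢(E n, ℂ)) (r • (s : E n))) ζ c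

theorem rayL_apply {ζ : ℂ} (hζ : 0 < ζ.re) (g : evenS n) :
    rayL ζ hζ g = (memLp_pMellin hζ g).toLp _ := rfl

theorem norm_sq_rayL {ζ : ℂ} (hζ : 0 < ζ.re) (g : evenS n) :
    ‖rayL ζ hζ g‖ ^ 2 = ∫ s, ‖rayMellin ζ (g : 𝓢(E n, ℂ)) (s : E n)‖ ^ 2 ∂(surf n) := by
  rw [norm_sq_eq_integral, rayL_apply,
    integral_congr_ae (g := fun u => ‖pMellin ζ g u‖ ^ 2) (by
      filter_upwards [(memLp_pMellin hζ g).coeFn_toLp] with u hu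
      rw [hu]), nu, integral_map PSph.measurable_mk.aemeasurable
      ((measurable_pMellin ζ g).norm.pow_const 2).aestronglyMeasurable]
  rfl

/-- The Fourier transform of even Schwartz functions. -/
noncomputable def hatE : evenS n ≃ₗ[ℂ] evenS n :=
  LinearEquiv.ofInvolutive
    ({ toFun := fun g => ⟨hat (g : 𝓢(E n, ℂ)), hat_even g.2⟩
       map_add' := fun a b => Subtype.ext (FourierTransform.fourier_add _ _)
       map_smul' := fun c a => Subtype.ext (FourierTransform.fourier_smul _ _) } :
      evenS n →ₗ[ℂ] evenS n) (fun g => by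
    apply Subtype.ext
    have h : hat (g : 𝓢(E n, ℂ)) = 𝓕⁻ (g : 𝓢(E n, ℂ)) := by
      ext x
      rw [SchwartzMap.fourierInv_coe, Real.fourierInv_eq_fourier_neg, ← SchwartzMap.fourier_coe,
        ← hat, hat_even g.2]
    change hat (hat (g : 𝓢(E n, ℂ))) = g
    rw [h, hat, FourierTransform.fourier_fourierInv_eq])

theorem hatE_coe (g : evenS n) : (hatE g : 𝓢(E n, ℂ)) = hat (g : 𝓢(E n, ℂ)) := rfl

theorem norm_rayL_hatE {ζ : ℂ} (hζ : ζ.re = (n : ℝ) / 2) (h1 : 0 < ζ.re)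
    (h2 : 0 < ((n : ℂ) - ζ).re) (g : evenS n) :
    ‖rayL ζ h1 (hatE g)‖ = ‖rayL (n - ζ) h2 g‖ := by
  rw [← sq_eq_sq₀ (norm_nonneg _) (norm_nonneg _), norm_sq_rayL, norm_sq_rayL, hatE_coe,
    integral_norm_sq_rayMellin_fourier _ hζ]

/-- The lift is made with radial phase τ = Im ζ, for which the radial Mellin transform at ζ does not
vanish and can be divided out. Density of the ray transforms follows. -/
theorem exists_rayL_eq {ζ : ℂ} (hζ : 0 < ζ.re) {φ : PSph n → ℂ} (hφ : IsSmooth φ)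
    (hm : MemLp φ 2 (nu n)) : ∃ g : evenS n, rayL ζ hζ g = hm.toLp φ := by
  obtain ⟨g, hge, hg, -⟩ := exists_lift ζ.im hφ
  refine ⟨(radialMellin ζ.im ζ)⁻¹ • ⟨g, hge⟩, ?_⟩
  rw [map_smul, inv_smul_eq_iff₀ (radialMellin_ne_zero rfl), rayL_apply, ← MemLp.toLp_const_smul]
  refine MemLp.toLp_congr _ _ (Eventually.of_forall fun u => ?_)
  obtain ⟨s, rfl⟩ := PSph.mk_surjective u
  rw [pMellin_mk]
  exact rayMellin_lift (hg s) ζ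

theorem denseRange_rayL {ζ : ℂ} (hζ : 0 < ζ.re) : DenseRange (rayL (n := n) ζ hζ) := by
  refine dense_smooth.mono ?_
  rintro _ ⟨φ, hm, hφ, rfl⟩
  exact exists_rayL_eq hζ hφ hm

theorem re_pos_of_eq {ζ : ℂ} (hζ : ζ.re = (n : ℝ) / 2) : 0 < ζ.re := by
  have : (0 : ℝ) < n := Nat.cast_pos.2 (NeZero.pos n)
  rw [hζ]; positivity

theorem re_sub_eq {ζ : ℂ} (hζ : ζ.re = (n : ℝ) / 2) : ((n : ℂ) - ζ).re = (n : ℝ) / 2 := by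
  rw [Complex.sub_re, Complex.natCast_re, hζ]; ring

/-- The unitary operator induced by the Fourier transform on the Mellin transforms along rays. -/
noncomputable def fourierU (ζ : ℂ) (hζ : ζ.re = (n : ℝ) / 2) : L2S n ≃ₗᵢ[ℂ] L2S n :=
  (hatE (n := n)).extendOfIsometry (rayL (n - ζ) (re_pos_of_eq (re_sub_eq hζ)))
    (rayL ζ (re_pos_of_eq hζ)) (denseRange_rayL _) (denseRange_rayL _) (norm_rayL_hatE hζ _ _)

theorem fourierU_rayL {ζ : ℂ} (hζ : ζ.re = (n : ℝ) / 2) (h2 : 0 < ((n : ℂ) - ζ).re)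
    (g : evenS n) : fourierU ζ hζ (rayL (n - ζ) h2 g) = rayL ζ (re_pos_of_eq hζ) (hatE g) :=
  LinearEquiv.extendOfIsometry_eq _ _ _ _ _ _ g

/-! #### Intertwining property -/

/-- `linAct g` as a continuous linear equivalence. -/
noncomputable def linActEquiv (g : G n) : E n ≃L[ℝ] E n :=
  LinearEquiv.toContinuousLinearEquiv
    { toFun := linAct g
      map_add' := fun x y => by simp [linAct, Matrix.mulVec_add]
      map_smul' := fun c x => linAct_smul g c x
      invFun := linAct g⁻¹
      left_inv := fun x => by rw [← linAct_mul, inv_mul_cancel, linAct_one]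
      right_inv := fun x => by rw [← linAct_mul, mul_inv_cancel, linAct_one] }

/-- `g ↦ g ∘ x⁻¹` on even Schwartz functions. -/
noncomputable def translateE (x : G n) (g : evenS n) : evenS n :=
  ⟨SchwartzMap.compCLMOfContinuousLinearEquiv ℂ (linActEquiv x⁻¹) (g : 𝓢(E n, ℂ)), fun y => by
    rw [SchwartzMap.compCLMOfContinuousLinearEquiv_apply, Function.comp_apply, Function.comp_apply,
      map_neg, g.2]⟩

theorem translateE_apply (x : G n) (g : evenS n) (y : E n) :
    (translateE x g : 𝓢(E n, ℂ)) y = (g : 𝓢(E n, ℂ)) (linAct x⁻¹ y) := rfl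

/-- The substitution y ↦ x(y) has Jacobian 1, and the inverse of the transpose of x, which it puts
on the dual variable, is θ(x). -/
theorem hatE_translateE (x : G n) (g : evenS n) :
    hatE (translateE x g) = translateE (theta x) (hatE g) := by
  apply Subtype.ext
  ext ξ
  rw [translateE_apply, hatE_coe, hatE_coe, hat, hat, SchwartzMap.fourier_coe,
    SchwartzMap.fourier_coe, Real.fourier_eq, Real.fourier_eq,
    ← (measurePreserving_linAct x).integral_comp
      (linActEquiv x).toHomeomorph.measurableEmbedding]
  refine integral_congr_ae (Eventually.of_forall fun y => ?_)
  simp only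
  have h : inner ℝ (linAct x y) ξ = inner ℝ y (linAct (theta x)⁻¹ ξ) := by
    rw [← inner_linAct_theta x y (linAct (theta x)⁻¹ ξ), ← linAct_mul, mul_inv_cancel, linAct_one]
  rw [h, translateE_apply, ← linAct_mul, inv_mul_cancel, linAct_one]

theorem linAct_coe_eq (g : G n) (s : Sph n) :
    linAct g (s : E n) = ‖linAct g (s : E n)‖ • (sphAct g s : E n) := by
  have h : ‖linAct g (s : E n)‖ ≠ 0 := norm_ne_zero_iff.2 (linAct_ne_zero g s.ne_zero)
  simp only [sphAct]
  rw [smul_smul, mul_inv_cancel₀ h, one_smul]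

/-- Writing x⁻¹(s) as ‖x⁻¹(s)‖ times a point of the sphere, homogeneity of degree -ζ brings out the
multiplier ‖x⁻¹(s)‖^(-ζ), which is that of π_μ for μ = -ζ. -/
theorem rayL_translateE {ζ : ℂ} (hζ : 0 < ζ.re) {μ : ℂ} (hμ : μ.re = -(n : ℝ) / 2) (h : μ = -ζ)
    (x : G n) (g : evenS n) : rayL ζ hζ (translateE x g) = rep μ hμ x (rayL ζ hζ g) := by
  subst h
  refine Lp.ext ?_
  rw [rep_apply, rayL_apply, rayL_apply]
  refine (MemLp.coeFn_toLp (memLp_pMellin hζ (translateE x g))).trans (EventuallyEq.symm ?_)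
  refine ((isWeighted_act x⁻¹ hμ).toLpIsometry_toLp (memLp_pMellin hζ g)).trans
    (Eventually.of_forall fun u => ?_)
  obtain ⟨s, rfl⟩ := PSph.mk_surjective u
  simp only
  rw [act_mk, pMellin_mk, pMellin_mk, stretch_mk,
    ← rayMellin_smul ζ _ (norm_pos_iff.2 (linAct_ne_zero x⁻¹ s.ne_zero)), ← linAct_coe_eq]
  simp only [rayMellin, translateE_apply, linAct_smul]

/-- It suffices to check ray transforms, which are dense. There translation by x becomes translation
by θ(x) under the Fourier transform, while the degree passes from ζ - n to -ζ. -/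
theorem fourierU_rep {ζ : ℂ} (hζ : ζ.re = (n : ℝ) / 2) {μ μ' : ℂ} (hμ : μ.re = -(n : ℝ) / 2)
    (hμ' : μ'.re = -(n : ℝ) / 2) (h : μ = ζ - n) (h' : μ' = -ζ) (x : G n) (φ : L2S n) :
    fourierU ζ hζ (rep μ hμ x φ) = rep μ' hμ' (theta x) (fourierU ζ hζ φ) := by
  have h2 : 0 < ((n : ℂ) - ζ).re := re_pos_of_eq (re_sub_eq hζ)
  refine (denseRange_rayL h2).induction_on (p := fun φ => fourierU ζ hζ (rep μ hμ x φ) =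
    rep μ' hμ' (theta x) (fourierU ζ hζ φ)) φ ?_ fun g => ?_
  · exact isClosed_eq (by fun_prop) (by fun_prop)
  · rw [← rayL_translateE h2 hμ (by rw [h]; ring), fourierU_rayL, fourierU_rayL,
      hatE_translateE, rayL_translateE _ hμ' h']

/-! #### The normalizing factor -/

theorem sphereArea_eq : sphereArea n = 2 * Real.pi ^ ((n : ℝ) / 2) / Real.Gamma (n / 2) := by
  have hn : (0 : ℝ) < n := Nat.cast_pos.2 (NeZero.pos n)
  have hG := Real.Gamma_pos_of_pos (half_pos hn)
  rw [sphereArea, Measure.toSphere_real_apply_univ, Measure.real, EuclideanSpace.volume_ball,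
    finrank_euclideanSpace, Fintype.card_fin, ENNReal.ofReal_one, one_pow, one_mul,
    Real.Gamma_add_one (by positivity), ENNReal.toReal_ofReal (by positivity),
    Real.sqrt_eq_rpow, ← Real.rpow_natCast, ← Real.rpow_mul Real.pi_pos.le]
  have h : (1 / 2 : ℝ) * n = n / 2 := by ring
  rw [h]
  field_simp

theorem param_re (σ : ℝ) : (param n σ).re = -(n : ℝ) / 2 := by simp [param]

theorem param_im (σ : ℝ) : (param n σ).im = σ := by simp [param]

/-- With a and b as in the proof, d(σ) contains Γ(b)/Γ(a) and κ contains Γ(ā)/Γ(b), whose product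
has modulus 1. The remaining powers of π and Γ(n/2) cancel against the area of the sphere. -/
theorem norm_dconst_mul_kappa {σ : ℝ} (hσ : σ ≠ 0) :
    ‖dconst n σ * kappa n (-param n σ - n)‖ = 1 := by
  have hn : (0 : ℝ) < n := Nat.cast_pos.2 (NeZero.pos n)
  have hG := Real.Gamma_pos_of_pos (half_pos hn)
  set a : ℂ := (-(n : ℂ) / 2 + Complex.I * σ + 1) / 2 with ha
  set b : ℂ := ((n : ℂ) / 2 + Complex.I * σ) / 2 with hb
  have h1 : (-param n σ - n + 1) / 2 = conj a := by
    simp only [ha, param, map_div₀, map_add, map_neg, map_mul, Complex.conj_I, Complex.conj_ofReal,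
      map_one, Complex.conj_natCast, Complex.conj_ofNat]
    ring
  have h2 : -(-param n σ - n) / 2 = b := by
    simp only [hb, param]
    ring
  have ha0 : Complex.Gamma a ≠ 0 := Complex.Gamma_ne_zero fun m hm => hσ (by
    have := congrArg Complex.im hm
    simpa [ha] using this)
  have hb0 : Complex.Gamma b ≠ 0 := Complex.Gamma_ne_zero_of_re_pos (by
    simpa [hb] using hn)
  have h3 : ‖(Real.pi : ℂ) ^ (-(-param n σ - n) - 1 / 2)‖ = Real.pi ^ ((n : ℝ) / 2 - 1 / 2) := by
    rw [Complex.norm_cpow_eq_rpow_re_of_pos Real.pi_pos]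
    congr 1
    simp [param]
    ring
  have h4 : Complex.Gamma ((n : ℂ) / 2) = (Real.Gamma ((n : ℝ) / 2) : ℂ) := by
    rw [← Complex.Gamma_ofReal]
    push_cast
    rfl
  rw [dconst, kappa, h1, h2, ← ha, ← hb, h4, Complex.Gamma_conj]
  simp only [norm_mul, norm_div, norm_inv, h3, RCLike.norm_conj, Complex.norm_real]
  have ha1 := norm_ne_zero_iff.2 ha0
  have hb1 := norm_ne_zero_iff.2 hb0
  have hA := sphereArea_pos (n := n)
  rw [Real.norm_of_nonneg hG.le, Real.norm_of_nonneg hA.le, Real.norm_of_nonneg (Real.sqrt_nonneg _),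
    sphereArea_eq, Real.rpow_sub Real.pi_pos, Real.sqrt_eq_rpow]
  have hp := Real.rpow_pos_of_pos Real.pi_pos (1 / 2)
  have hp' := Real.rpow_pos_of_pos Real.pi_pos ((n : ℝ) / 2)
  rw [Complex.norm_ofNat]
  field_simp

/-- The multiplication by a complex number of modulus one. -/
noncomputable def unitSMul {V : Type*} [NormedAddCommGroup V] [NormedSpace ℂ V] (ρ : ℂ)
    (hρ : ‖ρ‖ = 1) : V ≃ₗᵢ[ℂ] V :=
  { LinearEquiv.smulOfNeZero ℂ V ρ (norm_ne_zero_iff.1 (by rw [hρ]; exact one_ne_zero)) with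
    norm_map' := fun v => by
      change ‖ρ • v‖ = ‖v‖
      rw [norm_smul, hρ, one_mul] }

theorem param_add_re (σ : ℝ) : (param n σ + n).re = (n : ℝ) / 2 := by
  simp [param]; ring

/-- The unitary operator `U_σ`. -/
noncomputable def intertwiner (n : ℕ) [NeZero n] {σ : ℝ} (hσ : σ ≠ 0) : L2S n ≃ₗᵢ[ℂ] L2S n :=
  (fourierU (param n σ + n) (param_add_re σ)).trans (unitSMul _ (norm_dconst_mul_kappa (n := n) hσ))

theorem intertwiner_apply {σ : ℝ} (hσ : σ ≠ 0) (φ : L2S n) :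
    intertwiner n hσ φ = (dconst n σ * kappa n (-param n σ - n)) •
      fourierU (param n σ + n) (param_add_re σ) φ := rfl

theorem isIntertwiner_intertwiner (hn : 2 ≤ n) {σ : ℝ} (hσ : σ ≠ 0) :
    IsIntertwiner n σ (intertwiner n hσ : L2S n →L[ℂ] L2S n) := by
  intro φ hφ
  -- The ray transform is taken at -μ, whose imaginary part is -σ. This choice of phase makes the
  -- radial constant nonzero.
  obtain ⟨g, hge, hg, C, hC⟩ := exists_lift (-σ) hφ
  have hm := memLp_of_continuous hφ.continuous
  have hc : radialMellin (-σ) (-param n σ) ≠ 0 := radialMellin_ne_zero (by simp [param_im])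
  set gE : evenS n := ⟨g, hge⟩ with hgE
  have h2 : (n : ℂ) - (param n σ + n) = -param n σ := by ring
  have hpos : 0 < ((n : ℂ) - (param n σ + n)).re := re_pos_of_eq (re_sub_eq (param_add_re σ))
  have h3 : hm.toLp φ = (radialMellin (-σ) (-param n σ))⁻¹ •
      rayL ((n : ℂ) - (param n σ + n)) hpos gE := by
    rw [eq_comm, inv_smul_eq_iff₀ hc, rayL_apply, ← MemLp.toLp_const_smul]
    refine MemLp.toLp_congr _ _ (Eventually.of_forall fun u => ?_)
    obtain ⟨s, rfl⟩ := PSph.mk_surjective u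
    rw [pMellin_mk, h2]
    exact rayMellin_lift (hg s) _
  refine ⟨hm, fun u => kappa n (-param n σ - n) * pMellin (param n σ + n) (hatE gE) u /
    radialMellin (-σ) (-param n σ), fun u => ?_, ?_⟩
  · obtain ⟨s, rfl⟩ := PSph.mk_surjective u
    exact isAValue_lift hn hσ hφ.continuous hge hg hC s
  · change intertwiner n hσ (hm.toLp φ) =ᵐ[nu n] _
    rw [intertwiner_apply, h3, map_smul, fourierU_rayL, smul_smul]
    refine (Lp.coeFn_smul _ _).trans ?_
    filter_upwards [(memLp_pMellin (re_pos_of_eq (param_add_re (n := n) σ)) (hatE gE)).coeFn_toLp] with u hu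
    rw [Pi.smul_apply, rayL_apply, hu, smul_eq_mul]
    ring

theorem IsIntertwiner.unique {σ : ℝ} {U₁ U₂ : L2S n →L[ℂ] L2S n} (h₁ : IsIntertwiner n σ U₁)
    (h₂ : IsIntertwiner n σ U₂) : U₁ = U₂ := by
  refine ContinuousLinearMap.coeFn_injective (Continuous.ext_on (dense_smooth (n := n)) U₁.continuous
    U₂.continuous ?_)
  rintro _ ⟨φ, hm, hφ, rfl⟩
  obtain ⟨hm₁, A₁, hA₁, he₁⟩ := h₁ φ hφ
  obtain ⟨hm₂, A₂, hA₂, he₂⟩ := h₂ φ hφ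
  have hA : A₁ = A₂ := funext fun s => (hA₁ s).unique (hA₂ s)
  subst hA
  exact Lp.ext (he₁.trans he₂.symm)

theorem conj_param (σ : ℝ) : conj (param n σ) = -(param n σ + n) := by
  simp only [param, map_add, map_div₀, map_neg, map_mul, Complex.conj_I, Complex.conj_ofReal,
    Complex.conj_natCast, Complex.conj_ofNat]
  ring

theorem conj_param_re (σ : ℝ) : (conj (param n σ)).re = -(n : ℝ) / 2 := by
  rw [Complex.conj_re, param_re]

theorem intertwiner_rep {σ : ℝ} (hσ : σ ≠ 0) (x : G n) (φ : L2S n) :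
    intertwiner n hσ (rep (param n σ) (param_re σ) x φ) =
      rep (conj (param n σ)) (conj_param_re σ) (theta x) (intertwiner n hσ φ) := by
  rw [intertwiner_apply, intertwiner_apply, map_smul]
  congr 1
  exact fourierU_rep (n := n) (param_add_re σ) _ _ (by ring) (conj_param (n := n) σ) x φ

end Intertwiner

/-! ### The orbit `X` in `S̃ × S̃` -/

section Orbit

variable {n : ℕ} [NeZero n]

theorem act_mk_eq {g : G n} {s t : Sph n} {c : ℝ} (hc : c ≠ 0)
    (h : linAct g (s : E n) = c • (t : E n)) : act g (PSph.mk s) = PSph.mk t := by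
  rw [act_mk, PSph.mk_eq_mk]
  have ht : ‖(t : E n)‖ = 1 := norm_eq_of_mem_sphere _
  rcases lt_or_gt_of_ne hc with hlt | hgt
  · right
    apply Subtype.ext
    simp only [sphAct, h, norm_smul, ht, mul_one, smul_smul, Real.norm_eq_abs, abs_of_neg hlt]
    rw [inv_neg, neg_mul, inv_mul_cancel₀ hc, neg_one_smul]
    rfl
  · left
    apply Subtype.ext
    simp only [sphAct, h, norm_smul, ht, mul_one, smul_smul, Real.norm_eq_abs, abs_of_pos hgt]
    rw [inv_mul_cancel₀ hc, one_smul]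

theorem linAct_e1_apply (g : G n) (j : Fin n) : linAct g (e1 n : E n) j = g.1 j 0 := by
  simp [linAct, e1]

theorem apply_zero_of_act_e1 {g : G n} (h : act g (PSph.mk (e1 n)) = PSph.mk (e1 n)) {j : Fin n}
    (hj : j ≠ 0) : g.1 j 0 = 0 := by
  rw [← linAct_e1_apply, linAct_coe_eq]
  have he : (e1 n : E n) j = 0 := by simp [e1, hj]
  rw [act_mk, PSph.mk_eq_mk] at h
  rcases h with h | h
  · rw [h, PiLp.smul_apply, he, smul_zero]
  · rw [h]
    change ‖_‖ • -((e1 n : E n) j) = 0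
    rw [he, neg_zero, smul_zero]

/-- `SL(n, ℝ)` contains a matrix with first column proportional to a given one. -/
theorem exists_act_e1 (u : PSph n) : ∃ g : G n, act g (PSph.mk (e1 n)) = u := by
  obtain ⟨s, rfl⟩ := PSph.mk_surjective u
  obtain ⟨L, hL⟩ := exists_isometry_e1 s
  let M : Matrix (Fin n) (Fin n) ℝ := Matrix.toEuclideanLin.symm (L.toLinearEquiv : E n →ₗ[ℝ] E n)
  have hM : ∀ x : E n, WithLp.toLp 2 (M.mulVec x.ofLp) = L x := fun x => by
    have := congrArg (fun A : E n →ₗ[ℝ] E n => A x)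
      (Matrix.toEuclideanLin.apply_symm_apply (L.toLinearEquiv : E n →ₗ[ℝ] E n))
    exact this
  have hdet : M.det ≠ 0 := by
    intro h0
    obtain ⟨v, hv, hv0⟩ := Matrix.exists_mulVec_eq_zero_iff.2 h0
    have h1 := hM (WithLp.toLp 2 v)
    rw [hv0] at h1
    have h2 : WithLp.toLp 2 v = (0 : E n) := L.injective (by rw [← h1, map_zero]; rfl)
    exact hv (congrArg WithLp.ofLp h2)
  -- Rescaling the first column corrects the determinant without changing the line that the column
  -- spans.
  let D : Matrix (Fin n) (Fin n) ℝ := Matrix.diagonal (Function.update 1 0 M.det⁻¹)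
  have hD : D.det = M.det⁻¹ := by
    rw [Matrix.det_diagonal, Finset.prod_update_of_mem (Finset.mem_univ _)]
    simp
  refine ⟨⟨M * D, by rw [Matrix.det_mul, hD, mul_inv_cancel₀ hdet]⟩,
    act_mk_eq (inv_ne_zero hdet) ?_⟩
  have h3 : D.mulVec (e1 n : E n).ofLp = M.det⁻¹ • (e1 n : E n).ofLp := by
    funext i
    rw [Matrix.mulVec_diagonal]
    by_cases hi : i = 0
    · subst hi; simp [e1]
    · simp [e1, hi]
  simp only [linAct]
  rw [← Matrix.mulVec_mulVec, h3, Matrix.mulVec_smul, ← hL, ← hM]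
  rfl

/-- The stabilizer of the second component acts transitively on the orbit. -/
theorem exists_act_of_absInner_ne_zero {u : PSph n} (hu : absInner u (PSph.mk (e1 n)) ≠ 0) :
    ∃ g : G n, act g (PSph.mk (e1 n)) = u ∧ act (theta g) (PSph.mk (e1 n)) = PSph.mk (e1 n) := by
  obtain ⟨s, rfl⟩ := PSph.mk_surjective u
  have hs : (s : E n) 0 ≠ 0 := by
    rw [absInner_mk, real_inner_comm, inner_e1] at hu
    exact abs_ne_zero.1 hu
  -- M is unipotent lower triangular with first column s/s₀ and first row e₁. The first row of M is
  -- the first column of θ(g)⁻¹ = ᵗM, so θ(g) fixes the class of e₁.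
  obtain ⟨M, hM0, hM1⟩ : ∃ M : Matrix (Fin n) (Fin n) ℝ, (∀ i, M i 0 = (s : E n) i / (s : E n) 0) ∧
      ∀ i j, j ≠ 0 → M i j = (1 : Matrix (Fin n) (Fin n) ℝ) i j :=
    ⟨Matrix.updateCol 1 0 fun i => (s : E n) i / (s : E n) 0, fun i => Matrix.updateCol_self,
      fun i j hj => Matrix.updateCol_ne hj⟩
  have hdet : M.det = 1 := by
    have h1 : M.BlockTriangular (fun i : Fin n => OrderDual.toDual i) := fun i j hij => by
      have hij : i < j := hij
      have hj : j ≠ 0 := fun h => by rw [h] at hij; exact absurd hij (not_lt.2 (Fin.zero_le i))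
      rw [hM1 i j hj, Matrix.one_apply_ne hij.ne]
    rw [Matrix.det_of_isLowerTriangular M h1]
    refine Finset.prod_eq_one fun i _ => ?_
    by_cases hi : i = 0
    · subst hi; rw [hM0, div_self hs]
    · rw [hM1 _ _ hi, Matrix.one_apply_eq]
  let g : G n := ⟨M, hdet⟩
  refine ⟨g, act_mk_eq (inv_ne_zero hs) ?_, ?_⟩
  · ext i
    rw [linAct_e1_apply, PiLp.smul_apply, smul_eq_mul]
    change M i 0 = _
    rw [hM0, div_eq_inv_mul]
  · have h2 : act (theta g)⁻¹ (PSph.mk (e1 n)) = PSph.mk (e1 n) := by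
      rw [← theta_inv]
      refine act_mk_eq one_ne_zero ?_
      ext i
      rw [linAct_e1_apply, one_smul]
      have h3 : (theta g⁻¹).1 i 0 = M 0 i := by
        simp only [theta, inv_inv]
        rfl
      rw [h3]
      by_cases hi : i = 0
      · subst hi
        rw [hM0, div_self hs]; simp [e1]
      · rw [hM1 _ _ hi, Matrix.one_apply_ne (Ne.symm hi)]; simp [e1, hi]
    calc _ = act (theta g) (act (theta g)⁻¹ (PSph.mk (e1 n))) := by rw [h2]
      _ = _ := by rw [← act_mul, mul_inv_cancel, act_one]

/-- The projection `G → X`. -/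
def X.mk (g : G n) : X n := (g : G n ⧸ H n)

theorem X.mk_surjective : Function.Surjective (X.mk : G n → X n) := Quotient.mk_surjective

theorem orbitMap_mk (g : G n) : orbitMap n (X.mk g) =
    (act g (PSph.mk (e1 n)), act (theta g) (PSph.mk (e1 n))) := rfl

/-- The action of `G` on `S̃ × S̃`. -/
noncomputable def actProd (x : G n) : PSph n × PSph n → PSph n × PSph n :=
  Prod.map (act x) (act (theta x))

theorem orbitMap_smul (x : G n) (p : X n) : orbitMap n (x • p) = actProd x (orbitMap n p) := by
  obtain ⟨g, rfl⟩ := X.mk_surjective p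
  have : x • X.mk g = X.mk (x * g) := rfl
  rw [this, orbitMap_mk, orbitMap_mk, actProd, Prod.map_apply, act_mul, theta_mul, act_mul]

theorem absInner_orbitMap (p : X n) : absInner (orbitMap n p).1 (orbitMap n p).2 ≠ 0 := by
  obtain ⟨g, rfl⟩ := X.mk_surjective p
  have h := absInner_act_theta g (PSph.mk (e1 n)) (PSph.mk (e1 n))
  have h1 : absInner (PSph.mk (e1 n)) (PSph.mk (e1 n)) = 1 := by
    rw [absInner_mk, real_inner_self_eq_norm_sq, norm_eq_of_mem_sphere]; simp
  rw [h1] at h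
  rw [orbitMap_mk]
  exact left_ne_zero_of_mul (by rw [h]; exact one_ne_zero)

/-- Fixing the class of e₁ under g kills the first column off the diagonal, and fixing it under
θ(g⁻¹) kills the first row. The stabilizer of the base point is therefore H. -/
theorem orbitMap_injective : Function.Injective (orbitMap n) := by
  intro p q h
  obtain ⟨a, rfl⟩ := X.mk_surjective p
  obtain ⟨b, rfl⟩ := X.mk_surjective q
  rw [orbitMap_mk, orbitMap_mk, Prod.mk.injEq] at h
  refine QuotientGroup.eq.2 fun j hj => ?_
  have h1 : act (a⁻¹ * b) (PSph.mk (e1 n)) = PSph.mk (e1 n) := by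
    rw [act_mul, ← h.1, ← act_mul, inv_mul_cancel, act_one]
  have h2 : act (theta (a⁻¹ * b)⁻¹) (PSph.mk (e1 n)) = PSph.mk (e1 n) := by
    rw [mul_inv_rev, inv_inv, theta_mul, act_mul, h.2, ← act_mul, ← theta_mul, inv_mul_cancel,
      theta_one, act_one]
  refine ⟨?_, apply_zero_of_act_e1 h1 hj⟩
  have h3 := apply_zero_of_act_e1 h2 hj
  simp only [theta, inv_inv] at h3
  exact h3

/-- The second component is first moved to e₁ by an element of the form θ(k). Then
`exists_act_of_absInner_ne_zero` moves the first component while fixing the second. -/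
theorem range_orbitMap : Set.range (orbitMap n) = {p | absInner p.1 p.2 ≠ 0} := by
  refine Set.Subset.antisymm (Set.range_subset_iff.2 absInner_orbitMap) ?_
  rintro ⟨u, v⟩ h
  obtain ⟨k, rfl⟩ := exists_act_e1 v
  set g : G n := theta k with hg
  have hgk : theta g = k := theta_theta k
  have h1 := absInner_act_theta g (act g⁻¹ u) (PSph.mk (e1 n))
  rw [← act_mul, mul_inv_cancel, act_one, hgk] at h1
  have h2 : absInner (act g⁻¹ u) (PSph.mk (e1 n)) ≠ 0 := by
    rw [← h1]
    exact mul_ne_zero h (mul_pos (stretch_pos _ _) (stretch_pos _ _)).ne'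
  obtain ⟨x, hx1, hx2⟩ := exists_act_of_absInner_ne_zero h2
  refine ⟨X.mk (g * x), ?_⟩
  rw [orbitMap_mk, theta_mul, act_mul, act_mul, hx1, hx2, ← act_mul, mul_inv_cancel, act_one, hgk]

instance : BorelSpace (X n) := ⟨rfl⟩

theorem continuous_act_left (u : PSph n) : Continuous fun g : G n => act g u := by
  obtain ⟨s, rfl⟩ := PSph.mk_surjective u
  have h1 : Continuous fun g : G n => linAct g (s : E n) :=
    (PiLp.continuous_toLp 2 _).comp (Continuous.matrix_mulVec continuous_subtype_val continuous_const)
  refine PSph.continuous_mk.comp (Continuous.subtype_mk ?_ _)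
  exact (h1.norm.inv₀ fun g => norm_ne_zero_iff.2 (linAct_ne_zero g s.ne_zero)).smul h1

theorem continuous_theta : Continuous (theta : G n → G n) := by
  refine Continuous.subtype_mk ?_ _
  have h : Continuous fun g : G n => (g⁻¹ : G n).1 := continuous_subtype_val.comp continuous_inv
  exact h.matrix_transpose

theorem X.continuous_mk : Continuous (X.mk : G n → X n) := continuous_quotient_mk'

theorem continuous_orbitMap : Continuous (orbitMap n) := by
  refine continuous_quot_lift _ ?_
  exact (continuous_act_left _).prodMk ((continuous_act_left (PSph.mk (e1 n))).comp continuous_theta)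

instance : SigmaCompactSpace (G n) := by
  have h : Topology.IsClosedEmbedding (Subtype.val : G n → Matrix (Fin n) (Fin n) ℝ) :=
    (isClosed_eq (Continuous.matrix_det continuous_id) continuous_const).isClosedEmbedding_subtypeVal
  have : SigmaCompactSpace (Matrix (Fin n) (Fin n) ℝ) :=
    inferInstanceAs (SigmaCompactSpace (Fin n → Fin n → ℝ))
  exact h.sigmaCompactSpace

/-- G is σ-compact, so the image of a closed subset of X is a countable union of compact sets, hence
Borel. Injectivity lets complements pass through the image. -/
theorem measurableEmbedding_orbitMap : MeasurableEmbedding (orbitMap n) where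
  injective := orbitMap_injective
  measurable := continuous_orbitMap.measurable
  measurableSet_image' := by
    have hclosed : ∀ A : Set (X n), IsClosed A → MeasurableSet (orbitMap n '' A) := by
      intro A hA
      have h1 : orbitMap n '' A = (orbitMap n ∘ X.mk) '' (X.mk ⁻¹' A) := by
        rw [Set.image_comp, Set.image_preimage_eq A X.mk_surjective]
      have h2 : IsSigmaCompact (X.mk ⁻¹' A : Set (G n)) :=
        isSigmaCompact_univ.of_isClosed_subset (hA.preimage X.continuous_mk) (Set.subset_univ _)
      obtain ⟨K, hK, hU⟩ := h2.image (continuous_orbitMap.comp X.continuous_mk)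
      rw [h1, ← hU]
      exact MeasurableSet.iUnion fun i => (hK i).isClosed.measurableSet
    intro A hA
    rw [BorelSpace.measurable_eq (α := X n), borel_eq_generateFrom_isClosed] at hA
    induction A, hA using MeasurableSpace.generateFrom_induction with
    | hC t ht _ => exact hclosed t ht
    | empty => rw [Set.image_empty]; exact MeasurableSet.empty
    | compl t _ ht =>
      rw [Set.image_compl_eq_range_sdiff_image orbitMap_injective]
      refine MeasurableSet.diff ?_ ht
      rw [← Set.image_univ]
      exact hclosed _ isClosed_univ
    | iUnion s _ hs => rw [Set.image_iUnion]; exact MeasurableSet.iUnion hs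

end Orbit

/-! ### The measure of `X` and the isometry `L²(X) ≃ L²(S̃ × S̃)` -/

theorem IsWeighted.prod {α β α' β' : Type*} [MeasurableSpace α] [MeasurableSpace β]
    [MeasurableSpace α'] [MeasurableSpace β'] {μ : Measure α} {ν : Measure β} {μ' : Measure α'}
    {ν' : Measure β'} [SFinite μ] [SFinite μ'] {e : α → β} {w : α → ℂ} {e' : α' → β'} {w' : α' → ℂ}
    (h : IsWeighted e w μ ν) (h' : IsWeighted e' w' μ' ν') [SFinite ν] [SFinite ν'] :
    IsWeighted (Prod.map e e') (fun p => w p.1 * w' p.2) (μ.prod μ') (ν.prod ν') where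
  measurable_weight := (h.measurable_weight.comp measurable_fst).mul
    (h'.measurable_weight.comp measurable_snd)
  ne_zero p := mul_ne_zero (h.ne_zero _) (h'.ne_zero _)
  preserving := by
    have h1 := h.preserving.prod h'.preserving
    rw [prod_withDensity (h.measurable_weight.enorm.pow_const 2)
      (h'.measurable_weight.enorm.pow_const 2)] at h1
    simpa only [enorm_mul, mul_pow] using h1

section OrbitMeasure

variable {n : ℕ} [NeZero n]

/-- The density `|⟨u, v⟩|⁻ⁿ` on `S̃ × S̃`. -/
noncomputable def orbitDensity (n : ℕ) (p : PSph n × PSph n) : ENNReal :=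
  ENNReal.ofReal ((absInner p.1 p.2 ^ n)⁻¹)

theorem measurable_orbitDensity : Measurable (orbitDensity n) :=
  ((continuous_absInner.measurable.pow_const n).inv).ennreal_ofReal

theorem ae_mem_range_orbitMap : ∀ᵐ p ∂(nu n).prod (nu n), p ∈ Set.range (orbitMap n) := by
  rw [range_orbitMap]
  refine (Measure.ae_prod_iff_ae_ae (p := fun p : PSph n × PSph n => absInner p.1 p.2 ≠ 0)
    (measurableSet_eq_fun continuous_absInner.measurable measurable_const).compl).2 ?_
  exact Eventually.of_forall ae_absInner_ne_zero

theorem measurePreserving_orbitMap :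
    MeasurePreserving (orbitMap n) (muX n) (((nu n).prod (nu n)).withDensity (orbitDensity n)) := by
  refine ⟨measurableEmbedding_orbitMap.measurable, ?_⟩
  rw [muX, measurableEmbedding_orbitMap.map_comap, Measure.restrict_eq_self_of_ae_mem]
  · rfl
  · exact (withDensity_absolutelyContinuous _ _).ae_le ae_mem_range_orbitMap

theorem isWeighted_actProd {μ : ℂ} (hμ : μ.re = -(n : ℝ) / 2) (x : G n) :
    IsWeighted (actProd x) (fun p => ((stretch x p.1 : ℝ) : ℂ) ^ μ *
      ((stretch (theta x) p.2 : ℝ) : ℂ) ^ μ) ((nu n).prod (nu n)) ((nu n).prod (nu n)) :=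
  (isWeighted_act x hμ).prod (isWeighted_act (theta x) hμ)

theorem absInner_actProd (x : G n) (p : PSph n × PSph n) :
    absInner (actProd x p).1 (actProd x p).2 * (stretch x p.1 * stretch (theta x) p.2) =
      absInner p.1 p.2 := absInner_act_theta x p.1 p.2

/-- The Jacobians of x and θ(x) contribute the inverse n-th powers of the two stretch factors, and
these are exactly absorbed by the transformation of |⟨u, v⟩|⁻ⁿ. -/
theorem measurePreserving_actProd (x : G n) :
    MeasurePreserving (actProd x) (((nu n).prod (nu n)).withDensity (orbitDensity n))
      (((nu n).prod (nu n)).withDensity (orbitDensity n)) := by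
  have h := isWeighted_actProd (n := n) (μ := -(n : ℂ) / 2) (by simp) x
  refine ⟨h.measurable, Measure.ext_of_lintegral _ fun F hF => ?_⟩
  rw [lintegral_map hF h.measurable, lintegral_withDensity_eq_lintegral_mul _
    measurable_orbitDensity (g := fun p => F (actProd x p)) (hF.comp h.measurable), lintegral_withDensity_eq_lintegral_mul _
    measurable_orbitDensity hF, ← h.lintegral_eq (measurable_orbitDensity.mul hF).aemeasurable]
  refine lintegral_congr fun p => ?_
  simp only [Pi.mul_apply]
  rw [← mul_assoc]
  congr 1
  have h1 := (stretch_pos x p.1).le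
  have h2 := (stretch_pos (theta x) p.2).le
  rw [enorm_mul, mul_pow, enorm_stretch_cpow_sq x _ (by simp),
    enorm_stretch_cpow_sq (theta x) _ (by simp), orbitDensity, orbitDensity, ← absInner_actProd x p,
    ← ENNReal.ofReal_mul (by positivity), ← ENNReal.ofReal_mul (by positivity)]
  congr 1
  rw [mul_pow, mul_pow, mul_inv, mul_inv, mul_comm]

theorem measurable_smul_X (x : G n) : Measurable fun p : X n => x • p := by
  refine measurableEmbedding_orbitMap.measurable_comp_iff.1 ?_
  have h : (orbitMap n ∘ fun p : X n => x • p) = actProd x ∘ orbitMap n :=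
    funext fun p => orbitMap_smul x p
  rw [h]
  exact (measurePreserving_actProd x).measurable.comp measurableEmbedding_orbitMap.measurable

theorem measurePreserving_smul_X (x : G n) :
    MeasurePreserving (fun p : X n => x • p) (muX n) (muX n) := by
  refine ⟨measurable_smul_X x, ?_⟩
  have h : (orbitMap n ∘ fun p : X n => x • p) = actProd x ∘ orbitMap n :=
    funext fun p => orbitMap_smul x p
  rw [← measurableEmbedding_orbitMap.comap_map ((muX n).map fun p => x • p),
    Measure.map_map measurableEmbedding_orbitMap.measurable (measurable_smul_X x), h,
    ← Measure.map_map (measurePreserving_actProd x).measurable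
      measurableEmbedding_orbitMap.measurable, measurePreserving_orbitMap.map_eq,
    (measurePreserving_actProd x).map_eq]
  rfl

theorem absInner_orbitMap_pos (p : X n) : 0 < absInner (orbitMap n p).1 (orbitMap n p).2 :=
  lt_of_le_of_ne (absInner_nonneg _ _) (absInner_orbitMap p).symm

/-- The squared weight is |⟨u, v⟩|ⁿ, the inverse of the density that defines the measure of X. Since
the orbit has full measure, the product measure on S̃ × S̃ is recovered. -/
theorem isWeighted_orbitMap {μ : ℂ} (hμ : μ.re = -(n : ℝ) / 2) :
    IsWeighted (orbitMap n)
      (fun p => ((absInner (orbitMap n p).1 (orbitMap n p).2 : ℝ) : ℂ) ^ (-μ)) (muX n)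
      ((nu n).prod (nu n)) where
  measurable_weight := (Complex.measurable_ofReal.comp (continuous_absInner.measurable.comp
    measurableEmbedding_orbitMap.measurable)).pow_const _
  ne_zero p := by
    rw [Ne, Complex.cpow_eq_zero_iff]
    simp [absInner_orbitMap p]
  preserving := by
    have h1 : ∀ p : X n, ‖((absInner (orbitMap n p).1 (orbitMap n p).2 : ℝ) : ℂ) ^ (-μ)‖ₑ ^ 2 =
        ENNReal.ofReal (absInner (orbitMap n p).1 (orbitMap n p).2 ^ n) := fun p => by
      have h0 := absInner_orbitMap_pos p
      rw [← ofReal_norm, Complex.norm_cpow_eq_rpow_re_of_pos h0,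
        ← ENNReal.ofReal_pow (by positivity), ← Real.rpow_natCast, ← Real.rpow_mul h0.le,
        ← Real.rpow_natCast]
      congr 2
      rw [Complex.neg_re, hμ]
      push_cast
      ring
    have hm := measurableEmbedding_orbitMap.measurable (α := X n)
    have ha : Measurable fun p : PSph n × PSph n => ENNReal.ofReal (absInner p.1 p.2 ^ n) :=
      (continuous_absInner.measurable.pow_const n).ennreal_ofReal
    refine ⟨hm, Measure.ext_of_lintegral _ fun F hF => ?_⟩
    simp_rw [h1]
    rw [lintegral_map hF hm, lintegral_withDensity_eq_lintegral_mul _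
      (f := fun p => ENNReal.ofReal (absInner (orbitMap n p).1 (orbitMap n p).2 ^ n))
      (ha.comp hm) (g := fun p => F (orbitMap n p)) (hF.comp hm)]
    have h2 := measurePreserving_orbitMap.lintegral_comp (ha.mul hF)
    refine h2.trans ?_
    rw [lintegral_withDensity_eq_lintegral_mul _ measurable_orbitDensity (ha.mul hF)]
    refine lintegral_congr_ae ?_
    filter_upwards [ae_mem_range_orbitMap] with q hq
    rw [range_orbitMap] at hq
    have h0 : 0 < absInner q.1 q.2 := lt_of_le_of_ne (absInner_nonneg _ _) (Ne.symm hq)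
    simp only [Pi.mul_apply, orbitDensity]
    rw [← mul_assoc, ← ENNReal.ofReal_mul (by positivity), inv_mul_cancel₀ (by positivity),
      ENNReal.ofReal_one, one_mul]

theorem lowered_orbitMap (σ : ℝ) (f : X n → ℂ) (p : X n) : lowered σ f (orbitMap n p) =
    f p * (absInner (orbitMap n p).1 (orbitMap n p).2 : ℂ) ^ param n σ :=
  orbitMap_injective.extend_apply _ _ _

theorem weight_mul_lowered (σ : ℝ) (f : X n → ℂ) (p : X n) :
    ((absInner (orbitMap n p).1 (orbitMap n p).2 : ℝ) : ℂ) ^ (-param n σ) *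
      lowered σ f (orbitMap n p) = f p := by
  have h : ((absInner (orbitMap n p).1 (orbitMap n p).2 : ℝ) : ℂ) ≠ 0 := by
    exact_mod_cast absInner_orbitMap p
  rw [lowered_orbitMap, mul_left_comm, ← Complex.cpow_add _ _ h, neg_add_cancel, Complex.cpow_zero,
    mul_one]

theorem memLp_lowered (σ : ℝ) (f : L2X n) : MemLp (lowered σ f) 2 ((nu n).prod (nu n)) := by
  have hm : AEStronglyMeasurable (lowered σ f) ((nu n).prod (nu n)) := by
    refine Measurable.aestronglyMeasurable ?_
    refine measurableEmbedding_orbitMap.measurable_extend ?_ measurable_const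
    refine (Lp.stronglyMeasurable f).measurable.mul ?_
    exact (Complex.measurable_ofReal.comp (continuous_absInner.measurable.comp
      measurableEmbedding_orbitMap.measurable)).pow_const _
  refine ⟨hm, ?_⟩
  rw [← (isWeighted_orbitMap (param_re (n := n) σ)).eLpNorm_eq hm]
  simp_rw [weight_mul_lowered]
  exact (Lp.memLp f).2

/-- The inverse of `lowered` as an isometry. -/
noncomputable def raise (n : ℕ) [NeZero n] (σ : ℝ) : L2SS n →ₗᵢ[ℂ] L2X n :=
  (isWeighted_orbitMap (param_re (n := n) σ)).toLpIsometry

theorem raise_lowered (σ : ℝ) (f : L2X n) : raise n σ ((memLp_lowered σ f).toLp _) = f := by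
  refine Lp.ext ?_
  filter_upwards [(isWeighted_orbitMap (param_re (n := n) σ)).toLpIsometry_toLp
    (memLp_lowered σ f)] with p hp
  rw [raise, hp, weight_mul_lowered]

/-- `lowered` as a unitary operator. -/
noncomputable def lower (n : ℕ) [NeZero n] (σ : ℝ) : L2X n ≃ₗᵢ[ℂ] L2SS n :=
  (LinearIsometryEquiv.ofSurjective (raise n σ) fun f => ⟨_, raise_lowered σ f⟩).symm

theorem raise_lower (σ : ℝ) (f : L2X n) : raise n σ (lower n σ f) = f :=
  (LinearIsometryEquiv.ofSurjective (raise n σ) fun f => ⟨_, raise_lowered σ f⟩).apply_symm_apply f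

theorem lower_eq (σ : ℝ) (f : L2X n) : lower n σ f = (memLp_lowered σ f).toLp _ :=
  (raise n σ).injective (by rw [raise_lower, raise_lowered])

/-! #### Covariance -/

/-- The action of `G` on `L²(S̃ × S̃)`. -/
noncomputable def repProd (μ : ℂ) (hμ : μ.re = -(n : ℝ) / 2) (x : G n) : L2SS n →ₗᵢ[ℂ] L2SS n :=
  (isWeighted_actProd hμ x⁻¹).toLpIsometry

/-- The multipliers of π_μ(x) and π_μ(θ(x)) cancel the change of |⟨u, v⟩|^(-μ) given by
`absInner_actProd`, which leaves plain translation on X. -/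
theorem raise_repProd (σ : ℝ) (x : G n) (F : L2SS n) :
    raise n σ (repProd (param n σ) (param_re σ) x F) =
      leftTranslate measurePreserving_smul_X x (raise n σ F) := by
  have hw := isWeighted_orbitMap (param_re (n := n) σ)
  have hT := isWeighted_actProd (param_re (n := n) σ) x⁻¹
  refine Lp.ext ?_
  filter_upwards [hw.toLpIsometry_coeFn (repProd (param n σ) (param_re σ) x F),
    hw.quasiMeasurePreserving.ae (hT.toLpIsometry_coeFn F),
    Lp.coeFn_compMeasurePreserving (raise n σ F) (measurePreserving_smul_X x⁻¹),
    (measurePreserving_smul_X x⁻¹).quasiMeasurePreserving.ae (hw.toLpIsometry_coeFn F)]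
    with p h1 h2 h3 h4
  rw [raise, h1, repProd, h2, leftTranslate, ← raise, h3, Function.comp_apply, raise, h4,
    orbitMap_smul]
  have h5 := absInner_actProd x⁻¹ (orbitMap n p)
  have h6 := absInner_orbitMap_pos (x⁻¹ • p)
  rw [orbitMap_smul] at h6
  have h7 := stretch_pos x⁻¹ (orbitMap n p).1
  have h8 := stretch_pos (theta x⁻¹) (orbitMap n p).2
  rw [← h5, Complex.ofReal_mul, Complex.mul_cpow_ofReal_nonneg h6.le (mul_pos h7 h8).le]
  have h9 : ((stretch x⁻¹ (orbitMap n p).1 * stretch (theta x⁻¹) (orbitMap n p).2 : ℝ) : ℂ) ^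
      (-param n σ) * (((stretch x⁻¹ (orbitMap n p).1 : ℝ) : ℂ) ^ param n σ *
        ((stretch (theta x⁻¹) (orbitMap n p).2 : ℝ) : ℂ) ^ param n σ) = 1 := by
    rw [← Complex.mul_cpow_ofReal_nonneg h7.le h8.le, ← Complex.ofReal_mul,
      ← Complex.cpow_add _ _
      (by exact_mod_cast (mul_pos h7 h8).ne'), neg_add_cancel, Complex.cpow_zero]
  linear_combination (((absInner (actProd x⁻¹ (orbitMap n p)).1
    (actProd x⁻¹ (orbitMap n p)).2 : ℝ) : ℂ) ^ (-param n σ) *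
    F (actProd x⁻¹ (orbitMap n p))) * h9

instance : SecondCountableTopology (LL (nu n)) := by
  have : Fact ((2 : ENNReal) ≠ ⊤) := ⟨by simp⟩
  infer_instance

theorem repProd_eq (μ : ℂ) (hμ : μ.re = -(n : ℝ) / 2) (x : G n) (F : L2SS n) :
    repProd μ hμ x F = ampL (repUnitary μ hμ x : L2S n →L[ℂ] L2S n)
      (amp (repUnitary μ hμ (theta x) : L2S n →L[ℂ] L2S n) F) := by
  have h : (repProd μ hμ x).toContinuousLinearMap =
      ampL (repUnitary μ hμ x : L2S n →L[ℂ] L2S n) ∘L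
        amp (repUnitary μ hμ (theta x) : L2S n →L[ℂ] L2S n) := by
    refine ext_tensor fun a b => ?_
    rw [ContinuousLinearMap.comp_apply, amp_tensor, ampL_tensor, repUnitary_apply, repUnitary_apply]
    refine Lp.ext ?_
    have hT := isWeighted_actProd hμ x⁻¹
    filter_upwards [hT.toLpIsometry_coeFn (tensor a b),
      hT.quasiMeasurePreserving.ae (tensor_coeFn a b),
      tensor_coeFn (repIsometry μ hμ x a) (repIsometry μ hμ (theta x) b),
      ae_fst (repIsometry_coeFn hμ x a), ae_snd (repIsometry_coeFn hμ (theta x) b)]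
      with p h1 h2 h3 h4 h5
    rw [h3, h4, h5]
    refine h1.trans ?_
    rw [h2, actProd, theta_inv]
    simp only [Prod.map_fst, Prod.map_snd]
    ring
  exact congrArg (fun T : L2SS n →L[ℂ] L2SS n => T F) h

theorem lower_leftTranslate (σ : ℝ) (x : G n) (f : L2X n) :
    lower n σ (leftTranslate measurePreserving_smul_X x f) =
      ampL (repUnitary (param n σ) (param_re σ) x : L2S n →L[ℂ] L2S n)
        (amp (repUnitary (param n σ) (param_re σ) (theta x) : L2S n →L[ℂ] L2S n)
          (lower n σ f)) := by
  rw [← repProd_eq]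
  refine (raise n σ).injective ?_
  rw [raise_lower, raise_repProd, raise_lower]

end OrbitMeasure

/-! ### The symbolic calculus -/

section SymbolicCalculus

variable {n : ℕ} [NeZero n] {σ : ℝ}

/-- The unitary operator `T_σ`. -/
noncomputable def kernelEquiv (n : ℕ) [NeZero n] (hσ : σ ≠ 0) : L2X n ≃ₗᵢ[ℂ] L2SS n :=
  (lower n σ).trans (ampEquiv (intertwiner n hσ))

theorem kernelEquiv_apply (hσ : σ ≠ 0) (f : L2X n) :
    kernelEquiv n hσ f = amp (intertwiner n hσ : L2S n →L[ℂ] L2S n) (lower n σ f) := rfl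

theorem fib_lower (f : L2X n) : ∀ᵐ u ∂(nu n),
    ∃ h : MemLp (fun w => lowered σ f (u, w)) 2 (nu n), fib (lower n σ f) u = h.toLp _ := by
  filter_upwards [memLp_section (memLp_lowered σ f), fib_coeFn (lower n σ f),
    Measure.ae_ae_of_ae_prod (memLp_lowered σ f).coeFn_toLp] with u h1 h2 h3
  refine ⟨h1, Lp.ext ?_⟩
  rw [lower_eq] at h2 ⊢
  exact h2.trans (EventuallyEq.trans h3 h1.coeFn_toLp.symm)

theorem isT_kernelEquiv (hn : 2 ≤ n) (hσ : σ ≠ 0) (f : L2X n) : IsT σ f (kernelEquiv n hσ f) := by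
  refine ⟨_, isIntertwiner_intertwiner hn hσ, ?_⟩
  filter_upwards [fib_lower (σ := σ) f, fib_coeFn (kernelEquiv n hσ f),
    fib_amp (intertwiner n hσ : L2S n →L[ℂ] L2S n) (lower n σ f)] with u h1 h2 h3
  obtain ⟨h, h1⟩ := h1
  refine ⟨h, h2.symm.trans ?_⟩
  rw [kernelEquiv_apply, h3, h1]

/-- The intertwiner is unique and a kernel is determined by almost all of its fibres, so T_σ f
admits no other value. The uniqueness of `Op` follows. -/
theorem IsT.eq_kernelEquiv (hn : 2 ≤ n) (hσ : σ ≠ 0) {f : L2X n} {k : L2SS n} (hk : IsT σ f k) :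
    k = kernelEquiv n hσ f := by
  obtain ⟨U, hU, hk⟩ := hk
  obtain rfl := hU.unique (isIntertwiner_intertwiner hn hσ)
  refine eq_of_fib_eq ?_
  filter_upwards [hk, fib_lower (σ := σ) f, fib_coeFn k,
    fib_amp (intertwiner n hσ : L2S n →L[ℂ] L2S n) (lower n σ f)] with u h1 h2 h3 h4
  obtain ⟨h, h1⟩ := h1
  obtain ⟨h', h2⟩ := h2
  rw [kernelEquiv_apply, h4, h2]
  exact Lp.ext (h3.trans h1)

/-- The symbolic calculus `Op_σ`. -/
noncomputable def symbolicCalculus (n : ℕ) [NeZero n] (hσ : σ ≠ 0) :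
    L2X n →ₗ[ℂ] (L2S n →L[ℂ] L2S n) :=
  (kint : KK (nu n) →L[ℂ] _).toLinearMap ∘ₗ (kernelEquiv n hσ).toLinearEquiv.toLinearMap

theorem symbolicCalculus_apply (hσ : σ ≠ 0) (f : L2X n) :
    symbolicCalculus n hσ f = kint (kernelEquiv n hσ f) := rfl

theorem isSymbolicCalculus_symbolicCalculus (hn : 2 ≤ n) (hσ : σ ≠ 0) :
    IsSymbolicCalculus σ (symbolicCalculus n hσ) := fun f =>
  ⟨kernelEquiv n hσ f, isT_kernelEquiv hn hσ f, fun φ => kint_coeFn _ φ⟩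

theorem IsSymbolicCalculus.eq (hn : 2 ≤ n) (hσ : σ ≠ 0) {Op : L2X n →ₗ[ℂ] (L2S n →L[ℂ] L2S n)}
    (h : IsSymbolicCalculus σ Op) : Op = symbolicCalculus n hσ := by
  ext1 f
  obtain ⟨k, hk, h⟩ := h f
  obtain rfl := hk.eq_kernelEquiv hn hσ
  ext1 φ
  exact Lp.ext ((h φ).trans (kint_coeFn _ φ).symm)

/-! #### Covariance -/

theorem conjL_rep {μ : ℂ} (hμ : μ.re = -(n : ℝ) / 2) (hμ' : (conj μ).re = -(n : ℝ) / 2) (x : G n)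
    (φ : L2S n) : conjL (nu n) (repIsometry μ hμ x φ) =
      repIsometry (conj μ) hμ' x (conjL (nu n) φ) := by
  refine Lp.ext ?_
  filter_upwards [conjL_coeFn (repIsometry μ hμ x φ), repIsometry_coeFn hμ x φ,
    repIsometry_coeFn hμ' x (conjL (nu n) φ),
    (isWeighted_act x⁻¹ hμ).quasiMeasurePreserving.ae (conjL_coeFn φ)] with u h1 h2 h3 h4
  rw [h1, h2, h3, h4, map_mul]
  congr 1
  have harg : Complex.arg ((stretch x⁻¹ u : ℝ) : ℂ) ≠ Real.pi := by
    rw [Complex.arg_ofReal_of_nonneg (stretch_pos _ _).le]; exact Real.pi_ne_zero.symm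
  have := Complex.cpow_conj ((stretch x⁻¹ u : ℝ) : ℂ) μ harg
  rw [this, Complex.conj_ofReal]

/-- The adjoint of a unitary representation is its inverse, and the surrounding complex conjugations
change μ̄ into μ. -/
theorem transposeOp_repUnitary {μ : ℂ} (hμ : μ.re = -(n : ℝ) / 2)
    (hμ' : (conj μ).re = -(n : ℝ) / 2) (x : G n) :
    transposeOp (repUnitary (conj μ) hμ' x : L2S n →L[ℂ] L2S n) =
      (repUnitary μ hμ x⁻¹ : L2S n →L[ℂ] L2S n) := by
  have h1 : ContinuousLinearMap.adjoint (repUnitary (conj μ) hμ' x : L2S n →L[ℂ] L2S n) =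
      (repUnitary (conj μ) hμ' x⁻¹ : L2S n →L[ℂ] L2S n) := by
    rw [map_inv]
    rfl
  rw [transposeOp, h1]
  ext1 φ
  rw [conjOp_apply, repUnitary_apply, repUnitary_apply]
  exact (conjL _).injective (by rw [conjL_conjL, conjL_rep hμ hμ'])

theorem intertwiner_comp_repUnitary (hσ : σ ≠ 0) (x : G n) :
    (intertwiner n hσ : L2S n →L[ℂ] L2S n) ∘L
        (repUnitary (param n σ) (param_re σ) (theta x) : L2S n →L[ℂ] L2S n) =
      (repUnitary (conj (param n σ)) (conj_param_re σ) x : L2S n →L[ℂ] L2S n) ∘L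
        (intertwiner n hσ : L2S n →L[ℂ] L2S n) := by
  ext1 φ
  have h := intertwiner_rep hσ (theta x) φ
  rw [theta_theta] at h
  exact h

/-- Translation of f acts on the lowered kernel as π_μ(x) ⊗ π_μ(θ(x)). The first factor multiplies
the operator on the left. U_σ turns the second into π_{μ̄}(x), which acts on the right through its
transpose π_μ(x⁻¹). -/
theorem symbolicCalculus_leftTranslate (hσ : σ ≠ 0) (x : G n) (f : L2X n) :
    symbolicCalculus n hσ (leftTranslate measurePreserving_smul_X x f) =
      (repUnitary (param n σ) (param_re σ) x : L2S n →L[ℂ] L2S n) ∘L symbolicCalculus n hσ f ∘L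
        (repUnitary (param n σ) (param_re σ) x⁻¹ : L2S n →L[ℂ] L2S n) := by
  rw [symbolicCalculus_apply, symbolicCalculus_apply, kernelEquiv_apply, lower_leftTranslate,
    ← ContinuousLinearMap.comp_apply (amp _), amp_ampL_comm, ContinuousLinearMap.comp_apply,
    kint_ampL,
    ← ContinuousLinearMap.comp_apply (amp _), ← amp_comp, intertwiner_comp_repUnitary, amp_comp,
    ContinuousLinearMap.comp_apply, ← kernelEquiv_apply, kint_amp,
    transposeOp_repUnitary (param_re σ)]

end SymbolicCalculus

end ParaHermitian

/-! ### The theorem on the calculus `Op` -/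

open ParaHermitian in
theorem mainTheorem3 (n : ℕ) [NeZero n] (hn : 2 ≤ n) (σ : ℝ) (hσ : σ ≠ 0) :
    (∃! Op : L2X n →ₗ[ℂ] (L2S n →L[ℂ] L2S n), IsSymbolicCalculus σ Op) ∧
    ∀ Op : L2X n →ₗ[ℂ] (L2S n →L[ℂ] L2S n), IsSymbolicCalculus σ Op →
      ∃ (sharp : L2X n → L2X n → L2X n) (star : L2X n → L2X n),
        (∀ f g h : L2X n, Op h = Op f ∘L Op g ↔ h = sharp f g) ∧
        (∀ f h : L2X n, Op h = ContinuousLinearMap.adjoint (Op f) ↔ h = star f) ∧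
        IsHStarAlgebra (L2X n) sharp star ∧
        ∃ (hinv : ∀ x : G n, MeasurePreserving (fun p : X n => x • p) (muX n) (muX n))
          (π : G n →* unitary (L2S n →L[ℂ] L2S n)),
          IsPiPlus (param n σ) π ∧
          (∀ (x : G n) (f : L2X n),
            Op (leftTranslate hinv x f) =
              (π x : L2S n →L[ℂ] L2S n) ∘L Op f ∘L (π x⁻¹ : L2S n →L[ℂ] L2S n)) ∧
          (∀ (x : G n) (f g : L2X n),
            leftTranslate hinv x (sharp f g) =
              sharp (leftTranslate hinv x f) (leftTranslate hinv x g)) := by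
  have hJ := kint_comp_injective (kernelEquiv n hσ)
  refine ⟨⟨symbolicCalculus n hσ, isSymbolicCalculus_symbolicCalculus hn hσ,
    fun Op h => h.eq hn hσ⟩, fun Op hOp => ?_⟩
  obtain rfl := hOp.eq hn hσ
  refine ⟨sharpOf (kernelEquiv n hσ), starOf (kernelEquiv n hσ), fun f g h => ?_, fun f h => ?_,
    isHStarAlgebra_transport _, measurePreserving_smul_X,
    repUnitary (param n σ) (param_re σ), isPiPlus_repUnitary _,
    symbolicCalculus_leftTranslate hσ, fun x f g => hJ ?_⟩
  · simp only [symbolicCalculus_apply]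
    rw [← kint_sharpOf]
    exact hJ.eq_iff
  · simp only [symbolicCalculus_apply]
    rw [← kint_starOf]
    exact hJ.eq_iff
  · have h := symbolicCalculus_leftTranslate (n := n) hσ x
    simp only [symbolicCalculus_apply] at h
    simp only [kint_sharpOf, h]
    ext1 φ
    simp only [ContinuousLinearMap.comp_apply]
    -- In π(x) A π(x⁻¹) π(x) B π(x⁻¹) the two inner factors cancel, so conjugation by π(x) is
    -- multiplicative and the covariance passes to the product.
    have h1 : ∀ ψ : L2S n, (repUnitary (param n σ) (param_re σ) x⁻¹ : L2S n →L[ℂ] L2S n)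
        ((repUnitary (param n σ) (param_re σ) x : L2S n →L[ℂ] L2S n) ψ) = ψ := fun ψ => by
      rw [repUnitary_apply, repUnitary_apply, ← repIsometry_mul, inv_mul_cancel, repIsometry_one]
    rw [h1]
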